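/- Let $K$ be a field of characteristic $0$, let $G$ be a split connected reductive group over $K$ with center $Z_G$, adjoint group $G^{\mathrm{ad}}=G/Z_G$, derived group $G^{\mathrm{der}}$ and maximal abelian quotient $b\colon G\to A$, and let $\Gamma$ be a finitely generated group. Let $\gamma_1,\dots,\gamma_N\in\Gamma$, and let $\mathcal K_1,\dots,\mathcal K_N\subset G$ be conjugacy classes defined over $K$, regarded as reduced locally closed subschemes of $G$. Let $\rho_0\colon\Gamma\to G(K)$ be a $G$-irreducible representation (for every algebraically closed field $\Omega\supseteq K$ the image of $\rho_0$ in $G(\Omega)$ lies in no proper parabolic subgroup) with $\rho_0(\gamma_i)\in\mathcal K_i(K)$ for all $i$, and put $\theta=b\circ\rho_0\colon\Gamma\to A(K)$. Let $\mathrm{Rep}_G(\Gamma,\theta)$ be the affine $K$-scheme of representations $\rho$ of $\Gamma$ in $G$ with $b\circ\rho=\theta$, on which $G^{\mathrm{ad}}$ acts by conjugation. Let $M$ be the substack of the quotient stack $[\mathrm{Rep}_G(\Gamma,\theta)/G^{\mathrm{ad}}]$ whose objects over a $K$-scheme $T$ are the pairs $(\mathcal E,f)$, with $\mathcal E\to T$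 a $G^{\mathrm{ad}}$-torsor and $f\colon\mathcal E\to\mathrm{Rep}_G(\Gamma,\theta)$ a $G^{\mathrm{ad}}$-equivariant morphism, such that the representations of $\Gamma$ given by $f$ at all geometric points of $\mathcal E$ are $G$-irreducible and the morphisms $\mathcal E\to G$, $e\mapsto f(e)(\gamma_i)$, factor through $\mathcal K_i$ for $i=1,\dots,N$. Let $[\rho_0]=(G^{\mathrm{ad}},\,g\mapsto g\rho_0g^{-1})\in M(K)$. Let the Zariski tangent space $T_{[\rho_0]}M$ be the set of isomorphism classes of objects of $M(K[\varepsilon])$, $\varepsilon^2=0$, equipped with an isomorphism of their restriction to $K$ with $[\rho_0]$; its scalar multiplication is given by pullback along $\varepsilon\mapsto c\varepsilon$, and $v_1+v_2$ is the pullback along $\varepsilon_1,\varepsilon_2\mapsto\varepsilon$ of the object over $K[\varepsilon_1,\varepsilon_2]/(\varepsilon_1,\varepsilon_2)^2$ that restricts to $v_1$ and to $v_2$. Let $\mathfrak g^{\mathrm{der}}$ be the Lie algebra of $G^{\mathrm{der}}$, on which $\Gamma$ acts through $\mathrm{Ad}\circ\rho_0$. Then these operations are well defined on $T_{[\rho_0]}M$,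 and there is a $K$-linear isomorphism $$T_{[\rho_0]}M\;\cong\;\ker\Bigl(H^1(\Gamma,\mathfrak g^{\mathrm{der}})\xrightarrow{\ \mathrm{res}\ }\bigoplus_{i=1}^N H^1(\langle\gamma_i\rangle,\mathfrak g^{\mathrm{der}})\Bigr).$$ It sends $(\mathcal E,f)$ to the class of the cocycle $\alpha$ with $\rho(\gamma)\rho_0(\gamma)^{-1}=1+\varepsilon\,\alpha(\gamma)$, where $\rho=f(s)\colon\Gamma\to G(K[\varepsilon])$ for any section $s$ of $\mathcal E$ over $K[\varepsilon]$ that extends the identity section of $G^{\mathrm{ad}}$ over $K$; such a section always exists. -/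

import Mathlib

open scoped TensorProduct

universe u

noncomputable section

namespace RepModuli

/-! ### Affine group schemes as group functors

An affine group scheme `G` over a field `K` is given by its coordinate ring, a commutative Hopf
algebra `A` over `K`; its points in a commutative `K`-algebra `R` are the algebra maps `A → R`. -/

/-- The set `G(R)` of `R`-points of the affine group scheme `G = Spec A`. -/
@[ext]
structure Pt (K A R : Type u) [CommRing K] [CommRing A] [Algebra K A] [CommRing R] [Algebra K R] where
  /-- The algebra map `A → R` that is the given point. -/
  hom : A →ₐ[K] R

section Points

variable {K A R S : Type u} [Field K] [CommRing A] [HopfAlgebra K A]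
  [CommRing R] [Algebra K R] [CommRing S] [Algebra K S]

instance : Mul (Pt K A R) :=
  ⟨fun x y => ⟨(Algebra.TensorProduct.lift x.hom y.hom (fun _ _ => .all _ _)).comp
    (Bialgebra.comulAlgHom K A)⟩⟩

instance : One (Pt K A R) := ⟨⟨(Algebra.ofId K R).comp (Bialgebra.counitAlgHom K A)⟩⟩

instance : Inv (Pt K A R) := ⟨fun x => ⟨x.hom.comp (HopfAlgebra.antipodeAlgHom K A)⟩⟩

theorem Pt.mul_hom (x y : Pt K A R) :
    (x * y).hom = (Algebra.TensorProduct.lift x.hom y.hom (fun _ _ => .all _ _)).comp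
      (Bialgebra.comulAlgHom K A) := rfl

theorem Pt.one_hom :
    (1 : Pt K A R).hom = (Algebra.ofId K R).comp (Bialgebra.counitAlgHom K A) := rfl

theorem Pt.inv_hom (x : Pt K A R) :
    (x⁻¹).hom = x.hom.comp (HopfAlgebra.antipodeAlgHom K A) := rfl

theorem Pt.mul_apply_repr (x y : Pt K A R) {ι : Type*} {a : A} (r : Coalgebra.Repr K a ι) :
    (x * y).hom a = ∑ i ∈ r.index, x.hom (r.left i) * y.hom (r.right i) := by
  rw [Pt.mul_hom, AlgHom.comp_apply, Bialgebra.comulAlgHom_apply, ← r.eq, map_sum]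
  simp

theorem Pt.toConv_mul (x y : Pt K A R) :
    WithConv.toConv (x * y).hom = WithConv.toConv x.hom * WithConv.toConv y.hom := by
  apply WithConv.ofConv_injective
  ext a
  exact (AlgHom.convMul_apply (WithConv.toConv x.hom) (WithConv.toConv y.hom) a).symm

theorem Pt.toConv_injective :
    Function.Injective (fun x : Pt K A R => WithConv.toConv x.hom) := by
  intro x y h
  exact Pt.ext (WithConv.toConv_injective h)

/-- The group law of `G(R)`: convolution. -/
instance : Group (Pt K A R) where
  mul_assoc x y z := by
    apply Pt.toConv_injective
    simp only [Pt.toConv_mul, mul_assoc]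
  one_mul x := by
    apply Pt.toConv_injective
    simp only [Pt.toConv_mul]
    exact one_mul _
  mul_one x := by
    apply Pt.toConv_injective
    simp only [Pt.toConv_mul]
    exact mul_one _
  inv_mul_cancel x := by
    ext a
    rw [Pt.mul_apply_repr _ _ (Coalgebra.Repr.arbitrary K a)]
    have h := congrArg x.hom
      (HopfAlgebra.sum_antipode_mul_eq_algebraMap_counit (Coalgebra.Repr.arbitrary K a))
    simp only [map_sum, map_mul] at h
    simp only [Pt.inv_hom, AlgHom.comp_apply, HopfAlgebra.antipodeAlgHom_apply, Pt.one_hom]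
    rw [h]
    simp [Algebra.ofId_apply]

/-- Functoriality of points: `G(R) → G(S)` for `φ : R → S`. -/
def Pt.map (φ : R →ₐ[K] S) : Pt K A R →* Pt K A S where
  toFun x := ⟨φ.comp x.hom⟩
  map_one' := by ext a; simp [Pt.one_hom, Algebra.ofId_apply]
  map_mul' x y := by
    ext a
    simp only [AlgHom.comp_apply]
    rw [Pt.mul_apply_repr _ _ (Coalgebra.Repr.arbitrary K a),
      Pt.mul_apply_repr _ _ (Coalgebra.Repr.arbitrary K a)]
    simp

@[simp] theorem Pt.map_hom (φ : R →ₐ[K] S) (x : Pt K A R) :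
    (Pt.map φ x).hom = φ.comp x.hom := rfl

theorem Pt.map_map {T : Type u} [CommRing T] [Algebra K T] (φ : R →ₐ[K] S) (ψ : S →ₐ[K] T)
    (x : Pt K A R) : Pt.map ψ (Pt.map φ x) = Pt.map (ψ.comp φ) x := rfl

theorem Pt.map_ofId (φ : R →ₐ[K] S) (x : Pt K A K) :
    Pt.map φ (Pt.map (Algebra.ofId K R) x) = Pt.map (Algebra.ofId K S) x := by
  rw [Pt.map_map, Subsingleton.elim (φ.comp (Algebra.ofId K R)) (Algebra.ofId K S)]

theorem Pt.map_injective {φ : R →ₐ[K] S} (h : Function.Injective φ) :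
    Function.Injective (Pt.map φ : Pt K A R →* Pt K A S) := by
  intro x y hxy
  ext a
  exact h (congrArg (fun t : Pt K A S => t.hom a) hxy)

/-- The universal point `id ∈ G(A)`. -/
def Pt.univ (K A : Type u) [Field K] [CommRing A] [HopfAlgebra K A] : Pt K A A := ⟨AlgHom.id K A⟩

@[simp] theorem Pt.map_univ (x : Pt K A R) : Pt.map x.hom (Pt.univ K A) = x := rfl

end Points

/-! ### Hopf subalgebras -/

section Sub

variable {K A : Type u} [Field K] [CommRing A] [HopfAlgebra K A]

/-- `C ⊆ A` is a Hopf subalgebra: stable under comultiplication and antipode. Such `C` are the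
coordinate rings of the quotient groups of `G`. -/
structure IsHopfSubalgebra (C : Subalgebra K A) : Prop where
  comul_mem : ∀ c ∈ C, Coalgebra.comul (R := K) c ∈ (Algebra.TensorProduct.map C.val C.val).range
  antipode_mem : ∀ c ∈ C, HopfAlgebra.antipode K c ∈ C

theorem val_map_injective (C : Subalgebra K A) {V W : Type u} [AddCommGroup V] [Module K V]
    [AddCommGroup W] [Module K W] (f : V →ₗ[K] W) (hf : Function.Injective f) :
    Function.Injective (TensorProduct.map C.val.toLinearMap f) :=
  TensorProduct.map_injective_of_flat_flat _ _ Subtype.val_injective hf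

theorem valval_injective (C : Subalgebra K A) :
    Function.Injective (Algebra.TensorProduct.map C.val C.val) :=
  val_map_injective C C.val.toLinearMap Subtype.val_injective

/-- The comultiplication of a Hopf subalgebra. -/
def IsHopfSubalgebra.comul {C : Subalgebra K A} (h : IsHopfSubalgebra C) : C →ₐ[K] C ⊗[K] C :=
  (AlgEquiv.ofInjective _ (valval_injective C)).symm.toAlgHom.comp
    (((Bialgebra.comulAlgHom K A).comp C.val).codRestrict _ (fun c => h.comul_mem c c.2))

theorem IsHopfSubalgebra.val_comul {C : Subalgebra K A} (h : IsHopfSubalgebra C) (c : C) :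
    Algebra.TensorProduct.map C.val C.val (h.comul c) = Coalgebra.comul (R := K) (c : A) := by
  have := (AlgEquiv.ofInjective _ (valval_injective C)).apply_symm_apply
    (((Bialgebra.comulAlgHom K A).comp C.val).codRestrict _ (fun c => h.comul_mem c c.2) c)
  exact congrArg Subtype.val this

theorem IsHopfSubalgebra.val_comul_comp {C : Subalgebra K A} (h : IsHopfSubalgebra C) :
    (Algebra.TensorProduct.map C.val C.val).comp h.comul =
      (Bialgebra.comulAlgHom K A).comp C.val :=
  AlgHom.ext h.val_comul

/-- The bialgebra structure of a Hopf subalgebra. -/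
abbrev IsHopfSubalgebra.bialgebra {C : Subalgebra K A} (h : IsHopfSubalgebra C) : Bialgebra K C :=
  Bialgebra.ofAlgHom h.comul ((Bialgebra.counitAlgHom K A).comp C.val)
    (by
      have hinj : Function.Injective
          (Algebra.TensorProduct.map C.val (Algebra.TensorProduct.map C.val C.val)) :=
        val_map_injective C (Algebra.TensorProduct.map C.val C.val).toLinearMap (valval_injective C)
      have h1 : (Algebra.TensorProduct.map C.val (Algebra.TensorProduct.map C.val C.val)).comp
          ((Algebra.TensorProduct.assoc K K K C C C).toAlgHom.comp
            (Algebra.TensorProduct.map h.comul (.id K C))) =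
          ((Algebra.TensorProduct.assoc K K K A A A).toAlgHom.comp
            (Algebra.TensorProduct.map (Bialgebra.comulAlgHom K A) (.id K A))).comp
            (Algebra.TensorProduct.map C.val C.val) := by
        have h2 : (Algebra.TensorProduct.map C.val (Algebra.TensorProduct.map C.val C.val)).comp
            (Algebra.TensorProduct.assoc K K K C C C).toAlgHom =
            (Algebra.TensorProduct.assoc K K K A A A).toAlgHom.comp
              (Algebra.TensorProduct.map (Algebra.TensorProduct.map C.val C.val) C.val) := by
          ext <;> simp [Algebra.TensorProduct.one_def]
        rw [← AlgHom.comp_assoc, h2, AlgHom.comp_assoc, AlgHom.comp_assoc,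
          ← Algebra.TensorProduct.map_comp, ← Algebra.TensorProduct.map_comp, h.val_comul_comp]
        rfl
      have h3 : (Algebra.TensorProduct.map C.val (Algebra.TensorProduct.map C.val C.val)).comp
          (Algebra.TensorProduct.map (.id K C) h.comul) =
          (Algebra.TensorProduct.map (.id K A) (Bialgebra.comulAlgHom K A)).comp
            (Algebra.TensorProduct.map C.val C.val) := by
        rw [← Algebra.TensorProduct.map_comp, ← Algebra.TensorProduct.map_comp, h.val_comul_comp]
        rfl
      ext c
      apply hinj
      have e1 := DFunLike.congr_fun h1 (h.comul c)
      have e3 := DFunLike.congr_fun h3 (h.comul c)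
      simp only [AlgHom.comp_apply] at e1 e3 ⊢
      rw [e1, e3, h.val_comul]
      exact Coalgebra.coassoc_apply (R := K) (c : A))
    (by
      ext c
      apply (show Function.Injective (Algebra.TensorProduct.map (AlgHom.id K K) C.val) from
          TensorProduct.map_injective_of_flat_flat (LinearMap.id : K →ₗ[K] K) C.val.toLinearMap
            Function.injective_id Subtype.val_injective)
      have h1 : (Algebra.TensorProduct.map (AlgHom.id K K) C.val).comp
          (Algebra.TensorProduct.map ((Bialgebra.counitAlgHom K A).comp C.val) (.id K C)) =
          (Algebra.TensorProduct.map (Bialgebra.counitAlgHom K A) (.id K A)).comp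
            (Algebra.TensorProduct.map C.val C.val) := by
        rw [← Algebra.TensorProduct.map_comp, ← Algebra.TensorProduct.map_comp]
        rfl
      have e1 := DFunLike.congr_fun h1 (h.comul c)
      simp only [AlgHom.comp_apply] at e1 ⊢
      rw [e1, h.val_comul]
      have := Coalgebra.rTensor_counit_comul (R := K) (c : A)
      refine this.trans ?_
      simp)
    (by
      ext c
      apply (show Function.Injective (Algebra.TensorProduct.map C.val (AlgHom.id K K)) from
          val_map_injective C (LinearMap.id : K →ₗ[K] K) Function.injective_id)
      have h1 : (Algebra.TensorProduct.map C.val (AlgHom.id K K)).comp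
          (Algebra.TensorProduct.map (.id K C) ((Bialgebra.counitAlgHom K A).comp C.val)) =
          (Algebra.TensorProduct.map (.id K A) (Bialgebra.counitAlgHom K A)).comp
            (Algebra.TensorProduct.map C.val C.val) := by
        rw [← Algebra.TensorProduct.map_comp, ← Algebra.TensorProduct.map_comp]
        rfl
      have e1 := DFunLike.congr_fun h1 (h.comul c)
      simp only [AlgHom.comp_apply] at e1 ⊢
      rw [e1, h.val_comul]
      have := Coalgebra.lTensor_counit_comul (R := K) (c : A)
      refine this.trans ?_
      simp)

/-- The Hopf algebra structure of a Hopf subalgebra. -/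
abbrev IsHopfSubalgebra.hopfAlgebra {C : Subalgebra K A} (h : IsHopfSubalgebra C) :
    HopfAlgebra K C where
  toBialgebra := h.bialgebra
  antipode := ((HopfAlgebra.antipode K).comp C.val.toLinearMap).codRestrict
    (Subalgebra.toSubmodule C) (fun c => h.antipode_mem c c.2)
  mul_antipode_rTensor_comul := by
    ext c
    have h1 : C.val.toLinearMap ∘ₗ LinearMap.mul' K C ∘ₗ
        (((HopfAlgebra.antipode K).comp C.val.toLinearMap).codRestrict
          (Subalgebra.toSubmodule C) (fun c => h.antipode_mem c c.2)).rTensor C =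
        LinearMap.mul' K A ∘ₗ (HopfAlgebra.antipode K).rTensor A ∘ₗ
          (Algebra.TensorProduct.map C.val C.val).toLinearMap := by
      ext x y; rfl
    have e1 := LinearMap.congr_fun h1 (h.comul c)
    refine e1.trans ?_
    simp only [LinearMap.comp_apply, AlgHom.toLinearMap_apply, h.val_comul]
    exact HopfAlgebra.mul_antipode_rTensor_comul_apply (R := K) (c : A)
  mul_antipode_lTensor_comul := by
    ext c
    have h1 : C.val.toLinearMap ∘ₗ LinearMap.mul' K C ∘ₗ
        (((HopfAlgebra.antipode K).comp C.val.toLinearMap).codRestrict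
          (Subalgebra.toSubmodule C) (fun c => h.antipode_mem c c.2)).lTensor C =
        LinearMap.mul' K A ∘ₗ (HopfAlgebra.antipode K).lTensor A ∘ₗ
          (Algebra.TensorProduct.map C.val C.val).toLinearMap := by
      ext x y; rfl
    have e1 := LinearMap.congr_fun h1 (h.comul c)
    refine e1.trans ?_
    simp only [LinearMap.comp_apply, AlgHom.toLinearMap_apply, h.val_comul]
    exact HopfAlgebra.mul_antipode_lTensor_comul_apply (R := K) (c : A)

/-- An element of `A ⊗ A` all of whose slices lie in `C` comes from `C ⊗ C`. -/
theorem mem_range_of_slices (C : Subalgebra K A) (F : A ⊗[K] A)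
    (h1 : ∀ φ : A →ₗ[K] K, TensorProduct.rid K A (φ.lTensor A F) ∈ C)
    (h2 : ∀ φ : A →ₗ[K] K, TensorProduct.lid K A (φ.rTensor A F) ∈ C) :
    F ∈ (Algebra.TensorProduct.map C.val C.val).range := by
  classical
  obtain ⟨F', hF'⟩ : ∃ F' : C ⊗[K] A, C.val.toLinearMap.rTensor A F' = F := by
    let b := Module.Basis.ofVectorSpace K A
    obtain ⟨c, hc⟩ := TensorProduct.eq_repr_basis_right b F
    have hcm : ∀ i, c i ∈ C := by
      intro i
      have := h1 (b.coord i)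
      rw [← hc] at this
      simp only [Finsupp.sum, map_sum, LinearMap.lTensor_tmul, Module.Basis.coord_apply,
        Module.Basis.repr_self, TensorProduct.rid_tmul, Finsupp.single_apply, ite_smul, one_smul,
        zero_smul, Finset.sum_ite_eq', Finsupp.mem_support_iff] at this
      by_cases h0 : c i = 0
      · rw [h0]; exact C.zero_mem
      · simpa [h0] using this
    refine ⟨c.sum fun i m => (⟨c i, hcm i⟩ : C) ⊗ₜ b i, ?_⟩
    rw [← hc]
    simp [Finsupp.sum]
  let q := Module.Basis.ofVectorSpace K C
  obtain ⟨c, hc⟩ := TensorProduct.eq_repr_basis_left q F'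
  have hcm : ∀ i, c i ∈ C := by
    intro i
    obtain ⟨φ, hφ⟩ := LinearMap.exists_extend (p := Subalgebra.toSubmodule C) (q.coord i)
    have hφ' : ∀ x : C, φ (x : A) = q.coord i x := fun x => LinearMap.congr_fun hφ x
    have := h2 φ
    rw [← hF', ← hc] at this
    simp only [Finsupp.sum, map_sum, LinearMap.rTensor_tmul, AlgHom.toLinearMap_apply,
      Subalgebra.coe_val, hφ', Module.Basis.coord_apply, Module.Basis.repr_self,
      TensorProduct.lid_tmul, Finsupp.single_apply, ite_smul, one_smul, zero_smul,
      Finset.sum_ite_eq', Finsupp.mem_support_iff] at this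
    by_cases h0 : c i = 0
    · rw [h0]; exact C.zero_mem
    · simpa [h0] using this
  refine ⟨c.sum fun i m => q i ⊗ₜ (⟨c i, hcm i⟩ : C), ?_⟩
  rw [← hF', ← hc]
  simp [Finsupp.sum]

end Sub

/-! ### The adjoint group and the maximal abelian quotient -/

section Quotients

variable (K A : Type u) [Field K] [CommRing A] [HopfAlgebra K A]

variable {K A} in
/-- `z ∈ Z_G(R)` for the scheme-theoretic center `Z_G`: over every `R`-algebra, `z` commutes with
all points of `G`. -/
def Pt.IsCentral {R : Type u} [CommRing R] [Algebra K R] (z : Pt K A R) : Prop :=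
  ∀ (S : Type u) [CommRing S] [Algebra K S] (φ : R →ₐ[K] S) (g : Pt K A S),
    Pt.map φ z * g = g * Pt.map φ z

variable {K A} in
theorem Pt.IsCentral.map {R S : Type u} [CommRing R] [Algebra K R] [CommRing S] [Algebra K S]
    {z : Pt K A R} (hz : z.IsCentral) (φ : R →ₐ[K] S) : (Pt.map φ z).IsCentral := by
  intro T _ _ ψ g
  rw [Pt.map_map]
  exact hz T _ g

variable {K A} in
theorem Pt.IsCentral.comm {R : Type u} [CommRing R] [Algebra K R]
    {z : Pt K A R} (hz : z.IsCentral) (g : Pt K A R) : z * g = g * z :=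
  hz R (AlgHom.id K R) g

variable {K A} in
theorem Pt.IsCentral.inv {R : Type u} [CommRing R] [Algebra K R]
    {z : Pt K A R} (hz : z.IsCentral) : z⁻¹.IsCentral := by
  intro T _ _ ψ g
  rw [map_inv]
  exact ((show Commute (Pt.map ψ z) g from hz T ψ g).inv_left)

/-- The coordinate ring of the adjoint group `G^ad = G / Z_G`: the functions on `G` that are
invariant under translation by `Z_G`. The quotient map `G → G^ad` is the inclusion into `A`. -/
def adCoord : Subalgebra K A where
  carrier := {a | ∀ (R : Type u) [CommRing R] [Algebra K R] (g z : Pt K A R), z.IsCentral →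
    (g * z).hom a = g.hom a}
  mul_mem' ha hb R _ _ g z hz := by rw [map_mul, map_mul, ha R g z hz, hb R g z hz]
  add_mem' ha hb R _ _ g z hz := by rw [map_add, map_add, ha R g z hz, hb R g z hz]
  algebraMap_mem' r R _ _ g z _ := by rw [AlgHom.commutes, AlgHom.commutes]

variable {K A} in
theorem mem_adCoord {a : A} : a ∈ adCoord K A ↔ ∀ (R : Type u) [CommRing R] [Algebra K R]
    (g z : Pt K A R), z.IsCentral → (g * z).hom a = g.hom a := Iff.rfl

theorem adCoord_isHopf : IsHopfSubalgebra (adCoord K A) where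
  comul_mem c hc := by
    apply mem_range_of_slices
    · intro φ R _ _ g z hz
      have key : ∀ x : Pt K A R, x.hom (TensorProduct.rid K A (φ.lTensor A (Coalgebra.comul c))) =
          TensorProduct.rid K R (φ.lTensor R
            ((Pt.map Algebra.TensorProduct.includeLeft x *
              (⟨Algebra.TensorProduct.includeRight⟩ : Pt K A (R ⊗[K] A))).hom c)) := by
        intro x
        rw [Pt.mul_apply_repr _ _ (Coalgebra.Repr.arbitrary K c),
          ← (Coalgebra.Repr.arbitrary K c).eq]
        simp
      rw [key, key, map_mul, mul_assoc,
        hz (R ⊗[K] A) Algebra.TensorProduct.includeLeft, ← mul_assoc,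
        hc _ _ _ (hz.map _)]
    · intro φ R _ _ g z hz
      have key : ∀ x : Pt K A R, x.hom (TensorProduct.lid K A (φ.rTensor A (Coalgebra.comul c))) =
          TensorProduct.lid K R (φ.rTensor R
            (((⟨Algebra.TensorProduct.includeLeft⟩ : Pt K A (A ⊗[K] R)) *
              Pt.map Algebra.TensorProduct.includeRight x).hom c)) := by
        intro x
        rw [Pt.mul_apply_repr _ _ (Coalgebra.Repr.arbitrary K c),
          ← (Coalgebra.Repr.arbitrary K c).eq]
        simp
      rw [key, key, map_mul, ← mul_assoc, hc _ _ _ (hz.map _)]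
  antipode_mem c hc R _ _ g z hz := by
    have key : ∀ x : Pt K A R, x.hom (HopfAlgebra.antipode K c) = x⁻¹.hom c := fun x => rfl
    rw [key, key, mul_inv_rev, hz.inv.comm, hc _ _ _ hz.inv]

instance : HopfAlgebra K (adCoord K A) := (adCoord_isHopf K A).hopfAlgebra

variable {K A} in
/-- The quotient map `G(R) → G^ad(R)`. -/
def toAd {R : Type u} [CommRing R] [Algebra K R] (g : Pt K A R) : Pt K (adCoord K A) R :=
  ⟨g.hom.comp (adCoord K A).val⟩

/-- A Hopf subalgebra is cocommutative when the corresponding quotient group is commutative. -/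
def IsCocommSub (C : Subalgebra K A) : Prop :=
  IsHopfSubalgebra C ∧
    ∀ c ∈ C, TensorProduct.comm K A A (Coalgebra.comul (R := K) c) = Coalgebra.comul (R := K) c

/-- The coordinate ring of the maximal abelian quotient `b : G → G^ab`: the largest cocommutative
Hopf subalgebra of `A`. The map `b` is the inclusion into `A`. -/
def abCoord : Subalgebra K A := sSup {C | IsCocommSub K A C}

/-- The ideal of the derived group `G^der`, the kernel of `b : G → G^ab` (that is, the smallest
normal subgroup of `G` with commutative quotient). -/
def derIdeal : Ideal A :=
  Ideal.span {a | ∃ c ∈ abCoord K A, a = c - algebraMap K A (Coalgebra.counit (R := K) c)}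

variable {K A}

theorem comm_on_abCoord {R : Type u} [CommRing R] [Algebra K R] (x y : Pt K A R)
    {c : A} (hc : c ∈ abCoord K A) : (x * y).hom c = (y * x).hom c := by
  have : abCoord K A ≤ AlgHom.equalizer (x * y).hom (y * x).hom := by
    apply sSup_le
    rintro C ⟨-, hC⟩ a ha
    change (x * y).hom a = (y * x).hom a
    have h1 : (Algebra.TensorProduct.lift y.hom x.hom (fun _ _ => .all _ _)).toLinearMap ∘ₗ
        (TensorProduct.comm K A A).toLinearMap =
        (Algebra.TensorProduct.lift x.hom y.hom (fun _ _ => .all _ _)).toLinearMap := by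
      ext p q; simp [mul_comm]
    have h2 := LinearMap.congr_fun h1 (Coalgebra.comul (R := K) a)
    simp only [LinearMap.comp_apply, LinearEquiv.coe_coe, hC a ha] at h2
    exact h2.symm
  exact this hc

/-- The abelianization `b(g) ∈ G^ab(R)` of a point `g ∈ G(R)`. -/
def Pt.ab {R : Type u} [CommRing R] [Algebra K R] (g : Pt K A R) : abCoord K A →ₐ[K] R :=
  g.hom.comp (abCoord K A).val

end Quotients

/-! ### Geometric notions: the group `G(Ω)` over an algebraically closed field -/

section Geometric

variable {K A Ω : Type u} [Field K] [CommRing A] [HopfAlgebra K A] [Field Ω] [Algebra K Ω]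

/-- Evaluation `Ω[G] = Ω ⊗ A → Ω` at a point `g ∈ G(Ω)`. -/
def Pt.eval (g : Pt K A Ω) : Ω ⊗[K] A →ₐ[Ω] Ω :=
  Algebra.TensorProduct.lift (AlgHom.id Ω Ω) g.hom (fun _ _ => .all _ _)

variable (K A Ω) in
/-- The Zariski topology on `G(Ω)`: induced from `Spec Ω[G]`. -/
abbrev zariski : TopologicalSpace (Pt K A Ω) :=
  TopologicalSpace.induced
    (fun g => (⟨RingHom.ker g.eval.toRingHom, RingHom.ker_isPrime _⟩ : PrimeSpectrum (Ω ⊗[K] A)))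
    inferInstance

/-- A Zariski closed subgroup of `G(Ω)`. -/
def IsClosedSubgroup (H : Subgroup (Pt K A Ω)) : Prop := @IsClosed _ (zariski K A Ω) (H : Set _)

/-- A subgroup of `G(Ω)` that is connected in the Zariski topology. -/
def IsConnectedSubgroup (H : Subgroup (Pt K A Ω)) : Prop :=
  @IsConnected _ (zariski K A Ω) (H : Set _)

/-- A Borel subgroup: a maximal closed connected solvable subgroup. -/
def IsBorel (B : Subgroup (Pt K A Ω)) : Prop :=
  Maximal (fun H => IsClosedSubgroup H ∧ IsConnectedSubgroup H ∧ Group.IsSolvable H) B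

/-- A parabolic subgroup: a closed subgroup that contains a Borel subgroup. -/
def IsParabolic (P : Subgroup (Pt K A Ω)) : Prop :=
  IsClosedSubgroup P ∧ ∃ B, IsBorel B ∧ B ≤ P

/-- Right translation by `g` on `Ω[G]`: `(r_g F)(x) = F(x g)`. -/
def Pt.rightTranslation (g : Pt K A Ω) : Ω ⊗[K] A →ₐ[Ω] Ω ⊗[K] A :=
  Algebra.TensorProduct.lift (Algebra.ofId Ω (Ω ⊗[K] A))
    ((⟨Algebra.TensorProduct.includeRight⟩ : Pt K A (Ω ⊗[K] A)) *
      ⟨(Algebra.TensorProduct.includeLeft : Ω →ₐ[K] Ω ⊗[K] A).comp g.hom⟩).hom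
    (fun _ _ => .all _ _)

/-- `g ∈ G(Ω)` is unipotent: right translation by `g` on `Ω[G]` is locally unipotent. -/
def Pt.IsUnipotent (g : Pt K A Ω) : Prop :=
  ∀ F : Ω ⊗[K] A, ∃ n : ℕ, ((g.rightTranslation.toLinearMap - 1 : Module.End Ω (Ω ⊗[K] A)) ^ n) F = 0

end Geometric

/-- `G = Spec A` is a split connected reductive group over `K`. -/
structure IsSplitConnectedReductive (K A : Type u) [Field K] [CommRing A] [HopfAlgebra K A] :
    Prop where
  smooth : Algebra.Smooth K A
  connected : ConnectedSpace (PrimeSpectrum A)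
  /-- The geometric unipotent radical is trivial. -/
  reductive : ∀ U : Subgroup (Pt K A (AlgebraicClosure K)), IsClosedSubgroup U →
    IsConnectedSubgroup U → U.Normal → (∀ u ∈ U, u.IsUnipotent) → U = ⊥
  /-- There is a split torus `T ≅ 𝔾_m^n` in `G` such that `T` is, over the algebraic closure, not
  properly contained in another torus of `G`. -/
  split : ∃ (n : ℕ) (φ : A →ₐc[K] MonoidAlgebra K (Multiplicative (Fin n → ℤ))),
    Function.Surjective φ ∧
      ∀ (m : ℕ) (ψ : (AlgebraicClosure K ⊗[K] A) →ₐc[AlgebraicClosure K]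
        MonoidAlgebra (AlgebraicClosure K) (Multiplicative (Fin m → ℤ))),
        Function.Surjective ψ →
        RingHom.ker ψ ≤ (RingHom.ker φ).map
          (Algebra.TensorProduct.includeRight : A →ₐ[K] AlgebraicClosure K ⊗[K] A) →
        RingHom.ker ψ = (RingHom.ker φ).map
          (Algebra.TensorProduct.includeRight : A →ₐ[K] AlgebraicClosure K ⊗[K] A)

/-- A representation `ρ : Γ → G(R)` is `G`-irreducible if at every geometric point of `Spec R` its
image is not contained in any proper parabolic subgroup. -/
def IsGIrreducible {K A R Γ : Type u} [Field K] [CommRing A] [HopfAlgebra K A] [CommRing R]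
    [Algebra K R] [Group Γ] (ρ : Γ →* Pt K A R) : Prop :=
  ∀ (Ω : Type u) [Field Ω] [Algebra K Ω] [IsAlgClosed Ω] (t : R →ₐ[K] Ω)
    (P : Subgroup (Pt K A Ω)), IsParabolic P → ((Pt.map t).comp ρ).range ≤ P → P = ⊤

/-- A conjugacy class of `G` defined over `K`: a locally closed subset of `G` whose set of
geometric points is a conjugacy class. It is regarded as a reduced locally closed subscheme. -/
structure ConjClass (K A : Type u) [Field K] [CommRing A] [HopfAlgebra K A] where
  /-- The underlying set of points of the scheme `G`. -/
  carrier : Set (PrimeSpectrum A)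
  isLocallyClosed : IsLocallyClosed carrier
  isConj : ∃ x : Pt K A (AlgebraicClosure K), ∀ y : Pt K A (AlgebraicClosure K),
    (⟨RingHom.ker y.hom.toRingHom, RingHom.ker_isPrime _⟩ : PrimeSpectrum A) ∈ carrier ↔ IsConj x y

/-- `y ∈ 𝒦(R)`: the morphism `y : Spec R → G` factors through the reduced locally closed subscheme
`𝒦`, that is, it factors through the (reduced) closure of `𝒦` and has image in `𝒦`. -/
def ConjClass.Mem {K A R : Type u} [Field K] [CommRing A] [HopfAlgebra K A] [CommRing R]
    [Algebra K R] (𝒦 : ConjClass K A) (y : Pt K A R) : Prop :=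
  (∀ a ∈ PrimeSpectrum.vanishingIdeal 𝒦.carrier, y.hom a = 0) ∧
    Set.range (PrimeSpectrum.comap y.hom.toRingHom) ⊆ 𝒦.carrier

/-! ### Torsors -/

/-- A (left) torsor `E = Spec B` over `Spec R` under the affine group scheme `H = Spec Q`. Since `H`
is affine, every torsor over an affine base is affine. -/
structure Torsor (K Q R : Type u) [Field K] [CommRing Q] [HopfAlgebra K Q] [CommRing R]
    [Algebra K R] where
  /-- The coordinate ring of `E`. -/
  B : Type u
  [commRing : CommRing B]
  [algebra : Algebra K B]
  /-- The structure morphism `E → Spec R`. -/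
  p : R →ₐ[K] B
  faithfullyFlat : p.toRingHom.FaithfullyFlat
  /-- The action morphism `H × E → E`. -/
  coact : B →ₐ[K] Q ⊗[K] B
  one_act : ∀ (S : Type u) [CommRing S] [Algebra K S] (e : B →ₐ[K] S),
    (Algebra.TensorProduct.lift (1 : Pt K Q S).hom e (fun _ _ => .all _ _)).comp coact = e
  mul_act : ∀ (S : Type u) [CommRing S] [Algebra K S] (g h : Pt K Q S) (e : B →ₐ[K] S),
    (Algebra.TensorProduct.lift (g * h).hom e (fun _ _ => .all _ _)).comp coact =
      (Algebra.TensorProduct.lift g.hom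
        ((Algebra.TensorProduct.lift h.hom e (fun _ _ => .all _ _)).comp coact)
        (fun _ _ => .all _ _)).comp coact
  /-- `H` acts over `Spec R`. -/
  act_over : ∀ (S : Type u) [CommRing S] [Algebra K S] (g : Pt K Q S) (e : B →ₐ[K] S),
    ((Algebra.TensorProduct.lift g.hom e (fun _ _ => .all _ _)).comp coact).comp p = e.comp p
  /-- `H × E → E ×_{Spec R} E` is an isomorphism. -/
  simplyTransitive : ∀ (S : Type u) [CommRing S] [Algebra K S] (e e' : B →ₐ[K] S),
    e.comp p = e'.comp p → ∃! g : Pt K Q S,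
      (Algebra.TensorProduct.lift g.hom e (fun _ _ => .all _ _)).comp coact = e'

attribute [instance] Torsor.commRing Torsor.algebra

section TorsorBasics

variable {K Q R S : Type u} [Field K] [CommRing Q] [HopfAlgebra K Q] [CommRing R] [Algebra K R]
  [CommRing S] [Algebra K S]

/-- The action `H(S) × E(S) → E(S)`. -/
def Torsor.act (E : Torsor K Q R) (g : Pt K Q S) (e : E.B →ₐ[K] S) : E.B →ₐ[K] S :=
  (Algebra.TensorProduct.lift g.hom e (fun _ _ => .all _ _)).comp E.coact

variable (K Q) in
/-- The trivial torsor `H` over `Spec K`. -/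
def Torsor.trivial : Torsor K Q K where
  B := Q
  p := Algebra.ofId K Q
  faithfullyFlat := by
    have : Nontrivial Q := (Bialgebra.counitAlgHom K Q).toRingHom.domain_nontrivial
    have h : Module.FaithfullyFlat K Q := inferInstance
    exact RingHom.faithfullyFlat_algebraMap_iff.2 h
  coact := Bialgebra.comulAlgHom K Q
  one_act S _ _ e := congrArg Pt.hom (one_mul (⟨e⟩ : Pt K Q S))
  mul_act S _ _ g h e := by
    have := congrArg Pt.hom (mul_assoc g h (⟨e⟩ : Pt K Q S))
    rw [Pt.mul_hom (g * h), Pt.mul_hom g (h * _), Pt.mul_hom h ⟨e⟩] at this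
    exact this
  act_over S _ _ g e := Subsingleton.elim _ _
  simplyTransitive S _ _ e e' _ := by
    let x : Pt K Q S := ⟨e⟩
    let y : Pt K Q S := ⟨e'⟩
    refine ⟨y * x⁻¹, ?_, fun g hg => ?_⟩
    · have h : y * x⁻¹ * x = y := inv_mul_cancel_right y x
      have h' := congrArg Pt.hom h
      rw [Pt.mul_hom] at h'
      exact h'
    · have hg' : g * x = y := Pt.ext hg
      rw [← hg', mul_inv_cancel_right]

end TorsorBasics

/-! ### The stack of local systems and the moduli stack -/

section Moduli

variable {K A Γ : Type u} [Field K] [CommRing A] [HopfAlgebra K A] [Group Γ]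

/-- An object `(E, f)` over `Spec R` of the quotient stack `Loc_G(Γ, θ) = [Rep_G(Γ, θ) / G^ad]`: a
`G^ad`-torsor `E = Spec B` over `Spec R` and a `G^ad`-equivariant morphism `f : E → Rep_G(Γ, θ)`,
the latter being the same as a representation `Γ → G(B)` with abelianization `θ`. -/
structure LocObj (θ : Γ → (abCoord K A →ₐ[K] K)) (R : Type u) [CommRing R] [Algebra K R]
    extends Torsor K (adCoord K A) R where
  /-- The representation `Γ → G(B)` given by `f`; on `e ∈ E(S)` we have `f(e) = e_* ρ`. -/
  ρ : Γ →* Pt K A B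
  ab_eq : ∀ γ, (ρ γ).ab = (Algebra.ofId K B).comp (θ γ)
  /-- `f(g e) = g f(e) g⁻¹`. As `G^ad` acts on representations through the (fppf) epimorphism
  `G → G^ad`, equivariance can be tested on the points of `G`. -/
  equivariant : ∀ (S : Type u) [CommRing S] [Algebra K S] (g : Pt K A S) (e : B →ₐ[K] S) (γ : Γ),
    Pt.map (toTorsor.act (toAd g) e) (ρ γ) = g * Pt.map e (ρ γ) * g⁻¹

/-- `h : B → B'` defines a morphism `(E', f') → (E, f)` in the stack over the morphism of bases
given by `φ : R → R'`: it is a `G^ad`-equivariant morphism over `φ` compatible with `f` and `f'`.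
Any such morphism identifies `(E', f')` with the pullback of `(E, f)` along `φ`. -/
structure LocObj.IsHom {θ : Γ → (abCoord K A →ₐ[K] K)} {R R' : Type u} [CommRing R] [Algebra K R]
    [CommRing R'] [Algebra K R'] (φ : R →ₐ[K] R') (X : LocObj θ R) (X' : LocObj θ R')
    (h : X.B →ₐ[K] X'.B) : Prop where
  over_base : h.comp X.p = X'.p.comp φ
  equivariant : X'.coact.comp h = (Algebra.TensorProduct.map (AlgHom.id K _) h).comp X.coact
  rep : ∀ γ, Pt.map h (X.ρ γ) = X'.ρ γ

/-- The object `(E, f)` of `Loc_G(Γ, θ)` belongs to the moduli stack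
`M = M_G(Γ, θ, {(γ_i, 𝒦_i)})`: it is `G`-irreducible (at every geometric point), and the morphisms
`f(γ_i) : E → G` factor through the locally closed subschemes `𝒦_i`. -/
structure LocObj.InModuli {θ : Γ → (abCoord K A →ₐ[K] K)} {R : Type u} [CommRing R] [Algebra K R]
    {N : ℕ} (γ : Fin N → Γ) (𝒦 : Fin N → ConjClass K A) (X : LocObj θ R) : Prop where
  irreducible : IsGIrreducible X.ρ
  conj : ∀ i, (𝒦 i).Mem (X.ρ (γ i))

theorem conj_mem_adCoord (x : Pt K A K) (a : A) :
    (Pt.univ K A * Pt.map (Algebra.ofId K A) x * (Pt.univ K A)⁻¹).hom a ∈ adCoord K A := by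
  intro R _ _ g z hz
  have key : ∀ y : Pt K A R,
      y.hom ((Pt.univ K A * Pt.map (Algebra.ofId K A) x * (Pt.univ K A)⁻¹).hom a) =
        (y * Pt.map (Algebra.ofId K R) x * y⁻¹).hom a := by
    intro y
    change (Pt.map y.hom (Pt.univ K A * Pt.map (Algebra.ofId K A) x * (Pt.univ K A)⁻¹)).hom a = _
    rw [map_mul, map_mul, map_inv, Pt.map_univ, Pt.map_ofId]
  rw [key, key]
  congr 2
  rw [mul_inv_rev, mul_assoc g z, hz.comm, mul_assoc, mul_assoc, mul_assoc, mul_inv_cancel_left]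

/-- The morphism `G^ad → G`, `g ↦ g x g⁻¹`, for `x ∈ G(K)`, as a point of `G`. -/
def orbitPt (x : Pt K A K) : Pt K A (adCoord K A) :=
  ⟨(Pt.univ K A * Pt.map (Algebra.ofId K A) x * (Pt.univ K A)⁻¹).hom.codRestrict _
    (conj_mem_adCoord x)⟩

theorem map_val_orbitPt (x : Pt K A K) : Pt.map (adCoord K A).val (orbitPt x) =
    Pt.univ K A * Pt.map (Algebra.ofId K A) x * (Pt.univ K A)⁻¹ := rfl

theorem map_toAd_orbitPt {R : Type u} [CommRing R] [Algebra K R] (x : Pt K A K) (g : Pt K A R) :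
    Pt.map (toAd g).hom (orbitPt x) = g * Pt.map (Algebra.ofId K R) x * g⁻¹ := by
  change Pt.map (g.hom.comp (adCoord K A).val) (orbitPt x) = _
  rw [← Pt.map_map, map_val_orbitPt, map_mul, map_mul, map_inv, Pt.map_univ, Pt.map_ofId]

theorem toAd_mul {R : Type u} [CommRing R] [Algebra K R] (g h : Pt K A R) :
    toAd (g * h) = toAd g * toAd h := by
  ext c
  have h1 : (Algebra.TensorProduct.lift (toAd g).hom (toAd h).hom (fun _ _ => .all _ _)) =
      (Algebra.TensorProduct.lift g.hom h.hom (fun _ _ => .all _ _)).comp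
        (Algebra.TensorProduct.map (adCoord K A).val (adCoord K A).val) := by
    ext <;> simp [toAd]
  rw [Pt.mul_hom, h1]
  simp only [AlgHom.comp_apply]
  exact congrArg _ ((adCoord_isHopf K A).val_comul c).symm

theorem orbitPt_equivariant {S : Type u} [CommRing S] [Algebra K S] (x : Pt K A K) (g : Pt K A S)
    (e : Pt K (adCoord K A) S) :
    Pt.map (toAd g * e).hom (orbitPt x) = g * Pt.map e.hom (orbitPt x) * g⁻¹ := by
  -- reduce to the universal pair over `A ⊗ Q`, and there to `A ⊗ A`, where `e` lifts to `G`
  let g₀ : Pt K A (A ⊗[K] adCoord K A) := ⟨Algebra.TensorProduct.includeLeft⟩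
  let e₀ : Pt K (adCoord K A) (A ⊗[K] adCoord K A) := ⟨Algebra.TensorProduct.includeRight⟩
  have huniv : Pt.map (toAd g₀ * e₀).hom (orbitPt x) =
      g₀ * Pt.map e₀.hom (orbitPt x) * g₀⁻¹ := by
    let j : A ⊗[K] adCoord K A →ₐ[K] A ⊗[K] A :=
      Algebra.TensorProduct.map (AlgHom.id K A) (adCoord K A).val
    have hj : Function.Injective j :=
      TensorProduct.map_injective_of_flat_flat (LinearMap.id : A →ₗ[K] A)
        (adCoord K A).val.toLinearMap Function.injective_id Subtype.val_injective
    apply Pt.map_injective hj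
    let g₁ : Pt K A (A ⊗[K] A) := ⟨Algebra.TensorProduct.includeLeft⟩
    let y₁ : Pt K A (A ⊗[K] A) := ⟨Algebra.TensorProduct.includeRight⟩
    have hg : Pt.map j g₀ = g₁ := by
      ext a; simp [j, g₀, g₁]
    have hgt : Pt.map j (toAd g₀) = toAd g₁ := by
      ext a; simp [j, g₀, g₁, toAd]
    have he : Pt.map j e₀ = toAd y₁ := by
      ext a; simp [j, e₀, y₁, toAd]
    have hL : Pt.map j (Pt.map (toAd g₀ * e₀).hom (orbitPt x)) =
        Pt.map (toAd (g₁ * y₁)).hom (orbitPt x) := by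
      rw [Pt.map_map, toAd_mul, ← hgt, ← he, ← map_mul]; rfl
    have hR : Pt.map j (Pt.map e₀.hom (orbitPt x)) = Pt.map (toAd y₁).hom (orbitPt x) := by
      rw [Pt.map_map, ← he]; rfl
    rw [hL, map_mul, map_mul, map_inv, hR, hg, map_toAd_orbitPt, map_toAd_orbitPt, mul_inv_rev]
    simp only [mul_assoc]
  let l : A ⊗[K] adCoord K A →ₐ[K] S :=
    Algebra.TensorProduct.lift g.hom e.hom (fun _ _ => .all _ _)
  have hg : Pt.map l g₀ = g := by
    ext a; simp [l, g₀]
  have hgt : Pt.map l (toAd g₀) = toAd g := by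
    ext a; simp [l, g₀, toAd]
  have he : Pt.map l e₀ = e := by
    ext a; simp [l, e₀]
  have h := congrArg (Pt.map l) huniv
  have hL : Pt.map l (Pt.map (toAd g₀ * e₀).hom (orbitPt x)) =
      Pt.map (toAd g * e).hom (orbitPt x) := by
    have h3 : toAd g * e = Pt.map l (toAd g₀ * e₀) := by rw [map_mul, hgt, he]
    rw [h3, Pt.map_map]; rfl
  have hR : Pt.map l (Pt.map e₀.hom (orbitPt x)) = Pt.map e.hom (orbitPt x) := by
    conv_rhs => rw [← he]
    rw [Pt.map_map]; rfl
  rw [hL, map_mul, map_mul, map_inv, hR, hg] at h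
  exact h

/-- The morphism `x ↦ (g ↦ g x g⁻¹)` as a group homomorphism. -/
def orbitHom : Pt K A K →* Pt K A (adCoord K A) where
  toFun := orbitPt
  map_one' := by
    apply Pt.map_injective (φ := (adCoord K A).val) Subtype.val_injective
    rw [map_val_orbitPt, map_one, map_one, mul_one, mul_inv_cancel]
  map_mul' x y := by
    apply Pt.map_injective (φ := (adCoord K A).val) Subtype.val_injective
    rw [map_mul, map_val_orbitPt, map_val_orbitPt, map_val_orbitPt, map_mul]
    group

/-- The abelianization `ρ^ab : Γ → G^ab(K)` of a representation. -/
def abelianization (ρ : Γ →* Pt K A K) : Γ → (abCoord K A →ₐ[K] K) := fun γ => (ρ γ).ab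

/-- The object `[ρ] = (G^ad, f_ρ)` of `Loc_G(Γ, ρ^ab)` over `Spec K`, with `f_ρ(g) = g ρ g⁻¹`. -/
def LocObj.ofRep (ρ : Γ →* Pt K A K) : LocObj (abelianization ρ) K where
  toTorsor := Torsor.trivial K (adCoord K A)
  ρ := orbitHom.comp ρ
  ab_eq γ := by
    ext c
    apply Subtype.val_injective
    change (Pt.univ K A * Pt.map (Algebra.ofId K A) (ρ γ) * (Pt.univ K A)⁻¹).hom (c : A) =
      algebraMap K A ((ρ γ).hom c)
    rw [comm_on_abCoord _ _ c.2, ← mul_assoc, inv_mul_cancel, one_mul]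
    rfl
  equivariant S _ _ g e γ := orbitPt_equivariant (ρ γ) g ⟨e⟩

/-- The base point `1 ∈ G^ad(K)` of `[ρ]`. -/
def LocObj.basePt (ρ : Γ →* Pt K A K) : (LocObj.ofRep ρ).B →ₐ[K] K :=
  Bialgebra.counitAlgHom K (adCoord K A)

/-- For an augmented `K`-algebra `R → K`: an object of `M(R)` together with an isomorphism of its
restriction to `Spec K` with `[ρ₀]` (that is, a morphism from `[ρ₀]` to it over `Spec K → Spec R`).
-/
structure Deformation {N : ℕ} (ρ₀ : Γ →* Pt K A K) (γ : Fin N → Γ) (𝒦 : Fin N → ConjClass K A)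
    (R : Type u) [CommRing R] [Algebra K R] (aug : R →ₐ[K] K) where
  /-- The object `(E, f)` over `Spec R`. -/
  obj : LocObj (abelianization ρ₀) R
  inModuli : obj.InModuli γ 𝒦
  /-- The identification of `(E, f)` over `Spec K` with `[ρ₀]`. -/
  mark : obj.B →ₐ[K] (LocObj.ofRep ρ₀).B
  mark_isHom : LocObj.IsHom aug obj (LocObj.ofRep ρ₀) mark

section Def

variable {N : ℕ} {ρ₀ : Γ →* Pt K A K} {γ : Fin N → Γ} {𝒦 : Fin N → ConjClass K A}
  {R R' : Type u} [CommRing R] [Algebra K R] [CommRing R'] [Algebra K R']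
  {aug : R →ₐ[K] K} {aug' : R' →ₐ[K] K}

/-- `X'` is (isomorphic to) the pullback of the deformation `X` along `φ : R → R'`. -/
def Deformation.IsPullback (φ : R →ₐ[K] R') (X : Deformation ρ₀ γ 𝒦 R aug)
    (X' : Deformation ρ₀ γ 𝒦 R' aug') : Prop :=
  ∃ h : X.obj.B →ₐ[K] X'.obj.B, LocObj.IsHom φ X.obj X'.obj h ∧ X'.mark.comp h = X.mark

/-- Isomorphism of deformations: an isomorphism of objects of `M(R)` compatible with the
identifications over `Spec K`. -/
def Deformation.Iso (X X' : Deformation ρ₀ γ 𝒦 R aug) : Prop :=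
  ∃ e : X.obj.B ≃ₐ[K] X'.obj.B, LocObj.IsHom (AlgHom.id K R) X.obj X'.obj e.toAlgHom ∧
    X'.mark.comp e.toAlgHom = X.mark

theorem Deformation.Iso.symm {X X' : Deformation ρ₀ γ 𝒦 R aug} (h : X.Iso X') : X'.Iso X := by
  obtain ⟨e, he, hm⟩ := h
  have hinv : e.toAlgHom.comp e.symm.toAlgHom = AlgHom.id K _ := AlgHom.ext e.apply_symm_apply
  have hinv' : e.symm.toAlgHom.comp e.toAlgHom = AlgHom.id K _ := AlgHom.ext e.symm_apply_apply
  refine ⟨e.symm, ⟨?_, ?_, ?_⟩, ?_⟩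
  · have h1 : e.toAlgHom.comp X.obj.p = X'.obj.p := he.over_base
    rw [← h1, ← AlgHom.comp_assoc, hinv']; rfl
  · have h1 := he.equivariant
    have h2 : (Algebra.TensorProduct.map (AlgHom.id K (adCoord K A)) e.symm.toAlgHom).comp
        (Algebra.TensorProduct.map (AlgHom.id K (adCoord K A)) e.toAlgHom) = AlgHom.id K _ := by
      rw [← Algebra.TensorProduct.map_comp, hinv']
      exact Algebra.TensorProduct.map_id
    have h3 := congrArg (fun t => ((Algebra.TensorProduct.map (AlgHom.id K (adCoord K A))
      e.symm.toAlgHom).comp t).comp e.symm.toAlgHom) h1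
    simp only [← AlgHom.comp_assoc, h2] at h3
    rw [AlgHom.comp_assoc _ e.toAlgHom, hinv] at h3
    exact h3.symm
  · intro δ
    rw [← he.rep δ, Pt.map_map, hinv']; rfl
  · rw [← hm, AlgHom.comp_assoc, hinv]; rfl

theorem Deformation.Iso.trans {X X' X'' : Deformation ρ₀ γ 𝒦 R aug} (h : X.Iso X')
    (h' : X'.Iso X'') : X.Iso X'' := by
  obtain ⟨e, he, hm⟩ := h
  obtain ⟨e', he', hm'⟩ := h'
  have hc : (e.trans e').toAlgHom = e'.toAlgHom.comp e.toAlgHom := rfl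
  refine ⟨e.trans e', ⟨?_, ?_, ?_⟩, ?_⟩
  · rw [hc, AlgHom.comp_assoc, he.over_base]
    exact he'.over_base
  · rw [hc, ← AlgHom.comp_assoc, he'.equivariant, AlgHom.comp_assoc, he.equivariant,
      ← AlgHom.comp_assoc, ← Algebra.TensorProduct.map_comp]
    rfl
  · intro δ
    rw [hc, ← Pt.map_map, he.rep, he'.rep]
  · rw [hc, ← AlgHom.comp_assoc, hm', hm]

theorem Deformation.Iso.refl (X : Deformation ρ₀ γ 𝒦 R aug) : X.Iso X :=
  ⟨AlgEquiv.refl, ⟨rfl, by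
    have : (AlgEquiv.refl : X.obj.B ≃ₐ[K] X.obj.B).toAlgHom = AlgHom.id K _ := rfl
    rw [this, Algebra.TensorProduct.map_id]; rfl, fun _ => rfl⟩, rfl⟩

variable (ρ₀ γ 𝒦) in
/-- Isomorphism of deformations over the augmented algebra `R`. -/
def defSetoid (R : Type u) [CommRing R] [Algebra K R] (aug : R →ₐ[K] K) :
    Setoid (Deformation ρ₀ γ 𝒦 R aug) :=
  ⟨Deformation.Iso, Deformation.Iso.refl, Deformation.Iso.symm, Deformation.Iso.trans⟩

end Def

/-- `K ⊕ V` with `V² = 0`; the case `V = K` is the ring of dual numbers `K[ε]`. -/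
abbrev augmentation (K V : Type u) [Field K] [AddCommGroup V] [Module K V] [Module Kᵐᵒᵖ V]
    [IsCentralScalar K V] : TrivSqZeroExt K V →ₐ[K] K := TrivSqZeroExt.fstHom K K V

section Tangent

variable {N : ℕ} (ρ₀ : Γ →* Pt K A K) (γ : Fin N → Γ) (𝒦 : Fin N → ConjClass K A)

/-- A tangent vector of `M` at `[ρ₀]`: an object of `M(K[ε])` with an identification of its
restriction to `Spec K` with `[ρ₀]`. -/
abbrev TangentVector := Deformation ρ₀ γ 𝒦 (DualNumber K) (augmentation K K)

/-- The Zariski tangent space of `M` at `[ρ₀]`: isomorphism classes of tangent vectors. -/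
def TangentSpace := Quotient (defSetoid ρ₀ γ 𝒦 (DualNumber K) (augmentation K K))

variable {ρ₀ γ 𝒦}

/-- The class of a tangent vector. -/
def TangentVector.cls (X : TangentVector ρ₀ γ 𝒦) : TangentSpace ρ₀ γ 𝒦 := Quotient.mk _ X

/-- `Y = c • X` in the tangent space: `Y` is the pullback of `X` along `ε ↦ c ε`. -/
def TangentVector.IsSMul (c : K) (X Y : TangentVector ρ₀ γ 𝒦) : Prop :=
  Deformation.IsPullback (TrivSqZeroExt.map (c • LinearMap.id : K →ₗ[K] K)) X Y

/-- `Y = X₁ + X₂` in the tangent space: there is a deformation over `K[ε₁, ε₂]/(ε₁, ε₂)²` which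
restricts to `X₁` under `ε₂ ↦ 0`, to `X₂` under `ε₁ ↦ 0`, and to `Y` under `ε₁, ε₂ ↦ ε`. -/
def TangentVector.IsAdd (X₁ X₂ Y : TangentVector ρ₀ γ 𝒦) : Prop :=
  ∃ W : Deformation ρ₀ γ 𝒦 (TrivSqZeroExt K (K × K)) (augmentation K (K × K)),
    Deformation.IsPullback (TrivSqZeroExt.map (LinearMap.fst K K K)) W X₁ ∧
    Deformation.IsPullback (TrivSqZeroExt.map (LinearMap.snd K K K)) W X₂ ∧
    Deformation.IsPullback (TrivSqZeroExt.map (LinearMap.fst K K K + LinearMap.snd K K K)) W Y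

end Tangent

end Moduli

/-! ### The adjoint representation on `𝔤^der` and group cohomology -/

section Lie

variable (K A : Type u) [Field K] [CommRing A] [HopfAlgebra K A]

/-- The Lie algebra `𝔤^der` of `G^der`: the point derivations of `A` at the identity that vanish on
the ideal of `G^der`. -/
def lieDer : Submodule K (A →ₗ[K] K) where
  carrier := {D | (∀ a b, D (a * b) =
      Coalgebra.counit (R := K) a * D b + D a * Coalgebra.counit (R := K) b) ∧
    ∀ a ∈ derIdeal K A, D a = 0}
  zero_mem' := by simp
  add_mem' := by
    rintro D D' ⟨h1, h2⟩ ⟨h1', h2'⟩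
    refine ⟨fun a b => ?_, fun a ha => ?_⟩
    · simp only [LinearMap.add_apply, h1, h1']; ring
    · simp only [LinearMap.add_apply, h2 a ha, h2' a ha, add_zero]
  smul_mem' := by
    rintro c D ⟨h1, h2⟩
    refine ⟨fun a b => ?_, fun a ha => ?_⟩
    · simp only [LinearMap.smul_apply, h1, smul_eq_mul]; ring
    · simp only [LinearMap.smul_apply, h2 a ha, smul_zero]

variable {K A}

/-- The comorphism of conjugation `x ↦ g x g⁻¹` on `G`, for `g ∈ G(K)`. -/
def conjHom (g : Pt K A K) : A →ₐ[K] A :=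
  (Pt.map (Algebra.ofId K A) g * Pt.univ K A * (Pt.map (Algebra.ofId K A) g)⁻¹).hom

theorem comp_conjHom {R : Type u} [CommRing R] [Algebra K R] (g : Pt K A K) (x : Pt K A R) :
    x.hom.comp (conjHom g) =
      (Pt.map (Algebra.ofId K R) g * x * (Pt.map (Algebra.ofId K R) g)⁻¹).hom := by
  change (Pt.map x.hom (Pt.map (Algebra.ofId K A) g * Pt.univ K A *
    (Pt.map (Algebra.ofId K A) g)⁻¹)).hom = _
  rw [map_mul, map_mul, map_inv, Pt.map_univ, Pt.map_ofId]

theorem conjHom_one : conjHom (1 : Pt K A K) = AlgHom.id K A := by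
  rw [conjHom, map_one, one_mul, inv_one, mul_one]; rfl

theorem conjHom_mul (g h : Pt K A K) : conjHom (g * h) = (conjHom h).comp (conjHom g) := by
  have := comp_conjHom g (⟨conjHom h⟩ : Pt K A A)
  change (conjHom h).comp (conjHom g) = _ at this
  rw [this, conjHom, map_mul]
  congr 1
  have h2 : (⟨conjHom h⟩ : Pt K A A) = Pt.map (Algebra.ofId K A) h * Pt.univ K A *
    (Pt.map (Algebra.ofId K A) h)⁻¹ := rfl
  rw [h2]
  group

theorem counit_conjHom (g : Pt K A K) (a : A) :
    Coalgebra.counit (R := K) (conjHom g a) = Coalgebra.counit (R := K) a := by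
  have h := comp_conjHom g (1 : Pt K A K)
  rw [mul_one, mul_inv_cancel] at h
  exact DFunLike.congr_fun h a

theorem conjHom_ab (g : Pt K A K) {c : A} (hc : c ∈ abCoord K A) : conjHom g c = c := by
  rw [conjHom, comm_on_abCoord _ _ hc, inv_mul_cancel_left]; rfl

theorem conjHom_derIdeal (g : Pt K A K) {a : A} (ha : a ∈ derIdeal K A) :
    conjHom g a ∈ derIdeal K A := by
  have : derIdeal K A ≤ (derIdeal K A).comap (conjHom g) := by
    refine Ideal.span_le.2 ?_
    rintro _ ⟨c, hc, rfl⟩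
    change conjHom g (c - algebraMap K A (Coalgebra.counit (R := K) c)) ∈ derIdeal K A
    rw [map_sub, AlgHom.commutes, conjHom_ab g hc]
    exact Ideal.subset_span ⟨c, hc, rfl⟩
  exact this ha

/-- The adjoint action `Ad(g)` of `g ∈ G(K)` on `𝔤^der`. -/
def Ad : Pt K A K →* Module.End K (lieDer K A) where
  toFun g := LinearMap.restrict (LinearMap.lcomp K K (conjHom g).toLinearMap) (by
    rintro D ⟨h1, h2⟩
    refine ⟨fun a b => ?_, fun a ha => h2 _ (conjHom_derIdeal g ha)⟩
    change D (conjHom g (a * b)) = _ * D (conjHom g b) + D (conjHom g a) * _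
    rw [map_mul, h1, counit_conjHom, counit_conjHom])
  map_one' := by
    ext D a
    change D.1 (conjHom 1 a) = D.1 a
    rw [conjHom_one]; rfl
  map_mul' g h := by
    ext D a
    change D.1 (conjHom (g * h) a) = D.1 (conjHom h (conjHom g a))
    rw [conjHom_mul]; rfl

variable {Γ : Type u} [Group Γ]

/-- `𝔤^der` as a representation of `Γ` via `Ad ∘ ρ₀`. -/
abbrev adRep (ρ₀ : Γ →* Pt K A K) : Rep K Γ :=
  Rep.of (X := lieDer K A)
    ((Ad.comp ρ₀ : Γ →* Module.End K (lieDer K A)) : Representation K Γ (lieDer K A))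

/-- The restriction map `H¹(Γ, 𝔤^der) → ⨁ᵢ H¹(⟨γᵢ⟩, 𝔤^der)`. -/
def resMap {N : ℕ} (ρ₀ : Γ →* Pt K A K) (γ : Fin N → Γ) :
    groupCohomology.H1 (adRep ρ₀) →ₗ[K]
      ((i : Fin N) → groupCohomology.H1
        (Rep.res (Subgroup.zpowers (γ i)).subtype (adRep ρ₀))) :=
  LinearMap.pi fun i => (groupCohomology.map (Subgroup.zpowers (γ i)).subtype
    (CategoryTheory.CategoryStruct.id
      (Rep.res (Subgroup.zpowers (γ i)).subtype (adRep ρ₀))) 1).hom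

/-- The class `c ∈ H¹(Γ, 𝔤^der)` is attached to the tangent vector `X = (E, f)`: for a section
`s ∈ E(K[ε])` that extends the base point of `[ρ₀]`, with associated representation
`ρ = f(s) : Γ → G(K[ε])`, it is the class of the cocycle `α` given by
`ρ(γ) ρ₀(γ)⁻¹ = 1 + ε α(γ)`. -/
def TangentVector.HasClass {N : ℕ} {ρ₀ : Γ →* Pt K A K} {γ : Fin N → Γ} {𝒦 : Fin N → ConjClass K A}
    (X : TangentVector ρ₀ γ 𝒦) (c : groupCohomology.H1 (adRep ρ₀)) : Prop :=
  ∃ (s : X.obj.B →ₐ[K] DualNumber K) (α : groupCohomology.cocycles₁ (adRep ρ₀)),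
    s.comp X.obj.p = AlgHom.id K _ ∧
    (augmentation K K).comp s = (LocObj.basePt ρ₀).comp X.mark ∧
    (∀ (δ : Γ) (a : A), (α δ : lieDer K A).1 a =
      TrivSqZeroExt.snd ((Pt.map s (X.obj.ρ δ) *
        (Pt.map (Algebra.ofId K (DualNumber K)) (ρ₀ δ))⁻¹).hom a)) ∧
    groupCohomology.H1π (adRep ρ₀) α = c

end Lie

end RepModuli

end

noncomputable section

namespace RepModuli

/-! ### Lie algebras without nilpotently acting ideals -/

section LinearAlgebra

open Polynomial in
/-- In characteristic zero an endomorphism all of whose powers are traceless is nilpotent. -/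
theorem isNilpotent_of_trace_pow_eq_zero {K V : Type*} [Field K] [CharZero K] [AddCommGroup V]
    [Module K V] [FiniteDimensional K V] (x : Module.End K V)
    (h : ∀ k : ℕ, LinearMap.trace K V (x ^ (k + 1)) = 0) : IsNilpotent x := by
  obtain ⟨q, hq, hq0⟩ := exists_eq_pow_rootMultiplicity_mul_and_not_dvd (minpoly K x)
    (minpoly.ne_zero (Algebra.IsIntegral.isIntegral x)) 0
  rw [C_0, sub_zero] at hq hq0
  set a := rootMultiplicity 0 (minpoly K x)
  have hco : IsCoprime ((X : K[X]) ^ (a + 1)) q :=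
    IsCoprime.pow_left ((irreducible_X.coprime_iff_not_dvd).2 hq0)
  obtain ⟨s, t, hst⟩ := hco
  have hann : aeval x ((X : K[X]) ^ (a + 1) * q) = 0 := by
    rw [pow_succ', mul_assoc, ← hq, map_mul, minpoly.aeval, mul_zero]
  have hone : aeval x (s * X ^ (a + 1)) + aeval x (t * q) = 1 := by
    rw [← map_add, hst, map_one]
  have hzero : aeval x (s * X ^ (a + 1)) * aeval x (t * q) = 0 := by
    rw [← map_mul, show s * X ^ (a + 1) * (t * q) = s * t * (X ^ (a + 1) * q) by ring, map_mul,
      hann, mul_zero]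
  have hidem : IsIdempotentElem (aeval x (s * X ^ (a + 1))) := by
    have h1 := congrArg (aeval x (s * X ^ (a + 1)) * ·) hone
    simp only [mul_add, hzero, add_zero, mul_one] at h1
    exact h1
  have htr : ∀ p : K[X], LinearMap.trace K V (aeval x (p * X)) = 0 := by
    intro p
    induction p using Polynomial.induction_on' with
    | add p q hp hq => rw [add_mul, map_add, map_add, hp, hq, add_zero]
    | monomial n c =>
      rw [monomial_mul_X, aeval_monomial, ← Algebra.smul_def, map_smul, h, smul_zero]
  have he : aeval x (s * X ^ (a + 1)) = 0 := by
    apply LinearMap.IsIdempotentElem.eq_zero_of_trace_eq_zero hidem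
    rw [pow_succ, ← mul_assoc]
    exact htr _
  refine ⟨a + 1, ?_⟩
  rw [he, zero_add] at hone
  have h2 := congrArg (aeval x ((X : K[X]) ^ (a + 1)) * ·) hone
  simp only [mul_one] at h2
  rw [← map_mul, show (X : K[X]) ^ (a + 1) * (t * q) = t * (X ^ (a + 1) * q) by ring, map_mul,
    hann, mul_zero, map_pow, aeval_X] at h2
  exact h2.symm

variable {K L V : Type*} [Field K] [LieRing L] [LieAlgebra K L]
  [AddCommGroup V] [Module K V] [LieRingModule L V] [LieModule K L V] [FiniteDimensional K V]

open LieModule in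
/-- If `x = ∑ [aᵢ, bᵢ]` commutes with all `bᵢ`, then it acts nilpotently. -/
theorem isNilpotent_toEnd_of_mem_span_lie [CharZero K] (x : L)
    (hx : x ∈ Submodule.span K {c | ∃ a b : L, ⁅x, b⁆ = 0 ∧ ⁅a, b⁆ = c}) :
    _root_.IsNilpotent (toEnd K L V x) := by
  apply isNilpotent_of_trace_pow_eq_zero
  intro k
  have key : ∀ y ∈ Submodule.span K {c | ∃ a b : L, ⁅x, b⁆ = 0 ∧ ⁅a, b⁆ = c},
      LinearMap.trace K V (toEnd K L V x ^ k * toEnd K L V y) = 0 := by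
    intro y hy
    induction hy using Submodule.span_induction with
    | mem c hc =>
      obtain ⟨a, b, hb, rfl⟩ := hc
      have hlie : ∀ u v : L, toEnd K L V ⁅u, v⁆ =
          toEnd K L V u * toEnd K L V v - toEnd K L V v * toEnd K L V u := by
        intro u v
        ext w
        simp
      have hcomm : Commute (toEnd K L V x) (toEnd K L V b) := by
        rw [commute_iff_eq, ← sub_eq_zero, ← hlie, hb, map_zero]
      rw [hlie, mul_sub, map_sub, sub_eq_zero, ← mul_assoc, ← mul_assoc,
        (hcomm.pow_left k).eq, LinearMap.trace_mul_comm _ _ (toEnd K L V a), ← mul_assoc,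
        LinearMap.trace_mul_comm _ _ (toEnd K L V b), ← mul_assoc,
        mul_assoc (toEnd K L V a), LinearMap.trace_mul_comm _ (toEnd K L V a)]
    | zero => simp
    | add u v _ _ hu hv => rw [map_add, mul_add, map_add, hu, hv, add_zero]
    | smul c u _ hu => rw [map_smul, mul_smul_comm, map_smul, hu, smul_zero]
  rw [pow_succ]
  exact key x hx

open LieModule in
theorem eq_bot_of_forall_isNilpotent_toEnd
    (hnil : ∀ I : LieIdeal K L, LieModule.IsNilpotent I V → I = ⊥) (I : LieIdeal K L)
    (h : ∀ x ∈ I, _root_.IsNilpotent (toEnd K L V x)) : I = ⊥ :=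
  hnil I ((LieModule.isNilpotent_iff_forall' (R := K)).2 fun x => h x x.2)

open LieModule LieAlgebra in
/-- A Lie algebra in characteristic zero with a finite dimensional representation for which no
nonzero ideal acts nilpotently is the sum of its center and its derived algebra. -/
theorem center_sup_derived_eq_top [CharZero K] [FiniteDimensional K L]
    (hnil : ∀ I : LieIdeal K L, LieModule.IsNilpotent I V → I = ⊥) :
    (center K L).toSubmodule ⊔ (⁅(⊤ : LieIdeal K L), (⊤ : LieIdeal K L)⁆).toSubmodule = ⊤ := by
  have hspan : ∀ I J : LieIdeal K L, ∀ x ∈ ⁅I, J⁆,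
      x ∈ Submodule.span K {m | ∃ a ∈ I, ∃ b ∈ J, ⁅a, b⁆ = m} := by
    intro I J x hx
    rwa [← LieSubmodule.mem_toSubmodule, LieSubmodule.lieIdeal_oper_eq_linear_span'] at hx
  let b : LieIdeal K L := InvariantForm.orthogonal (traceForm K L V)
    (traceForm_lieInvariant K L V) ⊤
  have hb : ∀ y ∈ b, ∀ x, traceForm K L V x y = 0 := fun y hy x =>
    (InvariantForm.mem_orthogonal _ _ _ _).1 hy x trivial
  have hb' : ∀ y, (∀ x, traceForm K L V x y = 0) → y ∈ b := fun y hy =>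
    (InvariantForm.mem_orthogonal _ _ _ _).2 fun x _ => hy x
  -- the radical of the trace form is abelian
  have hbab : ⁅b, b⁆ = ⊥ := by
    apply eq_bot_of_forall_isNilpotent_toEnd (V := V) hnil
    have htf : traceForm K b V = 0 := by
      ext x y
      exact hb y y.2 x
    have hn := (LieModule.isNilpotent_iff_forall' (R := K)).1
      (isNilpotent_derivedSeries_of_traceForm_eq_zero htf)
    intro x hx
    have hxb : x ∈ b := LieSubmodule.lie_le_left b b hx
    refine hn ⟨⟨x, hxb⟩, ?_⟩
    rw [LieIdeal.derivedSeries_eq_derivedSeriesOfIdeal_comap]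
    exact hx
  have hbcomm : ∀ x ∈ b, ∀ y ∈ b, ⁅x, y⁆ = 0 := by
    intro x hx y hy
    have := LieSubmodule.lie_mem_lie hx hy
    rwa [hbab] at this
  have hLb : ⁅(⊤ : LieIdeal K L), b⁆ = ⊥ := by
    apply eq_bot_of_forall_isNilpotent_toEnd (V := V) hnil
    intro x hx
    apply isNilpotent_toEnd_of_mem_span_lie
    have hxb : x ∈ b := LieSubmodule.lie_le_right _ _ hx
    refine Submodule.span_mono ?_ (hspan _ _ x hx)
    rintro _ ⟨a, -, c, hc, rfl⟩
    exact ⟨a, c, hbcomm x hxb c hc, rfl⟩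
  have hbc : b ≤ center K L := by
    intro x hx
    rw [mem_maxTrivSubmodule]
    intro y
    have := LieSubmodule.lie_mem_lie (I := (⊤ : LieIdeal K L)) (x := y) trivial hx
    rwa [hLb] at this
  have hzh : center K L ⊓ ⁅(⊤ : LieIdeal K L), (⊤ : LieIdeal K L)⁆ = ⊥ := by
    apply eq_bot_of_forall_isNilpotent_toEnd (V := V) hnil
    rintro x ⟨hx1, hx2⟩
    apply isNilpotent_toEnd_of_mem_span_lie
    refine Submodule.span_mono ?_ (hspan _ _ x hx2)
    rintro _ ⟨a, -, c, -, rfl⟩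
    refine ⟨a, c, ?_, rfl⟩
    rw [← lie_skew, (mem_maxTrivSubmodule K L L x).1 hx1 c, neg_zero]
  set z := (center K L).toSubmodule with hz
  set h := (⁅(⊤ : LieIdeal K L), (⊤ : LieIdeal K L)⁆).toSubmodule with hh
  have hzh' : z ⊓ h = ⊥ := by
    rw [hz, hh, ← LieSubmodule.inf_toSubmodule, hzh, LieSubmodule.bot_toSubmodule]
  -- the orthogonal complement of the derived algebra is contained in the center
  let f : L →ₗ[K] Module.Dual K h := (Submodule.subtype h).dualMap ∘ₗ traceForm K L V
  have hf : LinearMap.ker f ≤ z := by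
    intro x hx
    change x ∈ center K L
    rw [mem_maxTrivSubmodule]
    intro y
    have h1 : ⁅x, y⁆ ∈ b := by
      apply hb'
      intro w
      rw [traceForm_comm, traceForm_apply_lie_apply]
      exact LinearMap.congr_fun (LinearMap.mem_ker.1 hx)
        ⟨⁅y, w⁆, LieSubmodule.lie_mem_lie trivial trivial⟩
    have h2 : ⁅x, y⁆ ∈ center K L ⊓ ⁅(⊤ : LieIdeal K L), (⊤ : LieIdeal K L)⁆ :=
      ⟨hbc h1, LieSubmodule.lie_mem_lie trivial trivial⟩
    rw [hzh] at h2
    rw [← lie_skew, (LieSubmodule.mem_bot _).1 h2, neg_zero]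
  apply Submodule.eq_top_of_finrank_eq
  have e1 := Submodule.finrank_sup_add_finrank_inf_eq z h
  rw [hzh', finrank_bot, add_zero] at e1
  have e2 := LinearMap.finrank_range_add_finrank_ker f
  have e3 := Submodule.finrank_le (LinearMap.range f)
  rw [Subspace.dual_finrank_eq] at e3
  have e4 := Submodule.finrank_mono hf
  have e5 := Submodule.finrank_le (z ⊔ h)
  omega

end LinearAlgebra

/-! ### Lifting along square-zero extensions in characteristic zero -/

section Fields

/-- Every extension of fields of characteristic zero is formally smooth. -/
theorem formallySmooth_of_charZero (F L : Type*) [Field F] [Field L] [Algebra F L] [CharZero F] :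
    Algebra.FormallySmooth F L := by
  obtain ⟨ι, v, hv⟩ := exists_isTranscendenceBasis' F L
  have : Algebra.IsAlgebraic (IntermediateField.adjoin F (Set.range v)) L := hv.isAlgebraic_field
  exact Algebra.FormallySmooth.of_algebraicIndependent_of_isSeparable hv.1

/-- In characteristic zero, a field extension `F → L` lifts along nilpotent extensions `S → L`. -/
theorem exists_lift_of_charZero {F L S : Type*} [Field F] [CharZero F] [Field L] [CommRing S]
    (i : F →+* L) (j : F →+* S) (π : S →+* L) (hπ : Function.Surjective π)
    (hn : IsNilpotent (RingHom.ker π)) (hij : π.comp j = i) :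
    ∃ σ : L →+* S, σ.comp i = j ∧ π.comp σ = RingHom.id L := by
  let := i.toAlgebra
  let := j.toAlgebra
  have := formallySmooth_of_charZero F L
  let π' : S →ₐ[F] L := { π with commutes' := fun r => RingHom.congr_fun hij r }
  let σ := Algebra.FormallySmooth.liftOfSurjective (AlgHom.id F L) π' hπ hn
  refine ⟨σ.toRingHom, ?_, ?_⟩
  · ext x
    exact σ.commutes x
  · ext x
    exact Algebra.FormallySmooth.liftOfSurjective_apply (AlgHom.id F L) π' hπ hn x

end Fields

/-! ### Convolution and point derivations -/

section Convolution

variable {K A S : Type u} [Field K] [CommRing A] [HopfAlgebra K A] [CommRing S] [Algebra K S]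

/-- The convolution of two linear maps from the Hopf algebra `A` to an algebra. -/
def conv (f g : A →ₗ[K] S) : A →ₗ[K] S :=
  LinearMap.mul' K S ∘ₗ TensorProduct.map f g ∘ₗ Coalgebra.comul

/-- A linear form on `A` as a linear map to the algebra `S`. -/
def scal (S : Type u) [CommRing S] [Algebra K S] (φ : A →ₗ[K] K) : A →ₗ[K] S :=
  Algebra.linearMap K S ∘ₗ φ

@[simp] theorem scal_apply (φ : A →ₗ[K] K) (a : A) : scal S φ a = algebraMap K S (φ a) := rfl

theorem conv_repr (f g : A →ₗ[K] S) {ι : Type*} {a : A} (r : Coalgebra.Repr K a ι) :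
    conv f g a = ∑ i ∈ r.index, f (r.left i) * g (r.right i) := by
  simp [conv, ← r.eq]

theorem conv_assoc (f g h : A →ₗ[K] S) : conv (conv f g) h = conv f (conv g h) :=
  congrArg WithConv.ofConv
    (mul_assoc (WithConv.toConv f) (WithConv.toConv g) (WithConv.toConv h))

theorem conv_counit (f : A →ₗ[K] S) : conv f (scal S Coalgebra.counit) = f :=
  congrArg WithConv.ofConv (mul_one (WithConv.toConv f))

theorem counit_conv (f : A →ₗ[K] S) : conv (scal S Coalgebra.counit) f = f :=
  congrArg WithConv.ofConv (one_mul (WithConv.toConv f))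

theorem Pt.mul_toLinearMap (x y : Pt K A S) :
    (x * y).hom.toLinearMap = conv x.hom.toLinearMap y.hom.toLinearMap := by
  ext a
  rw [conv_repr _ _ (Coalgebra.Repr.arbitrary K a)]
  exact Pt.mul_apply_repr _ _ _

theorem Pt.one_toLinearMap : (1 : Pt K A S).hom.toLinearMap = scal S Coalgebra.counit := rfl

theorem conv_comp {T : Type u} [CommRing T] [Algebra K T] (h : S →ₐ[K] T) (f g : A →ₗ[K] S) :
    h.toLinearMap ∘ₗ conv f g = conv (h.toLinearMap ∘ₗ f) (h.toLinearMap ∘ₗ g) := by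
  ext a
  simp [conv_repr _ _ (Coalgebra.Repr.arbitrary K a)]

/-- The operator `a ↦ ∑ a₁ φ(a₂)` on `A` attached to a linear form `φ`; these are the operators
invariant under left translation. -/
def rAct (φ : A →ₗ[K] K) : A →ₗ[K] A := conv LinearMap.id (scal A φ)

theorem rAct_repr (φ : A →ₗ[K] K) {ι : Type*} {a : A} (r : Coalgebra.Repr K a ι) :
    rAct φ a = ∑ i ∈ r.index, φ (r.right i) • r.left i := by
  rw [rAct, conv_repr _ _ r]
  simp [Algebra.smul_def, mul_comm]

/-- The operator `a ↦ ∑ φ(a₁) a₂` on `A`. -/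
def lAct (φ : A →ₗ[K] K) : A →ₗ[K] A := conv (scal A φ) LinearMap.id

theorem lAct_repr (φ : A →ₗ[K] K) {ι : Type*} {a : A} (r : Coalgebra.Repr K a ι) :
    lAct φ a = ∑ i ∈ r.index, φ (r.left i) • r.right i := by
  rw [lAct, conv_repr _ _ r]
  simp [Algebra.smul_def]

theorem comp_rAct (f : A →ₗ[K] S) (φ : A →ₗ[K] K) : f ∘ₗ rAct φ = conv f (scal S φ) := by
  ext a
  rw [LinearMap.comp_apply, rAct_repr _ (Coalgebra.Repr.arbitrary K a),
    conv_repr _ _ (Coalgebra.Repr.arbitrary K a), map_sum]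
  simp only [map_smul]
  simp [Algebra.smul_def, mul_comm]

theorem comp_lAct (f : A →ₗ[K] S) (φ : A →ₗ[K] K) : f ∘ₗ lAct φ = conv (scal S φ) f := by
  ext a
  rw [LinearMap.comp_apply, lAct_repr _ (Coalgebra.Repr.arbitrary K a),
    conv_repr _ _ (Coalgebra.Repr.arbitrary K a), map_sum]
  simp only [map_smul]
  simp [Algebra.smul_def]

theorem counit_rAct (φ : A →ₗ[K] K) (a : A) : Coalgebra.counit (R := K) (rAct φ a) = φ a := by
  have h := comp_rAct (Coalgebra.counit (R := K) (A := A)) φ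
  have h2 := counit_conv φ
  exact LinearMap.congr_fun (h.trans h2) a

theorem counit_lAct (φ : A →ₗ[K] K) (a : A) : Coalgebra.counit (R := K) (lAct φ a) = φ a := by
  have h := comp_lAct (Coalgebra.counit (R := K) (A := A)) φ
  have h2 := conv_counit φ
  exact LinearMap.congr_fun (h.trans h2) a

theorem scal_conv (φ ψ : A →ₗ[K] K) : scal S (conv φ ψ) = conv (scal S φ) (scal S ψ) :=
  conv_comp (Algebra.ofId K S) φ ψ

theorem rAct_rAct (φ ψ : A →ₗ[K] K) : rAct φ ∘ₗ rAct ψ = rAct (conv φ ψ) := by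
  rw [comp_rAct, rAct, conv_assoc, ← scal_conv, rAct]

theorem rAct_lAct (φ ψ : A →ₗ[K] K) : rAct φ ∘ₗ lAct ψ = lAct ψ ∘ₗ rAct φ := by
  rw [comp_rAct, comp_lAct, rAct, lAct, conv_assoc]

theorem rAct_counit : rAct (Coalgebra.counit : A →ₗ[K] K) = LinearMap.id := conv_counit _

theorem apply_rAct (φ ψ : A →ₗ[K] K) (a : A) : φ (rAct ψ a) = conv φ ψ a :=
  LinearMap.congr_fun (comp_rAct φ ψ) a

theorem apply_lAct (φ ψ : A →ₗ[K] K) (a : A) : φ (lAct ψ a) = conv ψ φ a :=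
  LinearMap.congr_fun (comp_lAct φ ψ) a

variable (K A) in
/-- The Lie algebra of `G`: the point derivations of `A` at the identity. -/
def pointDer : Submodule K (A →ₗ[K] K) where
  carrier := {D | ∀ a b, D (a * b) =
      Coalgebra.counit (R := K) a * D b + D a * Coalgebra.counit (R := K) b}
  zero_mem' := by simp
  add_mem' := by
    intro D D' h1 h1' a b
    simp only [LinearMap.add_apply, h1 a b, h1' a b]; ring
  smul_mem' := by
    intro c D h1 a b
    simp only [LinearMap.smul_apply, h1 a b, smul_eq_mul]; ring

theorem lieDer_le_pointDer : lieDer K A ≤ pointDer K A := fun _ hD => hD.1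

theorem pointDer_one {D : A →ₗ[K] K} (hD : D ∈ pointDer K A) : D 1 = 0 := by
  have h := hD 1 1
  simp only [mul_one, Bialgebra.counit_one, one_mul] at h
  simpa using h

/-- The point of `G` over the dual numbers given by a point `x` and a derivation over `x`. -/
def dualPt (x : Pt K A S) (d : A →ₗ[K] S)
    (hd : ∀ a b, d (a * b) = x.hom a * d b + d a * x.hom b) : Pt K A (DualNumber S) where
  hom := AlgHom.ofLinearMap
    ((TrivSqZeroExt.inlAlgHom K S S).toLinearMap ∘ₗ x.hom.toLinearMap +
      (TrivSqZeroExt.inrHom S S).restrictScalars K ∘ₗ d)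
    (by
      have h := hd 1 1
      simp only [mul_one, map_one, one_mul] at h
      have h1 : d 1 = 0 := by simpa using h
      simp [h1])
    (by
      intro a b
      ext
      · simp
      · simp [hd, mul_comm])

@[simp] theorem dualPt_fst (x : Pt K A S) (d : A →ₗ[K] S)
    (hd : ∀ a b, d (a * b) = x.hom a * d b + d a * x.hom b) (a : A) :
    TrivSqZeroExt.fst ((dualPt x d hd).hom a) = x.hom a := by
  simp [dualPt]

@[simp] theorem dualPt_snd (x : Pt K A S) (d : A →ₗ[K] S)
    (hd : ∀ a b, d (a * b) = x.hom a * d b + d a * x.hom b) (a : A) :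
    TrivSqZeroExt.snd ((dualPt x d hd).hom a) = d a := by
  simp [dualPt]

/-- The reduction of a point over the dual numbers. -/
def Pt.fst (y : Pt K A (DualNumber S)) : Pt K A S := Pt.map (TrivSqZeroExt.fstHom K S S) y

/-- The derivative of a point over the dual numbers. -/
def Pt.snd (y : Pt K A (DualNumber S)) : A →ₗ[K] S :=
  (TrivSqZeroExt.sndHom S S).restrictScalars K ∘ₗ y.hom.toLinearMap

theorem Pt.fst_apply (y : Pt K A (DualNumber S)) (a : A) :
    y.fst.hom a = TrivSqZeroExt.fst (y.hom a) := rfl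

theorem Pt.snd_apply (y : Pt K A (DualNumber S)) (a : A) :
    y.snd a = TrivSqZeroExt.snd (y.hom a) := rfl

theorem Pt.dual_ext {y y' : Pt K A (DualNumber S)} (h1 : y.fst = y'.fst) (h2 : y.snd = y'.snd) :
    y = y' := by
  ext a
  · exact congrArg (fun t : Pt K A S => t.hom a) h1
  · exact LinearMap.congr_fun h2 a

theorem Pt.fst_mul (y y' : Pt K A (DualNumber S)) : (y * y').fst = y.fst * y'.fst := map_mul _ _ _

theorem Pt.fst_inv (y : Pt K A (DualNumber S)) : (y⁻¹).fst = y.fst⁻¹ := map_inv _ _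

theorem Pt.snd_mul (y y' : Pt K A (DualNumber S)) : (y * y').snd =
    conv y.fst.hom.toLinearMap y'.snd + conv y.snd y'.fst.hom.toLinearMap := by
  ext a
  rw [Pt.snd_apply, Pt.mul_apply_repr _ _ (Coalgebra.Repr.arbitrary K a), LinearMap.add_apply,
    conv_repr _ _ (Coalgebra.Repr.arbitrary K a), conv_repr _ _ (Coalgebra.Repr.arbitrary K a),
    ← Finset.sum_add_distrib, TrivSqZeroExt.snd_sum]
  refine Finset.sum_congr rfl fun i _ => ?_
  simp [Pt.fst_apply, Pt.snd_apply, mul_comm]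

theorem Pt.snd_mul_apply (y : Pt K A (DualNumber S)) (a b : A) :
    y.snd (a * b) = y.fst.hom a * y.snd b + y.snd a * y.fst.hom b := by
  simp [Pt.fst_apply, Pt.snd_apply, mul_comm]

/-- A point as a constant point over the dual numbers. -/
def Pt.inl (x : Pt K A S) : Pt K A (DualNumber S) := Pt.map (TrivSqZeroExt.inlAlgHom K S S) x

@[simp] theorem Pt.inl_fst (x : Pt K A S) : x.inl.fst = x := rfl

@[simp] theorem Pt.inl_snd (x : Pt K A S) : x.inl.snd = 0 := by
  ext a; rfl

theorem Pt.inl_inv (x : Pt K A S) : x⁻¹.inl = x.inl⁻¹ := map_inv _ _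

theorem Pt.inl_mul (x y : Pt K A S) : (x * y).inl = x.inl * y.inl := map_mul _ _ _

theorem Pt.inl_mul_snd (x : Pt K A S) (y : Pt K A (DualNumber S)) :
    (x.inl * y).snd = conv x.hom.toLinearMap y.snd := by
  rw [Pt.snd_mul, Pt.inl_fst, Pt.inl_snd]
  ext a
  simp [conv_repr _ _ (Coalgebra.Repr.arbitrary K a)]

/-- Left invariant operators attached to point derivations are derivations. -/
theorem rAct_mul {D : A →ₗ[K] K} (hD : D ∈ pointDer K A) (a b : A) :
    rAct D (a * b) = a * rAct D b + rAct D a * b := by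
  have hd : ∀ a b, scal A D (a * b) =
      (1 : Pt K A A).hom a * scal A D b + scal A D a * (1 : Pt K A A).hom b := by
    intro a b
    simp [hD a b, Pt.one_hom, Algebra.ofId_apply]
  let y : Pt K A (DualNumber A) := dualPt 1 (scal A D) hd
  have hy : y.snd = scal A D := by
    ext a; exact dualPt_snd _ _ hd a
  have h : ((Pt.univ K A).inl * y).snd = rAct D := by
    rw [Pt.inl_mul_snd, hy]; rfl
  have h1 : y.fst = 1 := by
    ext a; exact dualPt_fst _ _ hd a
  have h2 := Pt.snd_mul_apply ((Pt.univ K A).inl * y) a b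
  rw [h, Pt.fst_mul, h1, mul_one] at h2
  exact h2

/-- The translate of a tangent vector at `x` to the identity. -/
theorem Pt.snd_eq_conv (y : Pt K A (DualNumber S)) : ∃ D : A →ₗ[K] S,
    (∀ a b, D (a * b) = algebraMap K S (Coalgebra.counit a) * D b +
      D a * algebraMap K S (Coalgebra.counit b)) ∧ y.snd = conv y.fst.hom.toLinearMap D ∧
      D = conv (y.fst⁻¹).hom.toLinearMap y.snd := by
  refine ⟨(y.fst.inl⁻¹ * y).snd, fun a b => ?_, ?_, ?_⟩
  · rw [Pt.snd_mul_apply, Pt.fst_mul, Pt.fst_inv, Pt.inl_fst, inv_mul_cancel]; rfl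
  · rw [← Pt.inl_mul_snd, mul_inv_cancel_left]
  · rw [← Pt.inl_inv, Pt.inl_mul_snd]

end Convolution

/-! ### Ideals stable under invariant derivations -/

section Stable

theorem tensor_eq_zero_of_slices {K V W : Type*} [Field K] [AddCommGroup V] [Module K V]
    [AddCommGroup W] [Module K W] (F : V ⊗[K] W)
    (h : ∀ c : W →ₗ[K] K, TensorProduct.rid K V (c.lTensor V F) = 0) : F = 0 := by
  classical
  let b := Module.Basis.ofVectorSpace K W
  obtain ⟨c, hc⟩ := TensorProduct.eq_repr_basis_right b F
  have hcm : c = 0 := by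
    ext i
    have := h (b.coord i)
    rw [← hc] at this
    simp only [Finsupp.sum, map_sum, LinearMap.lTensor_tmul, Module.Basis.coord_apply,
      Module.Basis.repr_self, TensorProduct.rid_tmul, Finsupp.single_apply, ite_smul, one_smul,
      zero_smul, Finset.sum_ite_eq', Finsupp.mem_support_iff] at this
    by_cases h0 : c i = 0
    · exact h0
    · simp [h0] at this
  rw [← hc, hcm, Finsupp.sum_zero_index]

variable {K A : Type u} [Field K] [CommRing A] [HopfAlgebra K A]

theorem conv_eq_zero_of_slices {S : Type u} [CommRing S] [Algebra K S]
    (f g : A →ₗ[K] S) (a : A) (h : ∀ c : S →ₗ[K] K, f (rAct (c ∘ₗ g) a) = 0) :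
    conv f g a = 0 := by
  have h1 : TensorProduct.map f g (Coalgebra.comul (R := K) a) = 0 := by
    apply tensor_eq_zero_of_slices
    intro c
    rw [← h c, rAct_repr _ (Coalgebra.Repr.arbitrary K a), map_sum]
    conv_lhs => rw [← (Coalgebra.Repr.arbitrary K a).eq]
    simp
  simp [conv, h1]

theorem exists_pointDer_injective [Algebra.FiniteType K A] :
    ∃ (s : Finset A) (f : pointDer K A →ₗ[K] (s → K)), Function.Injective f := by
  obtain ⟨s, hs⟩ := (‹Algebra.FiniteType K A›).out
  let f : pointDer K A →ₗ[K] (s → K) :=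
    LinearMap.pi fun i => (LinearMap.applyₗ (i : A)) ∘ₗ (pointDer K A).subtype
  refine ⟨s, f, ?_⟩
  rw [injective_iff_map_eq_zero]
  intro D hD
  ext a
  have ha : a ∈ Algebra.adjoin K (s : Set A) := by rw [hs]; trivial
  change D.1 a = 0
  induction ha using Algebra.adjoin_induction with
  | mem x hx => exact congrFun hD ⟨x, hx⟩
  | algebraMap r => rw [Algebra.algebraMap_eq_smul_one, map_smul, pointDer_one D.2, smul_zero]
  | add x y _ _ hx hy => rw [map_add, hx, hy, add_zero]
  | mul x y _ _ hx hy => rw [D.2, hx, hy, mul_zero, zero_mul, add_zero]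

instance [Algebra.FiniteType K A] : FiniteDimensional K (pointDer K A) := by
  obtain ⟨s, f, hf⟩ := exists_pointDer_injective (K := K) (A := A)
  exact FiniteDimensional.of_injective f hf

variable [CharZero K]

/-- At every closed point the invariant derivations separate tangent directions. -/
theorem mem_sq_of_forall_rAct_mem (M : Ideal A) [hM : M.IsMaximal] {a : A} (ha : a ∈ M)
    (h : ∀ D ∈ pointDer K A, rAct D a ∈ M) : a ∈ M ^ 2 := by
  by_contra hna
  let : Field (A ⧸ M) := Ideal.Quotient.field M
  let π : (A ⧸ M ^ 2) →+* (A ⧸ M) := Ideal.Quotient.factor (Ideal.pow_le_self two_ne_zero)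
  have hker : RingHom.ker π = M.map (Ideal.Quotient.mk (M ^ 2)) :=
    Ideal.Quotient.factor_ker (Ideal.pow_le_self two_ne_zero)
  have hsq : RingHom.ker π ^ 2 = ⊥ := by
    rw [hker, ← Ideal.map_pow, Ideal.map_quotient_self]
  obtain ⟨σ, hσ1, hσ2⟩ := exists_lift_of_charZero (algebraMap K (A ⧸ M))
    (algebraMap K (A ⧸ M ^ 2)) π (Ideal.Quotient.factor_surjective _) ⟨2, hsq⟩ rfl
  have hσ2' : ∀ x, π (σ x) = x := fun x => RingHom.congr_fun hσ2 x
  let : Algebra (A ⧸ M) (A ⧸ M ^ 2) := σ.toAlgebra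
  have hsmul : ∀ (x : A ⧸ M) (y : A ⧸ M ^ 2), x • y = σ x * y := fun x y => rfl
  let a' : A ⧸ M ^ 2 := Ideal.Quotient.mk _ a
  have ha' : a' ≠ 0 := fun h0 => hna (Ideal.Quotient.eq_zero_iff_mem.1 h0)
  obtain ⟨l, hl⟩ := Module.Projective.exists_dual_ne_zero (A ⧸ M) ha'
  have hlσ : ∀ x y, l (σ x * y) = x * l y := fun x y => l.map_smul x y
  have hπ : ∀ b : A, π (Ideal.Quotient.mk _ b) = Ideal.Quotient.mk M b := fun b => rfl
  let rem : A → A ⧸ M ^ 2 := fun b => Ideal.Quotient.mk _ b - σ (Ideal.Quotient.mk M b)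
  have hrem : ∀ b, rem b ∈ RingHom.ker π := by
    intro b
    rw [RingHom.mem_ker, map_sub, hπ, hσ2', sub_self]
  have hσK : ∀ c : K, σ (algebraMap K (A ⧸ M) c) = algebraMap K (A ⧸ M ^ 2) c :=
    fun c => RingHom.congr_fun hσ1 c
  let δ : A →ₗ[K] A ⧸ M :=
    { toFun := fun b => l (rem b)
      map_add' := fun b c => by
        rw [← map_add]
        congr 1
        simp only [rem, map_add]
        ring
      map_smul' := fun c b => by
        have h1 : rem (c • b) = σ (algebraMap K (A ⧸ M) c) * rem b := by
          simp only [rem, Algebra.smul_def, map_mul]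
          have h2 : Ideal.Quotient.mk M (algebraMap K A c) = algebraMap K (A ⧸ M) c := rfl
          rw [mul_sub, h2, hσK]
          rfl
        rw [h1, hlσ, RingHom.id_apply, Algebra.smul_def] }
  let x : Pt K A (A ⧸ M) := ⟨Ideal.Quotient.mkₐ K M⟩
  have hδ : ∀ b c, δ (b * c) = x.hom b * δ c + δ b * x.hom c := by
    intro b c
    have h0 : rem b * rem c = 0 := by
      have := Ideal.mul_mem_mul (hrem b) (hrem c)
      rwa [← sq, hsq] at this
    have h1 : rem (b * c) =
        σ (Ideal.Quotient.mk M b) * rem c + σ (Ideal.Quotient.mk M c) * rem b := by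
      rw [← sub_eq_zero, ← h0]
      simp only [rem, map_mul]
      ring
    change l (rem (b * c)) = Ideal.Quotient.mk M b * l (rem c) + l (rem b) * Ideal.Quotient.mk M c
    rw [h1, map_add, hlσ, hlσ, mul_comm (l (rem b))]
  obtain ⟨D, hD, hD', -⟩ := (dualPt x δ hδ).snd_eq_conv
  have hfst : (dualPt x δ hδ).fst = x := by
    ext b; exact dualPt_fst _ _ hδ b
  have hsnd : (dualPt x δ hδ).snd = δ := by
    ext b; exact dualPt_snd _ _ hδ b
  rw [hfst, hsnd] at hD'
  apply hl
  have h2 : δ a = l a' := by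
    change l (a' - σ (Ideal.Quotient.mk M a)) = l a'
    rw [Ideal.Quotient.eq_zero_iff_mem.2 ha, map_zero, sub_zero]
  rw [← h2, hD']
  apply conv_eq_zero_of_slices
  intro c
  refine Ideal.Quotient.eq_zero_iff_mem.2 (h _ fun b b' => ?_)
  simp only [LinearMap.comp_apply, hD, ← Algebra.smul_def, mul_comm (D b), map_add, map_smul,
    smul_eq_mul, mul_comm (c (D b))]

/-- An Euler operator at a closed point. -/
theorem exists_euler [Algebra.FiniteType K A] (M : Ideal A) [hM : M.IsMaximal] :
    ∃ (n : ℕ) (x : Fin n → A) (D : Fin n → A →ₗ[K] K), (∀ i, x i ∈ M) ∧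
      (∀ i, D i ∈ pointDer K A) ∧ ∀ a ∈ M, ∑ i, x i * rAct (D i) a - a ∈ M ^ 2 := by
  obtain ⟨n, b, hb⟩ := Module.Finite.exists_fin (R := K) (M := pointDer K A)
  let : Field (A ⧸ M) := Ideal.Quotient.field M
  let f : M →ₗ[A] (Fin (n) → A ⧸ M) :=
    { toFun := fun a i => Ideal.Quotient.mk M (rAct (b i).1 a)
      map_add' := fun a a' => by
        ext i; simp
      map_smul' := fun c a => by
        ext i
        simp only [RingHom.id_apply, Pi.smul_apply, Submodule.coe_smul, smul_eq_mul]
        rw [rAct_mul (b i).2, map_add, map_mul, map_mul,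
          Ideal.Quotient.eq_zero_iff_mem.2 a.2, mul_zero, add_zero]
        rfl }
  have hf : ∀ a : M, f a = 0 → (a : A) ∈ M ^ 2 := by
    intro a ha
    refine mem_sq_of_forall_rAct_mem (K := K) M a.2 fun D hD => ?_
    obtain ⟨c, hc⟩ := (Submodule.mem_span_range_iff_exists_fun K).1
      (hb ▸ Submodule.mem_top : (⟨D, hD⟩ : pointDer K A) ∈ Submodule.span K (Set.range b))
    have h1 : rAct D (a : A) = ∑ i, c i • rAct (b i).1 (a : A) := by
      have h2 : D = ∑ i, c i • (b i).1 := by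
        have := congrArg Subtype.val hc
        rw [Submodule.coe_sum] at this
        exact this.symm
      conv_lhs => rw [h2]
      simp only [rAct_repr _ (Coalgebra.Repr.arbitrary K (a : A)), LinearMap.sum_apply,
        LinearMap.smul_apply, Finset.sum_smul, Finset.smul_sum, smul_assoc]
      exact Finset.sum_comm
    rw [h1]
    refine Ideal.sum_mem _ fun i _ => ?_
    rw [Algebra.smul_def]
    exact M.mul_mem_left _ (Ideal.Quotient.eq_zero_iff_mem.1 (congrFun ha i))
  let g : M.Cotangent →ₗ[A] (Fin (n) → A ⧸ M) :=
    Ideal.Cotangent.lift f (by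
      intro x y
      ext i
      change Ideal.Quotient.mk M (rAct (b i).1 ((x : A) * y)) = 0
      rw [rAct_mul (b i).2, map_add, map_mul, map_mul, Ideal.Quotient.eq_zero_iff_mem.2 x.2,
        Ideal.Quotient.eq_zero_iff_mem.2 y.2, mul_zero, zero_mul, add_zero])
  let g' : M.Cotangent →ₗ[A ⧸ M] (Fin (n) → A ⧸ M) :=
    LinearMap.extendScalarsOfSurjective Ideal.Quotient.mk_surjective g
  have hg' : ∀ a : M, g' (M.toCotangent a) = f a := fun a => rfl
  obtain ⟨ψ, hψ⟩ := LinearMap.exists_leftInverse_of_injective g' (by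
    rw [LinearMap.ker_eq_bot']
    intro c hc
    obtain ⟨a, rfl⟩ := M.toCotangent_surjective c
    rw [hg'] at hc
    exact (M.toCotangent_eq_zero a).2 (hf a hc))
  choose x hx using fun i => M.toCotangent_surjective (ψ (Pi.single i 1))
  refine ⟨_, fun i => x i, fun i => (b i).1, fun i => (x i).2, fun i => (b i).2, fun a ha => ?_⟩
  have h1 : M.toCotangent (∑ i, rAct (b i).1 a • x i) = M.toCotangent ⟨a, ha⟩ := by
    have h2 := LinearMap.congr_fun hψ (M.toCotangent ⟨a, ha⟩)
    rw [LinearMap.comp_apply, hg', LinearMap.id_apply] at h2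
    rw [← h2, map_sum, LinearMap.pi_apply_eq_sum_univ ψ]
    refine Finset.sum_congr rfl fun i _ => ?_
    rw [map_smul, hx]
    rw [show (fun j => if i = j then (1 : A ⧸ M) else 0) = Pi.single i 1 by
      ext j; simp [Pi.single_apply, eq_comm]]
    rfl
  rw [Ideal.toCotangent_eq] at h1
  convert h1 using 2
  simp [mul_comm]

/-- A subspace of a maximal ideal that is stable under the invariant derivations is contained in all
powers of the ideal. -/
theorem mem_pow_of_stable [Algebra.FiniteType K A] (M : Ideal A) [hM : M.IsMaximal]
    (P : Submodule K A) (hPM : ∀ a ∈ P, a ∈ M)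
    (hP : ∀ D ∈ pointDer K A, ∀ a ∈ P, rAct D a ∈ P) (n : ℕ) : ∀ a ∈ P, a ∈ M ^ n := by
  obtain ⟨d, x, D, hx, hD, hE⟩ := exists_euler (K := K) M
  let E : A →ₗ[K] A := ∑ i, LinearMap.mulLeft K (x i) ∘ₗ rAct (D i)
  have hEa : ∀ a, E a = ∑ i, x i * rAct (D i) a := fun a => by simp [E]
  have hEmul : ∀ a b, E (a * b) = a * E b + E a * b := by
    intro a b
    simp only [hEa, rAct_mul (hD _), Finset.mul_sum, Finset.sum_mul, ← Finset.sum_add_distrib]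
    refine Finset.sum_congr rfl fun i _ => ?_
    ring
  have hpow : ∀ k : ℕ, ∀ a ∈ M ^ (k + 1), E a - (k + 1 : ℕ) * a ∈ M ^ (k + 2) := by
    intro k
    induction k with
    | zero =>
      intro a ha
      rw [zero_add, pow_one] at ha
      simpa [hEa] using hE a ha
    | succ k ih =>
      intro a ha
      rw [pow_succ] at ha
      induction ha using Submodule.mul_induction_on' with
      | mem_mul_mem u hu v hv =>
        have h1 := Ideal.mul_mem_mul (ih u hu) hv
        have h2 := Ideal.mul_mem_mul hu (hE v hv)
        rw [← hEa] at h2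
        rw [← pow_succ] at h1
        rw [← pow_add] at h2
        have h3 := Ideal.add_mem _ h1 h2
        convert h3 using 1
        rw [hEmul]
        push_cast
        ring
      | add u _ v _ hu hv =>
        convert Ideal.add_mem _ hu hv using 1
        rw [map_add]
        ring
  have hsucc : ∀ k : ℕ, ∀ a ∈ P, a ∈ M ^ (k + 1) := by
    intro k
    induction k with
    | zero => intro a ha; rw [zero_add, pow_one]; exact hPM a ha
    | succ k ih =>
      intro a ha
      have h1 := hpow k a (ih a ha)
      have h2 : E a ∈ M ^ (k + 2) := by
        rw [hEa]
        refine Ideal.sum_mem _ fun i _ => ?_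
        rw [pow_succ' M (k + 1)]
        exact Ideal.mul_mem_mul (hx i) (ih _ (hP _ (hD i) a ha))
      have h3 := Ideal.sub_mem _ h2 h1
      rw [sub_sub_cancel] at h3
      have h4 := (M ^ (k + 2)).mul_mem_left (algebraMap K A ((k + 1 : ℕ) : K)⁻¹) h3
      rwa [← mul_assoc, ← map_natCast (algebraMap K A) (k + 1), ← map_mul,
        inv_mul_cancel₀ (Nat.cast_ne_zero.2 k.succ_ne_zero), map_one, one_mul] at h4
  intro a ha
  exact Ideal.pow_le_pow_right n.le_succ (hsucc n a ha)

/-- On a connected group in characteristic zero there are no nontrivial ideals stable under the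
invariant derivations. -/
theorem eq_bot_or_eq_top_of_stable [Algebra.FiniteType K A] [ConnectedSpace (PrimeSpectrum A)]
    (I : Ideal A) (hI : ∀ D ∈ pointDer K A, ∀ a ∈ I, rAct D a ∈ I) : I = ⊥ ∨ I = ⊤ := by
  have : IsNoetherianRing A := Algebra.FiniteType.isNoetherianRing K A
  have hidem : I * I = I := by
    refine le_antisymm Ideal.mul_le_right fun x hx => ?_
    have h1 : I ⊔ Ideal.span {x} • ⊤ ≤ ⊤ := le_top
    let J : Ideal A := (Submodule.span A {x}).annihilator
    have h2 : I ⊔ J = ⊤ := by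
      by_contra hne
      obtain ⟨M, hM, hle⟩ := Ideal.exists_le_maximal _ hne
      have hx' : x ∈ (⨅ i : ℕ, M ^ i • ⊤ : Submodule A A) := by
        rw [Submodule.mem_iInf]
        intro n
        rw [smul_eq_mul, Ideal.mul_top]
        exact mem_pow_of_stable (K := K) M (I.restrictScalars K)
          (fun a ha => hle (Ideal.mem_sup_left ha)) hI n x hx
      obtain ⟨r, hr⟩ := (Ideal.mem_iInf_smul_pow_eq_bot_iff M x).1 hx'
      have h3 : 1 - (r : A) ∈ J := by
        rw [Submodule.mem_annihilator_span_singleton, sub_smul, hr, one_smul, sub_self]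
      have h4 := M.add_mem (hle (Ideal.mem_sup_right h3)) r.2
      rw [sub_add_cancel] at h4
      exact hM.ne_top ((Ideal.eq_top_iff_one M).2 h4)
    obtain ⟨i, hi, j, hj, hij⟩ := Submodule.mem_sup.1 (h2 ▸ Submodule.mem_top : (1 : A) ∈ I ⊔ J)
    have h5 : j * x = 0 := Submodule.mem_annihilator_span_singleton _ _ |>.1 hj
    have h6 : x = i * x := by
      conv_lhs => rw [← one_mul x, ← hij, add_mul, h5, add_zero]
    rw [h6]
    exact Ideal.mul_mem_mul hi hx
  obtain ⟨e, he, rfl⟩ := (Ideal.isIdempotentElem_iff_of_fg I (IsNoetherian.noetherian I)).1 hidem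
  have hclopen : IsClopen (PrimeSpectrum.basicOpen e : Set (PrimeSpectrum A)) :=
    PrimeSpectrum.isClopen_basicOpen_of_mul_add e (1 - e) (by rw [mul_sub, he.eq]; ring) (by ring)
  rcases isClopen_iff.1 hclopen with h | h
  · left
    have h1 : IsNilpotent e := by
      rw [← PrimeSpectrum.basicOpen_eq_bot_iff]
      exact TopologicalSpace.Opens.ext h
    obtain ⟨n, hn⟩ := h1
    have h2 : e = 0 := by
      rcases n with _ | n
      · rw [pow_zero] at hn
        rw [← mul_one e, hn, mul_zero]
      · rwa [he.pow_succ_eq] at hn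
    rw [h2, Submodule.span_zero_singleton]
  · right
    have h1 : IsUnit e := by
      by_contra hu
      obtain ⟨M, hM, heM⟩ := exists_max_ideal_of_mem_nonunits hu
      have : (⟨M, hM.isPrime⟩ : PrimeSpectrum A) ∈
          (PrimeSpectrum.basicOpen e : Set (PrimeSpectrum A)) := h ▸ Set.mem_univ _
      exact this heM
    exact Ideal.span_singleton_eq_top.2 h1

/-- In characteristic zero a connected affine algebraic group is integral. -/
theorem isDomain_of_connected [Algebra.FiniteType K A] [ConnectedSpace (PrimeSpectrum A)] :
    IsDomain A := by
  have hnt : Nontrivial A := (Bialgebra.counitAlgHom K A).toRingHom.domain_nontrivial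
  have hred : IsReduced A := by
    have hstab : ∀ D ∈ pointDer K A, ∀ a ∈ nilradical A, rAct D a ∈ nilradical A := by
      intro D hD a ha
      obtain ⟨n, hn⟩ := ha
      have hpow : ∀ x (m : ℕ), rAct D (x ^ (m + 1)) = (m + 1 : ℕ) * x ^ m * rAct D x := by
        intro x m
        induction m with
        | zero => simp
        | succ m ih =>
          rw [pow_succ, rAct_mul hD, ih]
          push_cast
          ring
      have hinv : ∀ (m : ℕ) (x : A), ((m + 1 : ℕ) : A) * x = 0 → x = 0 := by
        intro m x hx
        have h := congrArg (algebraMap K A ((m + 1 : ℕ) : K)⁻¹ * ·) hx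
        simp only [mul_zero] at h
        rwa [← mul_assoc, ← map_natCast (algebraMap K A) (m + 1), ← map_mul,
          inv_mul_cancel₀ (Nat.cast_ne_zero.2 m.succ_ne_zero), map_one, one_mul] at h
      have key : ∀ m j : ℕ, a ^ m * rAct D a ^ j = 0 → IsNilpotent (rAct D a) := by
        intro m
        induction m with
        | zero => intro j hj; exact ⟨j, by simpa using hj⟩
        | succ m ih =>
          intro j hj
          apply ih (j + 4)
          apply hinv m
          have h1 := congrArg (rAct D) (show a ^ (m + 1) * rAct D a ^ (j + 1) = 0 by
            rw [pow_succ (rAct D a), ← mul_assoc, hj, zero_mul])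
          rw [map_zero, rAct_mul hD, hpow, hpow] at h1
          have h2 := congrArg (· * rAct D a ^ 2) h1
          simp only [zero_mul] at h2
          linear_combination h2 - ((j + 1 : ℕ) : A) * rAct D (rAct D a) * rAct D a ^ 2 * hj
      exact mem_nilradical.2 (key n 0 (by rw [hn, zero_mul]))
    rcases eq_bot_or_eq_top_of_stable (K := K) (nilradical A) hstab with h | h
    · exact nilradical_eq_bot_iff.1 h
    · exact absurd (mem_nilradical.1 ((Ideal.eq_top_iff_one _).1 h)) not_isNilpotent_one
  have hann : ∀ a x : A, a * x = 0 → x ≠ 0 → a = 0 := by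
    intro a x hax hx
    have hstab : ∀ D ∈ pointDer K A, ∀ a ∈ (Submodule.span A {x}).annihilator,
        rAct D a ∈ (Submodule.span A {x}).annihilator := by
      intro D hD a ha
      rw [Submodule.mem_annihilator_span_singleton, smul_eq_mul] at ha ⊢
      have h1 := congrArg (rAct D) ha
      rw [map_zero, rAct_mul hD] at h1
      have h2 : (rAct D a * x) ^ 2 = 0 := by
        linear_combination (rAct D a * x) * h1 - rAct D a * rAct D x * ha
      exact pow_eq_zero_iff two_ne_zero |>.1 h2
    have ha : a ∈ (Submodule.span A {x}).annihilator := by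
      rwa [Submodule.mem_annihilator_span_singleton, smul_eq_mul]
    rcases eq_bot_or_eq_top_of_stable (K := K) _ hstab with h | h
    · rwa [h] at ha
    · have h1 := (Ideal.eq_top_iff_one _).1 h
      rw [Submodule.mem_annihilator_span_singleton, one_smul] at h1
      exact absurd h1 hx
  have : NoZeroDivisors A := ⟨fun {a x} h => by
    by_cases hx : x = 0
    · exact .inr hx
    · exact .inl (hann a x h hx)⟩
  exact NoZeroDivisors.to_isDomain A

/-- A subspace of functions vanishing at the identity that is stable under the invariant derivations
is zero. -/
theorem eq_zero_of_stable [Algebra.FiniteType K A] [ConnectedSpace (PrimeSpectrum A)]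
    (P : Submodule K A) (h0 : ∀ a ∈ P, Coalgebra.counit (R := K) a = 0)
    (hP : ∀ D ∈ pointDer K A, ∀ a ∈ P, rAct D a ∈ P) {a : A} (ha : a ∈ P) : a = 0 := by
  have hstab : ∀ D ∈ pointDer K A, ∀ a ∈ Ideal.span (P : Set A),
      rAct D a ∈ Ideal.span (P : Set A) := by
    intro D hD a ha
    induction ha using Submodule.span_induction with
    | mem x hx => exact Ideal.subset_span (hP D hD x hx)
    | zero => rw [map_zero]; exact Ideal.zero_mem _
    | add x y _ _ hx hy => rw [map_add]; exact Ideal.add_mem _ hx hy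
    | smul c x hx' hx =>
      rw [smul_eq_mul, rAct_mul hD]
      exact Ideal.add_mem _ (Ideal.mul_mem_left _ _ hx) (Ideal.mul_mem_left _ _ hx')
  have hle : Ideal.span (P : Set A) ≤ RingHom.ker (Bialgebra.counitAlgHom K A) :=
    Ideal.span_le.2 fun x hx => h0 x hx
  rcases eq_bot_or_eq_top_of_stable (K := K) _ hstab with h | h
  · have := Ideal.subset_span (α := A) ha
    rwa [h] at this
  · rw [h, top_le_iff] at hle
    exact absurd hle (RingHom.ker_ne_top _)

/-- On a connected group in characteristic zero, a subspace of `A` that is stable under the Lie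
algebra is a subcomodule. -/
theorem rAct_mem_of_stable [Algebra.FiniteType K A] [ConnectedSpace (PrimeSpectrum A)]
    (X : Submodule K A) (hX : ∀ D ∈ pointDer K A, ∀ a ∈ X, rAct D a ∈ X)
    (φ : A →ₗ[K] K) (hφ : ∀ a ∈ X, φ a = 0) {a : A} (ha : a ∈ X) : lAct φ a = 0 := by
  refine eq_zero_of_stable (X.map (lAct φ)) ?_ ?_ (Submodule.mem_map_of_mem ha)
  · rintro _ ⟨b, hb, rfl⟩
    rw [counit_lAct, hφ b hb]
  · rintro D hD _ ⟨b, hb, rfl⟩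
    refine ⟨rAct D b, hX D hD b hb, ?_⟩
    exact (LinearMap.congr_fun (rAct_lAct D φ) b).symm

/-- A Lie algebra element whose invariant derivation commutes with the Lie algebra is central. -/
theorem rAct_eq_lAct_of_commute [Algebra.FiniteType K A] [ConnectedSpace (PrimeSpectrum A)]
    (z : A →ₗ[K] K) (hz : ∀ D ∈ pointDer K A, conv D z = conv z D) : rAct z = lAct z := by
  ext a
  rw [← sub_eq_zero, ← LinearMap.sub_apply]
  refine eq_zero_of_stable (LinearMap.range (rAct z - lAct z)) ?_ ?_ ⟨a, rfl⟩
  · rintro _ ⟨b, rfl⟩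
    rw [LinearMap.sub_apply, map_sub, counit_lAct, counit_rAct, sub_self]
  · rintro D hD _ ⟨b, rfl⟩
    refine ⟨rAct D b, ?_⟩
    have h1 := LinearMap.congr_fun (rAct_rAct D z) b
    have h2 := LinearMap.congr_fun (rAct_rAct z D) b
    have h3 := LinearMap.congr_fun (rAct_lAct D z) b
    simp only [LinearMap.comp_apply] at h1 h2 h3
    rw [LinearMap.sub_apply, LinearMap.sub_apply, map_sub, h1, h2, h3, hz D hD]

end Stable

/-! ### Extension of point derivations from left coideal subalgebras -/

section Extension

variable {K A : Type u} [Field K] [CommRing A] [HopfAlgebra K A]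

/-- `C` is a left coideal subalgebra: `Δ(C) ⊆ A ⊗ C`. -/
def IsLeftCoideal (C : Subalgebra K A) : Prop :=
  ∀ c ∈ C, Coalgebra.comul (R := K) c ∈ (Algebra.TensorProduct.map (AlgHom.id K A) C.val).range

theorem idval_injective (C : Subalgebra K A) :
    Function.Injective (Algebra.TensorProduct.map (AlgHom.id K A) C.val) :=
  TensorProduct.map_injective_of_flat_flat (LinearMap.id : A →ₗ[K] A) C.val.toLinearMap
    Function.injective_id Subtype.val_injective

/-- The coaction `C → A ⊗ C` on a left coideal subalgebra. -/
def IsLeftCoideal.comul {C : Subalgebra K A} (h : IsLeftCoideal C) : C →ₐ[K] A ⊗[K] C :=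
  (AlgEquiv.ofInjective _ (idval_injective C)).symm.toAlgHom.comp
    (((Bialgebra.comulAlgHom K A).comp C.val).codRestrict _ (fun c => h c c.2))

theorem IsLeftCoideal.val_comul {C : Subalgebra K A} (h : IsLeftCoideal C) (c : C) :
    Algebra.TensorProduct.map (AlgHom.id K A) C.val (h.comul c) =
      Coalgebra.comul (R := K) (c : A) := by
  have := (AlgEquiv.ofInjective _ (idval_injective C)).apply_symm_apply
    (((Bialgebra.comulAlgHom K A).comp C.val).codRestrict _ (fun c => h c c.2) c)
  exact congrArg Subtype.val this

theorem IsLeftCoideal.conv_apply {C : Subalgebra K A} (h : IsLeftCoideal C) {S : Type u}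
    [CommRing S] [Algebra K S] (f g : A →ₗ[K] S) (c : C) :
    conv f g c = LinearMap.mul' K S (TensorProduct.map f (g ∘ₗ C.val.toLinearMap) (h.comul c)) := by
  rw [conv, LinearMap.comp_apply, LinearMap.comp_apply, ← h.val_comul]
  congr 1
  have : TensorProduct.map f (g ∘ₗ C.val.toLinearMap) =
      TensorProduct.map f g ∘ₗ (Algebra.TensorProduct.map (AlgHom.id K A) C.val).toLinearMap := by
    ext; simp
  rw [this]; rfl

theorem IsLeftCoideal.conv_congr {C : Subalgebra K A} (h : IsLeftCoideal C) {S : Type u}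
    [CommRing S] [Algebra K S] (f : A →ₗ[K] S) {g g' : A →ₗ[K] S} (hg : ∀ c : C, g c = g' c)
    (c : C) : conv f g c = conv f g' c := by
  have : g ∘ₗ C.val.toLinearMap = g' ∘ₗ C.val.toLinearMap := LinearMap.ext hg
  rw [h.conv_apply, h.conv_apply, this]

theorem exists_linear_retraction (K F : Type*) [Field K] [CommRing F] [Nontrivial F] [Algebra K F] :
    ∃ ℓ : F →ₗ[K] K, ∀ x : K, ℓ (algebraMap K F x) = x := by
  obtain ⟨ℓ, hℓ⟩ := LinearMap.exists_leftInverse_of_injective (Algebra.linearMap K F)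
    (LinearMap.ker_eq_bot.2 (algebraMap K F).injective)
  exact ⟨ℓ, fun x => LinearMap.congr_fun hℓ x⟩

theorem isNilpotent_ker_of_mul_eq_zero {S L : Type*} [CommRing S] [CommRing L] (π : S →+* L)
    (h : ∀ x y, π x = 0 → π y = 0 → x * y = 0) : IsNilpotent (RingHom.ker π) := by
  refine ⟨2, ?_⟩
  rw [Ideal.zero_eq_bot, eq_bot_iff, pow_two, Ideal.mul_le]
  intro x hx y hy
  exact h x y hx hy

theorem isNilpotent_ker_fst (S : Type*) [CommRing S] :
    IsNilpotent (RingHom.ker (TrivSqZeroExt.fstHom S S S).toRingHom) := by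
  refine isNilpotent_ker_of_mul_eq_zero _ fun x y hx hy => ?_
  have hx' : x.fst = 0 := hx
  have hy' : y.fst = 0 := hy
  ext <;> simp [hx', hy']

/-- Functoriality of the dual numbers. -/
def dualMap {S T : Type u} [CommRing S] [Algebra K S] [CommRing T] [Algebra K T] (f : S →ₐ[K] T) :
    DualNumber S →ₐ[K] DualNumber T :=
  { toFun := fun x => TrivSqZeroExt.inl (f x.fst) + TrivSqZeroExt.inr (f x.snd)
    map_one' := by ext <;> simp
    map_mul' := fun x y => by ext <;> simp
    map_zero' := by ext <;> simp
    map_add' := fun x y => by ext <;> simp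
    commutes' := fun r => by
      ext <;> simp [TrivSqZeroExt.algebraMap_eq_inl'] }

@[simp] theorem fst_dualMap {S T : Type u} [CommRing S] [Algebra K S] [CommRing T] [Algebra K T]
    (f : S →ₐ[K] T) (x : DualNumber S) :
    TrivSqZeroExt.fst (dualMap f x) = f (TrivSqZeroExt.fst x) := by
  simp [dualMap]

@[simp] theorem snd_dualMap {S T : Type u} [CommRing S] [Algebra K S] [CommRing T] [Algebra K T]
    (f : S →ₐ[K] T) (x : DualNumber S) :
    TrivSqZeroExt.snd (dualMap f x) = f (TrivSqZeroExt.snd x) := by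
  simp [dualMap]

theorem lift_toLinearMap {B C S : Type u} [CommRing B] [Algebra K B] [CommRing C] [Algebra K C]
    [CommRing S] [Algebra K S] (f : B →ₐ[K] S) (g : C →ₐ[K] S) :
    (Algebra.TensorProduct.lift f g (fun _ _ => .all _ _)).toLinearMap =
      LinearMap.mul' K S ∘ₗ TensorProduct.map f.toLinearMap g.toLinearMap := by
  ext; simp

/-- A derivation over the inclusion into the fraction field extends from a subalgebra. -/
theorem exists_extension_to_dualNumber [CharZero K] [IsDomain A] (C : Subalgebra K A)
    (w : C →ₐ[K] DualNumber (FractionRing A))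
    (hw : ∀ c, TrivSqZeroExt.fst (w c) = algebraMap A (FractionRing A) c) :
    ∃ y : Pt K A (DualNumber (FractionRing A)),
      (∀ c : C, y.hom c = w c) ∧
      ∀ a, TrivSqZeroExt.fst (y.hom a) = algebraMap A (FractionRing A) a := by
  let F := FractionRing A
  let E := FractionRing C
  have hCF : Function.Injective ((algebraMap A F).comp C.val.toRingHom) :=
    (IsFractionRing.injective A F).comp Subtype.val_injective
  let i : E →+* F := IsFractionRing.lift (A := C) (g := (algebraMap A F).comp C.val.toRingHom) hCF
  have hunit : ∀ c : nonZeroDivisors C, IsUnit (w.toRingHom c) := by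
    intro c
    rw [TrivSqZeroExt.isUnit_iff_isUnit_fst, isUnit_iff_ne_zero]
    intro h0
    have h1 := (hw c).symm.trans h0
    exact nonZeroDivisors.coe_ne_zero c ((injective_iff_map_eq_zero _).1 hCF _ h1)
  let j : E →+* DualNumber F := IsLocalization.lift hunit
  have hj : ∀ c : C, j (algebraMap C E c) = w c := fun c => IsLocalization.lift_eq hunit c
  have hi : ∀ c : C, i (algebraMap C E c) = algebraMap A F c := fun c =>
    IsFractionRing.lift_algebraMap hCF c
  have : CharZero E := charZero_of_injective_algebraMap (algebraMap K E).injective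
  obtain ⟨σ, h1, h2⟩ := exists_lift_of_charZero i j (TrivSqZeroExt.fstHom F F F).toRingHom
    (fun x => ⟨TrivSqZeroExt.inl x, rfl⟩) (isNilpotent_ker_fst F) (by
      refine IsLocalization.ringHom_ext (nonZeroDivisors C) (RingHom.ext fun c => ?_)
      change TrivSqZeroExt.fst (j (algebraMap C E c)) = i (algebraMap C E c)
      rw [hi, hj, hw])
  have h3 : ∀ c : C, σ (algebraMap A F c) = w c := by
    intro c
    rw [← hi, ← hj]
    exact RingHom.congr_fun h1 _
  refine ⟨⟨⟨σ.comp (algebraMap A F), fun r => ?_⟩⟩, h3, fun a => RingHom.congr_fun h2 _⟩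
  change σ (algebraMap A F (algebraMap K A r)) = _
  have := h3 (algebraMap K C r)
  rw [AlgHom.commutes] at this
  exact this

/-- Point derivations extend from left coideal subalgebras of an integral Hopf algebra in
characteristic zero. -/
theorem IsLeftCoideal.exists_pointDer [CharZero K] [IsDomain A] {C : Subalgebra K A}
    (hC : IsLeftCoideal C) (d : C →ₐ[K] DualNumber K)
    (hd : ∀ c, TrivSqZeroExt.fst (d c) = Coalgebra.counit (R := K) (c : A)) :
    ∃ D ∈ pointDer K A, ∀ c : C, D c = TrivSqZeroExt.snd (d c) := by
  let F := FractionRing A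
  let η : Pt K A F := ⟨IsScalarTower.toAlgHom K A F⟩
  let dF : C →ₐ[K] DualNumber F := (dualMap (Algebra.ofId K F)).comp d
  have hdF1 : ∀ c, (dF c).fst = algebraMap K F (d c).fst := by
    intro c
    simp [dF, Algebra.ofId_apply]
  have hdF2 : ∀ c, (dF c).snd = algebraMap K F (d c).snd := by
    intro c
    simp [dF, Algebra.ofId_apply]
  obtain ⟨d', hd'⟩ := LinearMap.exists_extend (p := Subalgebra.toSubmodule C) dF.toLinearMap
  have hd'' : ∀ c : C, d' c = dF c := fun c => LinearMap.congr_fun hd' c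
  let w : C →ₐ[K] DualNumber F :=
    (Algebra.TensorProduct.lift η.inl.hom dF (fun _ _ => .all _ _)).comp hC.comul
  have hw : ∀ c : C, w c = conv η.inl.hom.toLinearMap d' c := by
    intro c
    rw [hC.conv_apply]
    have : d' ∘ₗ C.val.toLinearMap = dF.toLinearMap := hd'
    rw [this]
    exact LinearMap.congr_fun (lift_toLinearMap _ _) (hC.comul c)
  have hfst : ∀ c : C, (w c).fst = algebraMap A F c := by
    intro c
    have h1 : TrivSqZeroExt.fst (w c) =
        conv η.hom.toLinearMap ((TrivSqZeroExt.fstHom K F F).toLinearMap ∘ₗ d') c := by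
      rw [hw]
      exact LinearMap.congr_fun (conv_comp (TrivSqZeroExt.fstHom K F F) _ d') c
    rw [h1, hC.conv_congr (g' := scal F Coalgebra.counit), conv_counit]
    · rfl
    · intro c
      change (d' c).fst = _
      rw [hd'', hdF1, hd]; rfl
  obtain ⟨y, hy1, hy2⟩ := exists_extension_to_dualNumber C w hfst
  have hyf : y.fst = η := by ext a; exact hy2 a
  let z := η.inl⁻¹ * y
  have hz : z.fst = 1 := by
    rw [Pt.fst_mul, Pt.fst_inv, Pt.inl_fst, hyf, inv_mul_cancel]
  have hzC : ∀ c : C, z.hom c = dF c := by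
    intro c
    change z.hom.toLinearMap c = _
    rw [Pt.mul_toLinearMap, hC.conv_congr (g' := conv η.inl.hom.toLinearMap d'), ← conv_assoc,
      ← Pt.mul_toLinearMap, inv_mul_cancel, Pt.one_toLinearMap, counit_conv, hd'']
    intro c
    rw [← hw, ← hy1]; rfl
  obtain ⟨ℓ, hℓ⟩ := exists_linear_retraction K F
  refine ⟨ℓ ∘ₗ z.snd, fun a b => ?_, fun c => ?_⟩
  · rw [LinearMap.comp_apply, Pt.snd_mul_apply, hz, map_add, Pt.one_hom]
    simp only [AlgHom.comp_apply, Algebra.ofId_apply, Bialgebra.counitAlgHom_apply]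
    rw [← Algebra.smul_def, mul_comm (z.snd a), ← Algebra.smul_def, map_smul, map_smul]
    simp [mul_comm]
  · rw [LinearMap.comp_apply, Pt.snd_apply, hzC, hdF2, hℓ]

end Extension

/-! ### Sections of torsors over the dual numbers -/

section TorsorLift

variable {K Q R S T : Type u} [Field K] [CommRing Q] [HopfAlgebra K Q] [CommRing R] [Algebra K R]
  [CommRing S] [Algebra K S] [CommRing T] [Algebra K T]

theorem Torsor.act_one (E : Torsor K Q R) (e : E.B →ₐ[K] S) : E.act 1 e = e := E.one_act S e

theorem Torsor.act_mul (E : Torsor K Q R) (g h : Pt K Q S) (e : E.B →ₐ[K] S) :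
    E.act (g * h) e = E.act g (E.act h e) := E.mul_act S g h e

theorem Torsor.act_comp_p (E : Torsor K Q R) (g : Pt K Q S) (e : E.B →ₐ[K] S) :
    (E.act g e).comp E.p = e.comp E.p := E.act_over S g e

theorem Torsor.comp_act (E : Torsor K Q R) (φ : S →ₐ[K] T) (g : Pt K Q S) (e : E.B →ₐ[K] S) :
    φ.comp (E.act g e) = E.act (Pt.map φ g) (φ.comp e) := by
  rw [Torsor.act, Torsor.act, ← AlgHom.comp_assoc]
  congr 1
  ext <;> simp

theorem Torsor.act_injective (E : Torsor K Q R) (e : E.B →ₐ[K] S) :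
    Function.Injective fun g : Pt K Q S => E.act g e := by
  intro g g' h
  obtain ⟨x, -, hx⟩ := E.simplyTransitive S e (E.act g e) (E.act_comp_p g e).symm
  exact (hx g rfl).trans (hx g' h.symm).symm

theorem Torsor.exists_act_eq (E : Torsor K Q R) (e e' : E.B →ₐ[K] S) (h : e.comp E.p = e'.comp E.p) :
    ∃ g : Pt K Q S, E.act g e = e' := (E.simplyTransitive S e e' h).exists

/-- Equivariance of a map of torsors on points. -/
theorem Torsor.act_comp_of_equivariant (E : Torsor K Q R) {R' : Type u} [CommRing R'] [Algebra K R']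
    (E' : Torsor K Q R') (h : E.B →ₐ[K] E'.B)
    (hh : E'.coact.comp h = (Algebra.TensorProduct.map (AlgHom.id K Q) h).comp E.coact)
    (g : Pt K Q S) (e : E'.B →ₐ[K] S) : (E'.act g e).comp h = E.act g (e.comp h) := by
  rw [Torsor.act, Torsor.act, AlgHom.comp_assoc, hh, ← AlgHom.comp_assoc]
  congr 1
  ext <;> simp

/-- An equivariant identification of the special fibre with the trivial torsor. -/
structure Torsor.IsMark (E : Torsor K Q R) (aug : R →ₐ[K] K) (m : E.B →ₐ[K] Q) : Prop where
  over_base : m.comp E.p = (Algebra.ofId K Q).comp aug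
  equivariant : (Bialgebra.comulAlgHom K Q).comp m =
    (Algebra.TensorProduct.map (AlgHom.id K Q) m).comp E.coact

variable {E : Torsor K Q R} {aug : R →ₐ[K] K} {m : E.B →ₐ[K] Q}

/-- The point of the torsor over `S` given by the base point of the special fibre. -/
def Torsor.base (E : Torsor K Q R) (m : E.B →ₐ[K] Q) (S : Type u) [CommRing S] [Algebra K S] :
    E.B →ₐ[K] S := (1 : Pt K Q S).hom.comp m

theorem Torsor.IsMark.act_comp (hm : E.IsMark aug m) (g h : Pt K Q S) :
    E.act g (h.hom.comp m) = (g * h).hom.comp m :=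
  (E.act_comp_of_equivariant (Torsor.trivial K Q) m hm.equivariant g h.hom).symm

theorem Torsor.IsMark.act_base (hm : E.IsMark aug m) (g : Pt K Q S) :
    E.act g (E.base m S) = g.hom.comp m := by
  rw [Torsor.base, hm.act_comp, mul_one]

theorem Torsor.IsMark.base_comp_p (hm : E.IsMark aug m) :
    (E.base m S).comp E.p = (Algebra.ofId K S).comp aug := by
  rw [Torsor.base, AlgHom.comp_assoc, hm.over_base, ← AlgHom.comp_assoc,
    Subsingleton.elim ((1 : Pt K Q S).hom.comp (Algebra.ofId K Q)) (Algebra.ofId K S)]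

theorem Torsor.IsMark.surjective (hm : E.IsMark aug m) : Function.Surjective m := by
  let ι : m.range →ₐ[K] Q := m.range.val
  have h1 : (E.base m m.range).comp E.p = m.rangeRestrict.comp E.p := by
    rw [hm.base_comp_p]
    ext r
    exact congrArg (fun t : R →ₐ[K] Q => t r) hm.over_base.symm
  obtain ⟨g, hg⟩ := E.exists_act_eq _ _ h1
  have h2 : E.act (Pt.map ι g) (E.base m Q) = E.act (Pt.univ K Q) (E.base m Q) := by
    rw [hm.act_base (Pt.univ K Q)]
    have := E.comp_act ι g (E.base m m.range)
    rw [hg] at this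
    have h3 : ι.comp (E.base m m.range) = E.base m Q := by
      ext b
      simp [Torsor.base, Pt.one_hom, Algebra.ofId_apply]
    rw [h3] at this
    rw [← this]
    ext b; rfl
  have h3 := E.act_injective _ h2
  intro q
  have h4 : ι (g.hom q) = q := congrArg (fun t : Pt K Q Q => t.hom q) h3
  obtain ⟨b, hb⟩ := (g.hom q).2
  exact ⟨b, hb.trans h4⟩

theorem Torsor.IsMark.ker_le (hm : E.IsMark aug m) (I : Ideal E.B)
    (hI : ∀ r, aug r = 0 → E.p r ∈ I) : RingHom.ker m ≤ I := by
  let π : E.B →ₐ[K] E.B ⧸ I := Ideal.Quotient.mkₐ K I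
  have h1 : (E.base m (E.B ⧸ I)).comp E.p = π.comp E.p := by
    rw [hm.base_comp_p]
    ext r
    have h2 : E.p (r - algebraMap K R (aug r)) ∈ I := hI _ (by simp)
    have h3 : π (E.p (r - algebraMap K R (aug r))) = 0 := Ideal.Quotient.eq_zero_iff_mem.2 h2
    rw [map_sub, map_sub, sub_eq_zero] at h3
    simpa [Algebra.ofId_apply] using h3.symm
  obtain ⟨g, hg⟩ := E.exists_act_eq _ _ h1
  rw [hm.act_base] at hg
  intro b hb
  have hb' : m b = 0 := hb
  have := congrArg (fun t : E.B →ₐ[K] E.B ⧸ I => t b) hg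
  simp only [AlgHom.comp_apply, hb', map_zero] at this
  exact Ideal.Quotient.eq_zero_iff_mem.1 this.symm

end TorsorLift

section DualLift

variable {K Q : Type u} [Field K] [CommRing Q] [HopfAlgebra K Q]
  {E : Torsor K Q (DualNumber K)} {m : E.B →ₐ[K] Q}

theorem Torsor.IsMark.mem_ker_iff (hm : E.IsMark (augmentation K K) m) (b : E.B) :
    m b = 0 ↔ ∃ c, b = E.p DualNumber.eps * c := by
  constructor
  · intro hb
    have h := hm.ker_le (Ideal.span {E.p DualNumber.eps}) (fun r hr => by
      have hr' : TrivSqZeroExt.fst r = 0 := hr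
      have : r = DualNumber.eps * algebraMap K _ (TrivSqZeroExt.snd r) := by
        ext <;> simp [hr', TrivSqZeroExt.algebraMap_eq_inl]
      rw [this, map_mul]
      exact Ideal.mul_mem_right _ _ (Ideal.subset_span rfl)) (show b ∈ RingHom.ker m from hb)
    exact Ideal.mem_span_singleton.1 h
  · rintro ⟨c, rfl⟩
    have h := congrArg (fun t : DualNumber K →ₐ[K] Q => t DualNumber.eps) hm.over_base
    simp only [AlgHom.comp_apply] at h
    rw [map_mul, h]
    simp

theorem exists_eq_eps_smul_of_flat {K B : Type*} [Field K] [AddCommGroup B]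
    [Module (DualNumber K) B] [Module.Flat (DualNumber K) B] (b : B)
    (h : (DualNumber.eps : DualNumber K) • b = 0) :
    ∃ c : B, b = (DualNumber.eps : DualNumber K) • c := by
  obtain ⟨k, a, y, h2, h3⟩ := Module.Flat.isTrivialRelation_of_sum_smul_eq_zero
    (f := fun _ : Fin 1 => (DualNumber.eps : DualNumber K)) (x := fun _ => b) (by simpa using h)
  have h4 : ∀ j, ∃ c : DualNumber K, a 0 j = DualNumber.eps * c := by
    intro j
    have h5 := h3 j
    rw [Fin.sum_univ_one] at h5
    have h6 : TrivSqZeroExt.fst (a 0 j) = 0 := by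
      have := congrArg TrivSqZeroExt.snd h5
      simpa using this
    refine ⟨TrivSqZeroExt.inl (TrivSqZeroExt.snd (a 0 j)), ?_⟩
    ext <;> simp [h6]
  choose c hc using h4
  refine ⟨∑ j, c j • y j, ?_⟩
  have h5 := h2 0
  simp only [hc, mul_smul] at h5
  rw [h5, ← Finset.smul_sum]

theorem Torsor.exists_of_eps_mul_eq_zero (E : Torsor K Q (DualNumber K)) (b : E.B)
    (h : E.p DualNumber.eps * b = 0) : ∃ c, b = E.p DualNumber.eps * c := by
  algebraize [E.p.toRingHom]
  have hff : Module.FaithfullyFlat (DualNumber K) E.B := E.faithfullyFlat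
  exact exists_eq_eps_smul_of_flat (K := K) b h

/-- A torsor over the dual numbers that is trivialized over `K` has a section over the dual numbers
of the function field of the group. -/
theorem Torsor.IsMark.exists_generic_section [CharZero K] [IsDomain Q]
    (hm : E.IsMark (augmentation K K) m) :
    ∃ τ : E.B →ₐ[K] DualNumber (FractionRing Q),
      τ.comp E.p = dualMap (Algebra.ofId K (FractionRing Q)) ∧
      ∀ b, TrivSqZeroExt.fst (τ b) = algebraMap Q (FractionRing Q) (m b) := by
  let F := FractionRing Q
  let μ : E.B →ₐ[K] F := (IsScalarTower.toAlgHom K Q F).comp m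
  have hμ : ∀ b, μ b = 0 ↔ m b = 0 := fun b =>
    map_eq_zero_iff _ (IsFractionRing.injective Q F)
  let 𝔫 : Ideal E.B := RingHom.ker μ
  have : 𝔫.IsPrime := RingHom.ker_isPrime _
  let L := Localization.AtPrime 𝔫
  let π : L →ₐ[K] F := IsLocalization.liftAlgHom (M := 𝔫.primeCompl) (f := μ) fun y => by
    rw [isUnit_iff_ne_zero]
    exact fun h => y.2 h
  have hπ : ∀ b, π (algebraMap E.B L b) = μ b := fun b => IsLocalization.lift_eq _ b
  let ε : L := algebraMap E.B L (E.p DualNumber.eps)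
  have hε : ε * ε = 0 := by
    rw [← map_mul, ← map_mul, DualNumber.eps_mul_eps, map_zero, map_zero]
  have hker : ∀ z : L, π z = 0 → ∃ w, z = ε * w := by
    intro z hz
    obtain ⟨⟨b, s⟩, hbs⟩ := IsLocalization.surj 𝔫.primeCompl z
    have h1 : μ b = 0 := by rw [← hπ, ← hbs, map_mul, hz, zero_mul]
    obtain ⟨c, hc⟩ := (hm.mem_ker_iff b).1 ((hμ b).1 h1)
    refine ⟨IsLocalization.mk' L c s, ?_⟩
    rw [IsLocalization.mul_mk'_eq_mk'_of_mul, ← hc]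
    exact (IsLocalization.eq_mk'_iff_mul_eq).2 hbs
  have hπs : Function.Surjective π := by
    intro x
    obtain ⟨a, s, hs, rfl⟩ := IsFractionRing.div_surjective (A := Q) x
    obtain ⟨b, rfl⟩ := hm.surjective a
    obtain ⟨t, rfl⟩ := hm.surjective s
    have ht : t ∈ 𝔫.primeCompl := fun h =>
      nonZeroDivisors.ne_zero hs ((hμ t).1 h)
    refine ⟨IsLocalization.mk' L b ⟨t, ht⟩, ?_⟩
    rw [eq_div_iff (by simpa using nonZeroDivisors.ne_zero hs)]
    have h1 := IsLocalization.mk'_spec L b (⟨t, ht⟩ : 𝔫.primeCompl)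
    have h2 := congrArg π h1
    rw [map_mul, hπ, hπ] at h2
    exact h2
  obtain ⟨σ, hσ1, hσ2⟩ := exists_lift_of_charZero (algebraMap K F) (algebraMap K L) π.toRingHom hπs
    (isNilpotent_ker_of_mul_eq_zero _ fun x y hx hy => by
      obtain ⟨x', rfl⟩ := hker x hx
      obtain ⟨y', rfl⟩ := hker y hy
      rw [mul_mul_mul_comm, hε, zero_mul]) (RingHom.ext fun r => π.commutes r)
  have hπσ : ∀ x, π (σ x) = x := fun x => RingHom.congr_fun hσ2 x
  have hεπ : π ε = 0 := by
    rw [hπ, hμ, hm.mem_ker_iff]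
    exact ⟨1, (mul_one _).symm⟩
  let f : DualNumber F →ₐ[K] L :=
    { toFun := fun x => σ x.fst + σ x.snd * ε
      map_one' := by simp
      map_mul' := fun x y => by
        simp only [TrivSqZeroExt.fst_mul, TrivSqZeroExt.snd_mul, map_add, map_mul, smul_eq_mul,
          MulOpposite.smul_eq_mul_unop, MulOpposite.unop_op]
        linear_combination - σ x.snd * σ y.snd * hε
      map_zero' := by simp
      map_add' := fun x y => by simp; ring
      commutes' := fun r => by
        simpa [TrivSqZeroExt.algebraMap_eq_inl'] using RingHom.congr_fun hσ1 r }
  have hf : ∀ x, f x = σ x.fst + σ x.snd * ε := fun x => rfl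
  have hbij : Function.Bijective f := by
    constructor
    · rw [injective_iff_map_eq_zero]
      intro x hx
      rw [hf] at hx
      have h1 : x.fst = 0 := by
        have := congrArg π hx
        rwa [map_add, map_mul, hεπ, mul_zero, add_zero, hπσ, map_zero] at this
      rw [h1, map_zero, zero_add] at hx
      have h2 : x.snd = 0 := by
        by_contra hne
        have h3 : ε = 0 := by
          have := congrArg (σ x.snd⁻¹ * ·) hx
          simpa only [← mul_assoc, ← map_mul, inv_mul_cancel₀ hne, map_one, one_mul, mul_zero]
            using this
        obtain ⟨s, hs⟩ := (IsLocalization.map_eq_zero_iff 𝔫.primeCompl L _).1 h3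
        obtain ⟨c, hc⟩ := E.exists_of_eps_mul_eq_zero s (by rw [mul_comm]; exact hs)
        exact s.2 ((hμ _).2 ((hm.mem_ker_iff _).2 ⟨c, hc⟩))
      exact TrivSqZeroExt.ext h1 h2
    · intro z
      obtain ⟨w, hw⟩ := hker (z - σ (π z)) (by rw [map_sub, hπσ, sub_self])
      obtain ⟨v, hv⟩ := hker (w - σ (π w)) (by rw [map_sub, hπσ, sub_self])
      refine ⟨TrivSqZeroExt.inl (π z) + TrivSqZeroExt.inr (π w), ?_⟩
      rw [hf]
      simp only [TrivSqZeroExt.fst_add, TrivSqZeroExt.fst_inl, TrivSqZeroExt.fst_inr, add_zero,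
        TrivSqZeroExt.snd_add, TrivSqZeroExt.snd_inl, TrivSqZeroExt.snd_inr, zero_add]
      linear_combination - hw - ε * hv - v * hε
  let e := AlgEquiv.ofBijective f hbij
  have he : ∀ x, e x = σ x.fst + σ x.snd * ε := fun x => rfl
  let lB : E.B →ₐ[K] L := IsScalarTower.toAlgHom K E.B L
  refine ⟨e.symm.toAlgHom.comp lB, ?_, fun b => ?_⟩
  · refine AlgHom.ext fun r => e.injective ?_
    change e (e.symm (lB (E.p r))) = _
    rw [e.apply_symm_apply, he, fst_dualMap, snd_dualMap, Algebra.ofId_apply, Algebra.ofId_apply]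
    have hσ : ∀ r, σ (algebraMap K F r) = algebraMap K L r := fun r => RingHom.congr_fun hσ1 r
    rw [hσ, hσ]
    have h1 : r = algebraMap K _ (TrivSqZeroExt.fst r) +
        algebraMap K _ (TrivSqZeroExt.snd r) * DualNumber.eps := by
      ext <;> simp [TrivSqZeroExt.algebraMap_eq_inl]
    conv_lhs => rw [h1]
    rw [map_add, map_mul, map_add, map_mul, AlgHom.commutes, AlgHom.commutes, AlgHom.commutes,
      AlgHom.commutes]
    rfl
  · have h1 : e (e.symm (lB b)) = lB b := e.apply_symm_apply _
    rw [he] at h1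
    have h2 := congrArg π h1
    rw [map_add, map_mul, hεπ, mul_zero, add_zero, hπσ] at h2
    exact h2.trans (hπ b)

/-- A torsor over the dual numbers that is trivialized over `K` has a section extending the base
point of the special fibre. -/
theorem Torsor.IsMark.exists_section [CharZero K] [IsDomain Q]
    (hm : E.IsMark (augmentation K K) m) :
    ∃ s : E.B →ₐ[K] DualNumber K, s.comp E.p = AlgHom.id K _ ∧
      (augmentation K K).comp s = (Bialgebra.counitAlgHom K Q).comp m := by
  let F := FractionRing Q
  obtain ⟨τ, hτ1, hτ2⟩ := hm.exists_generic_section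
  let η : Pt K Q F := ⟨IsScalarTower.toAlgHom K Q F⟩
  let e := E.act η⁻¹.inl τ
  have he1 : e.comp E.p = dualMap (Algebra.ofId K F) := by rw [E.act_comp_p, hτ1]
  have he2 : ∀ b, TrivSqZeroExt.fst (e b) = algebraMap K F (Coalgebra.counit (R := K) (m b)) := by
    intro b
    have h1 := E.comp_act (TrivSqZeroExt.fstHom K F F) η⁻¹.inl τ
    have h2 : (TrivSqZeroExt.fstHom K F F).comp τ = η.hom.comp m := AlgHom.ext hτ2
    have h3 : Pt.map (TrivSqZeroExt.fstHom K F F) η⁻¹.inl = η⁻¹ := Pt.inl_fst _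
    rw [h2, h3, hm.act_comp, inv_mul_cancel] at h1
    exact congrArg (fun t : E.B →ₐ[K] F => t b) h1
  obtain ⟨ℓ, hℓ⟩ := exists_linear_retraction K F
  have hmul : ∀ (r : K) (x : F), ℓ (algebraMap K F r * x) = r * ℓ x := by
    intro r x
    rw [← Algebra.smul_def, map_smul, smul_eq_mul]
  have hal : ∀ r : K, e (algebraMap K E.B r) = TrivSqZeroExt.inl (algebraMap K F r) := by
    intro r
    rw [e.commutes, TrivSqZeroExt.algebraMap_eq_inl']
  let s : E.B →ₐ[K] DualNumber K :=
    { toFun := fun b => TrivSqZeroExt.inl (Coalgebra.counit (R := K) (m b)) +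
        TrivSqZeroExt.inr (ℓ (TrivSqZeroExt.snd (e b)))
      map_one' := by ext <;> simp
      map_mul' := fun x y => by
        ext
        · simp
        · simp [he2, hmul, mul_comm]
      map_zero' := by ext <;> simp
      map_add' := fun x y => by ext <;> simp
      commutes' := fun r => by
        rw [hal]
        ext <;> simp [TrivSqZeroExt.algebraMap_eq_inl'] }
  have hs1 : ∀ b, TrivSqZeroExt.fst (s b) = Coalgebra.counit (R := K) (m b) := fun b => by simp [s]
  have hs2 : ∀ b, TrivSqZeroExt.snd (s b) = ℓ (TrivSqZeroExt.snd (e b)) := fun b => by simp [s]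
  refine ⟨s, AlgHom.ext fun r => ?_, AlgHom.ext hs1⟩
  have h1 : e (E.p r) = dualMap (Algebra.ofId K F) r := congrArg (fun t : _ →ₐ[K] _ => t r) he1
  apply TrivSqZeroExt.ext
  · change TrivSqZeroExt.fst (s (E.p r)) = TrivSqZeroExt.fst r
    rw [hs1]
    have h2 := congrArg (fun t : DualNumber K →ₐ[K] Q => t r) hm.over_base
    simp only [AlgHom.comp_apply] at h2
    rw [h2, Algebra.ofId_apply]
    simp
  · change TrivSqZeroExt.snd (s (E.p r)) = TrivSqZeroExt.snd r
    rw [hs2, h1, snd_dualMap]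
    exact hℓ _

end DualLift

/-! ### The conjugation action of the adjoint group -/

section AdAction

variable {K A S T : Type u} [Field K] [CommRing A] [HopfAlgebra K A] [CommRing S] [Algebra K S]
  [CommRing T] [Algebra K T]

theorem mem_range_of_right_slices (C : Subalgebra K A) (F : A ⊗[K] A)
    (h1 : ∀ φ : A →ₗ[K] K, TensorProduct.rid K A (φ.lTensor A F) ∈ C) :
    F ∈ (Algebra.TensorProduct.map C.val (AlgHom.id K A)).range := by
  classical
  let b := Module.Basis.ofVectorSpace K A
  obtain ⟨c, hc⟩ := TensorProduct.eq_repr_basis_right b F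
  have hcm : ∀ i, c i ∈ C := by
    intro i
    have := h1 (b.coord i)
    rw [← hc] at this
    simp only [Finsupp.sum, map_sum, LinearMap.lTensor_tmul, Module.Basis.coord_apply,
      Module.Basis.repr_self, TensorProduct.rid_tmul, Finsupp.single_apply, ite_smul, one_smul,
      zero_smul, Finset.sum_ite_eq', Finsupp.mem_support_iff] at this
    by_cases h0 : c i = 0
    · rw [h0]; exact C.zero_mem
    · simpa [h0] using this
  refine ⟨c.sum fun i m => (⟨c i, hcm i⟩ : C) ⊗ₜ b i, ?_⟩
  rw [← hc]
  simp [Finsupp.sum]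

theorem valid_injective (C : Subalgebra K A) (S : Type u) [CommRing S] [Algebra K S] :
    Function.Injective (Algebra.TensorProduct.map C.val (AlgHom.id K S)) :=
  val_map_injective C (LinearMap.id : S →ₗ[K] S) Function.injective_id

variable (K A) in
/-- The comorphism `A → A ⊗ A` of `(g, x) ↦ g x g⁻¹`. -/
def conjComul : A →ₐ[K] A ⊗[K] A :=
  ((⟨Algebra.TensorProduct.includeLeft⟩ : Pt K A (A ⊗[K] A)) *
    ⟨Algebra.TensorProduct.includeRight⟩ * (⟨Algebra.TensorProduct.includeLeft⟩)⁻¹).hom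

theorem lift_comp_conjComul (g x : Pt K A S) :
    (Algebra.TensorProduct.lift g.hom x.hom (fun _ _ => .all _ _)).comp (conjComul K A) =
      (g * x * g⁻¹).hom := by
  let l : A ⊗[K] A →ₐ[K] S := Algebra.TensorProduct.lift g.hom x.hom (fun _ _ => .all _ _)
  change (Pt.map l (_ * _ * _⁻¹)).hom = _
  rw [map_mul, map_mul, map_inv]
  have h1 : Pt.map l (⟨Algebra.TensorProduct.includeLeft⟩ : Pt K A (A ⊗[K] A)) = g := by
    ext a; simp [l]
  have h2 : Pt.map l (⟨Algebra.TensorProduct.includeRight⟩ : Pt K A (A ⊗[K] A)) = x := by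
    ext a; simp [l]
  rw [h1, h2]

theorem conjComul_mem (a : A) : conjComul K A a ∈
    (Algebra.TensorProduct.map (adCoord K A).val (AlgHom.id K A)).range := by
  apply mem_range_of_right_slices
  intro φ R _ _ g z hz
  let i : A →ₐ[K] R ⊗[K] A := Algebra.TensorProduct.includeRight
  have key : ∀ y : Pt K A R, y.hom (TensorProduct.rid K A (φ.lTensor A (conjComul K A a))) =
      TensorProduct.rid K R (φ.lTensor R
        ((Pt.map Algebra.TensorProduct.includeLeft y * (⟨i⟩ : Pt K A (R ⊗[K] A)) *
          (Pt.map Algebra.TensorProduct.includeLeft y)⁻¹).hom a)) := by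
    intro y
    rw [← lift_comp_conjComul]
    have : ∀ F : A ⊗[K] A, y.hom (TensorProduct.rid K A (φ.lTensor A F)) =
        TensorProduct.rid K R (φ.lTensor R (Algebra.TensorProduct.lift
          (Pt.map Algebra.TensorProduct.includeLeft y : Pt K A (R ⊗[K] A)).hom i
          (fun _ _ => .all _ _) F)) := by
      intro F
      induction F with
      | zero => simp
      | tmul x y => simp [i]
      | add x y hx hy => simp only [map_add, hx, hy]
    exact this _
  rw [key, key, map_mul, mul_inv_rev]
  have hz' := hz.map (Algebra.TensorProduct.includeLeft : R →ₐ[K] R ⊗[K] A)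
  congr 4
  rw [mul_assoc (Pt.map _ g), hz'.comm, mul_assoc, mul_assoc, mul_assoc, mul_inv_cancel_left]

variable (K A) in
/-- The comorphism `A → Q ⊗ A` of the conjugation action of the adjoint group on `G`. -/
def adCoact : A →ₐ[K] adCoord K A ⊗[K] A :=
  (AlgEquiv.ofInjective _ (valid_injective (adCoord K A) A)).symm.toAlgHom.comp
    ((conjComul K A).codRestrict _ conjComul_mem)

theorem val_adCoact : (Algebra.TensorProduct.map (adCoord K A).val (AlgHom.id K A)).comp
    (adCoact K A) = conjComul K A := by
  ext a
  have := (AlgEquiv.ofInjective _ (valid_injective (adCoord K A) A)).apply_symm_apply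
    ((conjComul K A).codRestrict _ conjComul_mem a)
  exact congrArg Subtype.val this

/-- The conjugation action of `G^ad(S)` on `G(S)`. -/
def adAct (t : Pt K (adCoord K A) S) (x : Pt K A S) : Pt K A S :=
  ⟨(Algebra.TensorProduct.lift t.hom x.hom (fun _ _ => .all _ _)).comp (adCoact K A)⟩

theorem adAct_toAd (g x : Pt K A S) : adAct (toAd g) x = g * x * g⁻¹ := by
  apply Pt.ext
  rw [← lift_comp_conjComul, ← val_adCoact, ← AlgHom.comp_assoc, adAct]
  refine congrArg (fun t : adCoord K A ⊗[K] A →ₐ[K] S => t.comp (adCoact K A)) ?_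
  ext <;> simp [toAd]

theorem map_adAct (φ : S →ₐ[K] T) (t : Pt K (adCoord K A) S) (x : Pt K A S) :
    Pt.map φ (adAct t x) = adAct (Pt.map φ t) (Pt.map φ x) := by
  apply Pt.ext
  rw [Pt.map_hom, adAct, adAct, ← AlgHom.comp_assoc]
  congr 1
  ext <;> simp

theorem map_toAd (φ : S →ₐ[K] T) (g : Pt K A S) : Pt.map φ (toAd g) = toAd (Pt.map φ g) := rfl

/-- An identity between points of `G` that depend naturally on a point of the adjoint group holds
if it holds for the points that lift to `G`. -/
theorem ad_descent (f f' : ∀ (T : Type u) [CommRing T] [Algebra K T], Pt K (adCoord K A) T →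
      (S →ₐ[K] T) → Pt K A T)
    (hf : ∀ (T T' : Type u) [CommRing T] [Algebra K T] [CommRing T'] [Algebra K T']
      (ψ : T →ₐ[K] T') t φ, Pt.map ψ (f T t φ) = f T' (Pt.map ψ t) (ψ.comp φ))
    (hf' : ∀ (T T' : Type u) [CommRing T] [Algebra K T] [CommRing T'] [Algebra K T']
      (ψ : T →ₐ[K] T') t φ, Pt.map ψ (f' T t φ) = f' T' (Pt.map ψ t) (ψ.comp φ))
    (h : ∀ (T : Type u) [CommRing T] [Algebra K T] (g : Pt K A T) (φ : S →ₐ[K] T),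
      f T (toAd g) φ = f' T (toAd g) φ) (t : Pt K (adCoord K A) S) :
    f S t (AlgHom.id K S) = f' S t (AlgHom.id K S) := by
  let j : adCoord K A ⊗[K] S →ₐ[K] A ⊗[K] S :=
    Algebra.TensorProduct.map (adCoord K A).val (AlgHom.id K S)
  let t₀ : Pt K (adCoord K A) (adCoord K A ⊗[K] S) := ⟨Algebra.TensorProduct.includeLeft⟩
  let i : S →ₐ[K] adCoord K A ⊗[K] S := Algebra.TensorProduct.includeRight
  let l : adCoord K A ⊗[K] S →ₐ[K] S :=
    Algebra.TensorProduct.lift t.hom (AlgHom.id K S) (fun _ _ => .all _ _)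
  let g₀ : Pt K A (A ⊗[K] S) := ⟨Algebra.TensorProduct.includeLeft⟩
  have hj : Pt.map j t₀ = toAd g₀ := by ext a; simp [j, t₀, g₀, toAd]
  have hl : Pt.map l t₀ = t := by ext a; simp [l, t₀]
  have hli : l.comp i = AlgHom.id K S := by ext a; simp [l, i]
  have h0 : f _ t₀ i = f' _ t₀ i := by
    apply Pt.map_injective (valid_injective (adCoord K A) S)
    change Pt.map j _ = Pt.map j _
    rw [hf, hf', hj, h]
  rw [← hl, ← hli, ← hf, ← hf', h0]

theorem adAct_mul_right (t : Pt K (adCoord K A) S) (x y : Pt K A S) :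
    adAct t (x * y) = adAct t x * adAct t y := by
  refine ad_descent (fun T _ _ t φ => adAct t (Pt.map φ (x * y)))
    (fun T _ _ t φ => adAct t (Pt.map φ x) * adAct t (Pt.map φ y)) ?_ ?_ ?_ t
  · intros; rw [map_adAct, Pt.map_map]
  · intros; rw [map_mul, map_adAct, map_adAct, Pt.map_map, Pt.map_map]
  · intro T _ _ g φ
    simp only [adAct_toAd, map_mul]
    group

theorem adAct_toAd_mul (g : Pt K A S) (t : Pt K (adCoord K A) S) (x : Pt K A S) :
    adAct (toAd g * t) x = g * adAct t x * g⁻¹ := by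
  refine ad_descent (fun T _ _ t φ => adAct (toAd (Pt.map φ g) * t) (Pt.map φ x))
    (fun T _ _ t φ => Pt.map φ g * adAct t (Pt.map φ x) * (Pt.map φ g)⁻¹) ?_ ?_ ?_ t
  · intros; simp only [map_mul, map_adAct, map_toAd, Pt.map_map]
  · intros; simp only [map_mul, map_inv, map_adAct, Pt.map_map]
  · intro T _ _ g φ
    simp only [← toAd_mul, adAct_toAd]
    group

theorem adAct_mul (s t : Pt K (adCoord K A) S) (x : Pt K A S) :
    adAct (s * t) x = adAct s (adAct t x) := by
  refine ad_descent (fun T _ _ s φ => adAct (s * Pt.map φ t) (Pt.map φ x))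
    (fun T _ _ s φ => adAct s (adAct (Pt.map φ t) (Pt.map φ x))) ?_ ?_ ?_ s
  · intros; simp only [map_mul, map_adAct, Pt.map_map]
  · intros; simp only [map_adAct, Pt.map_map]
  · intro T _ _ g φ
    simp only [adAct_toAd_mul, adAct_toAd]

theorem toAd_one : toAd (1 : Pt K A S) = 1 := by
  ext a; rfl

theorem adAct_one (x : Pt K A S) : adAct 1 x = x := by
  rw [← toAd_one, adAct_toAd, one_mul, inv_one, mul_one]

theorem map_orbitPt (t : Pt K (adCoord K A) S) (x : Pt K A K) :
    Pt.map t.hom (orbitPt x) = adAct t (Pt.map (Algebra.ofId K S) x) := by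
  refine ad_descent (S := S) (fun T _ _ (t : Pt K (adCoord K A) T) _ => Pt.map t.hom (orbitPt x))
    (fun T _ _ t φ => adAct t (Pt.map (Algebra.ofId K T) x)) ?_ ?_ ?_ t
  · intros; rw [Pt.map_map]; rfl
  · intros; rw [map_adAct, Pt.map_ofId]
  · intro T _ _ g φ
    rw [map_toAd_orbitPt, adAct_toAd]

theorem adAct_ab (t : Pt K (adCoord K A) S) (x : Pt K A S) : (adAct t x).ab = x.ab := by
  ext c
  obtain ⟨c, hc⟩ := c
  have hj := valid_injective (adCoord K A) S
  let j : adCoord K A ⊗[K] S →ₐ[K] A ⊗[K] S :=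
    Algebra.TensorProduct.map (adCoord K A).val (AlgHom.id K S)
  let t₀ : Pt K (adCoord K A) (adCoord K A ⊗[K] S) := ⟨Algebra.TensorProduct.includeLeft⟩
  let i : S →ₐ[K] adCoord K A ⊗[K] S := Algebra.TensorProduct.includeRight
  let l : adCoord K A ⊗[K] S →ₐ[K] S :=
    Algebra.TensorProduct.lift t.hom (AlgHom.id K S) (fun _ _ => .all _ _)
  let g₀ : Pt K A (A ⊗[K] S) := ⟨Algebra.TensorProduct.includeLeft⟩
  have hjt : Pt.map j t₀ = toAd g₀ := by ext a; simp [j, t₀, g₀, toAd]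
  have hl : Pt.map l t₀ = t := by ext a; simp [l, t₀]
  have hli : l.comp i = AlgHom.id K S := by ext a; simp [l, i]
  have h0 : (adAct t₀ (Pt.map i x)).hom c = (Pt.map i x).hom c := by
    apply hj
    change (Pt.map j (adAct t₀ (Pt.map i x))).hom c = (Pt.map j (Pt.map i x)).hom c
    rw [map_adAct, hjt, adAct_toAd, comm_on_abCoord _ _ hc, inv_mul_cancel_left]
  have h1 := congrArg l h0
  change (Pt.map l (adAct t₀ (Pt.map i x))).hom c = (Pt.map l (Pt.map i x)).hom c at h1
  rw [map_adAct, hl, Pt.map_map, hli] at h1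
  exact h1

/-- The conjugation action of the adjoint group by group automorphisms. -/
def adActEquiv (t : Pt K (adCoord K A) S) : Pt K A S ≃* Pt K A S where
  toFun := adAct t
  invFun := adAct t⁻¹
  left_inv x := by rw [← adAct_mul, inv_mul_cancel, adAct_one]
  right_inv x := by rw [← adAct_mul, mul_inv_cancel, adAct_one]
  map_mul' := adAct_mul_right t

variable {Γ : Type u} [Group Γ] {θ : Γ → (abCoord K A →ₐ[K] K)} {R : Type u} [CommRing R]
  [Algebra K R]

/-- Equivariance of the universal representation under the adjoint group. -/
theorem LocObj.map_act (X : LocObj θ R) (t : Pt K (adCoord K A) S) (e : X.B →ₐ[K] S) (γ : Γ) :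
    Pt.map (X.act t e) (X.ρ γ) = adAct t (Pt.map e (X.ρ γ)) := by
  refine ad_descent (fun T _ _ t φ => Pt.map (X.act t (φ.comp e)) (X.ρ γ))
    (fun T _ _ t φ => adAct t (Pt.map (φ.comp e) (X.ρ γ))) ?_ ?_ ?_ t
  · intros; rw [Pt.map_map, Torsor.comp_act]; rfl
  · intros; rw [map_adAct, Pt.map_map]; rfl
  · intro T _ _ g φ
    rw [X.equivariant, adAct_toAd]

end AdAction

/-! ### Transport of parabolic subgroups under the adjoint group -/

section Parabolic

variable {K A Ω : Type u} [Field K] [CommRing A] [HopfAlgebra K A] [Field Ω] [Algebra K Ω]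

theorem continuous_adAct (t : Pt K (adCoord K A) Ω) :
    @Continuous _ _ (zariski K A Ω) (zariski K A Ω) (adAct t) := by
  let := zariski K A Ω
  let c : Ω ⊗[K] A →ₐ[Ω] Ω ⊗[K] A := Algebra.TensorProduct.lift (Algebra.ofId Ω (Ω ⊗[K] A))
    ((Algebra.TensorProduct.lift ((Algebra.TensorProduct.includeLeft : Ω →ₐ[K] Ω ⊗[K] A).comp t.hom)
      (Algebra.TensorProduct.includeRight : A →ₐ[K] Ω ⊗[K] A) (fun _ _ => .all _ _)).comp
        (adCoact K A)) (fun _ _ => .all _ _)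
  have hc : ∀ x : Pt K A Ω, (adAct t x).eval = x.eval.comp c := by
    intro x
    apply Algebra.TensorProduct.ext'
    intro ω a
    have h1 : (x.eval.restrictScalars K).comp (Algebra.TensorProduct.lift
        ((Algebra.TensorProduct.includeLeft : Ω →ₐ[K] Ω ⊗[K] A).comp t.hom)
        (Algebra.TensorProduct.includeRight : A →ₐ[K] Ω ⊗[K] A) (fun _ _ => .all _ _)) =
        Algebra.TensorProduct.lift t.hom x.hom (fun _ _ => .all _ _) := by
      ext <;> simp [Pt.eval]
    have h2 := congrArg (fun f : adCoord K A ⊗[K] A →ₐ[K] Ω => f (adCoact K A a)) h1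
    simp only [AlgHom.comp_apply, AlgHom.restrictScalars_apply] at h2
    simp only [c, AlgHom.comp_apply, Algebra.TensorProduct.lift_tmul, map_mul, h2]
    simp [Pt.eval, adAct, Algebra.ofId_apply]
  refine continuous_induced_rng.2 ?_
  have : ((fun g : Pt K A Ω => (⟨RingHom.ker g.eval.toRingHom, RingHom.ker_isPrime _⟩ :
      PrimeSpectrum (Ω ⊗[K] A))) ∘ adAct t) =
      PrimeSpectrum.comap c.toRingHom ∘ (fun g : Pt K A Ω =>
        (⟨RingHom.ker g.eval.toRingHom, RingHom.ker_isPrime _⟩ : PrimeSpectrum (Ω ⊗[K] A))) := by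
    funext x
    apply PrimeSpectrum.ext
    ext F
    simp only [Function.comp_apply, hc, PrimeSpectrum.comap_asIdeal, Ideal.mem_comap,
      RingHom.mem_ker]
    rfl
  rw [this]
  exact (PrimeSpectrum.continuous_comap c.toRingHom).comp continuous_induced_dom

/-- The action of a point of the adjoint group as a homeomorphism. -/
def adActHomeo (t : Pt K (adCoord K A) Ω) :
    @Homeomorph (Pt K A Ω) (Pt K A Ω) (zariski K A Ω) (zariski K A Ω) :=
  @Homeomorph.mk _ _ (zariski K A Ω) (zariski K A Ω) (adActEquiv t).toEquiv
    (continuous_adAct t) (continuous_adAct t⁻¹)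

theorem IsClosedSubgroup.map_adAct {H : Subgroup (Pt K A Ω)} (hH : IsClosedSubgroup H)
    (t : Pt K (adCoord K A) Ω) : IsClosedSubgroup (H.map (adActEquiv t).toMonoidHom) := by
  let := zariski K A Ω
  exact (adActHomeo t).isClosed_image.2 hH

theorem IsConnectedSubgroup.map_adAct {H : Subgroup (Pt K A Ω)} (hH : IsConnectedSubgroup H)
    (t : Pt K (adCoord K A) Ω) : IsConnectedSubgroup (H.map (adActEquiv t).toMonoidHom) := by
  let := zariski K A Ω
  exact IsConnected.image hH _ (continuous_adAct t).continuousOn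

theorem map_adAct_map_adAct_inv (H : Subgroup (Pt K A Ω)) (t : Pt K (adCoord K A) Ω) :
    (H.map (adActEquiv t⁻¹).toMonoidHom).map (adActEquiv t).toMonoidHom = H := by
  rw [Subgroup.map_map]
  convert Subgroup.map_id H
  ext1 x
  exact (adActEquiv t).apply_symm_apply x

theorem IsBorel.map_adAct {B : Subgroup (Pt K A Ω)} (hB : IsBorel B) (t : Pt K (adCoord K A) Ω) :
    IsBorel (B.map (adActEquiv t).toMonoidHom) := by
  have hp : ∀ (s : Pt K (adCoord K A) Ω) (H : Subgroup (Pt K A Ω)),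
      (IsClosedSubgroup H ∧ IsConnectedSubgroup H ∧ Group.IsSolvable H) →
      (IsClosedSubgroup (H.map (adActEquiv s).toMonoidHom) ∧
        IsConnectedSubgroup (H.map (adActEquiv s).toMonoidHom) ∧
        Group.IsSolvable (H.map (adActEquiv s).toMonoidHom)) := by
    rintro s H ⟨h1, h2, h3⟩
    exact ⟨h1.map_adAct s, h2.map_adAct s, Group.isSolvable_of_surjective
      ((adActEquiv s).toMonoidHom.subgroupMap_surjective H)⟩
  refine ⟨hp t B hB.1, fun H hH hle => ?_⟩
  have h1 : B ≤ H.map (adActEquiv t⁻¹).toMonoidHom := by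
    have := Subgroup.map_mono (f := (adActEquiv t⁻¹).toMonoidHom) hle
    have h2 := map_adAct_map_adAct_inv B t⁻¹
    rw [inv_inv] at h2
    rwa [h2] at this
  have h2 := Subgroup.map_mono (f := (adActEquiv t).toMonoidHom) (hB.2 (hp t⁻¹ H hH) h1)
  rwa [map_adAct_map_adAct_inv] at h2

theorem IsParabolic.map_adAct {P : Subgroup (Pt K A Ω)} (hP : IsParabolic P)
    (t : Pt K (adCoord K A) Ω) : IsParabolic (P.map (adActEquiv t).toMonoidHom) := by
  obtain ⟨h1, B, hB, hle⟩ := hP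
  exact ⟨h1.map_adAct t, _, hB.map_adAct t, Subgroup.map_mono hle⟩

/-- A family of representations that at every geometric point is a conjugate of an irreducible
representation under the adjoint group is irreducible. -/
theorem IsGIrreducible.of_adAct {Γ S : Type u} [Group Γ] [CommRing S] [Algebra K S]
    {ρ₀ : Γ →* Pt K A K} (h : IsGIrreducible ρ₀) (ρ : Γ →* Pt K A S)
    (hρ : ∀ (Ω : Type u) [Field Ω] [Algebra K Ω] (t : S →ₐ[K] Ω), ∃ τ : Pt K (adCoord K A) Ω,
      ∀ γ, Pt.map t (ρ γ) = adAct τ (Pt.map (Algebra.ofId K Ω) (ρ₀ γ))) : IsGIrreducible ρ := by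
  intro Ω _ _ _ t P hP hle
  obtain ⟨τ, hτ⟩ := hρ Ω t
  have h1 := h Ω (Algebra.ofId K Ω) (P.map (adActEquiv τ⁻¹).toMonoidHom) (hP.map_adAct _) (by
    rintro _ ⟨γ, rfl⟩
    refine ⟨_, hle ⟨γ, rfl⟩, ?_⟩
    change adAct τ⁻¹ (Pt.map t (ρ γ)) = _
    rw [hτ, ← adAct_mul, inv_mul_cancel, adAct_one]
    rfl)
  rw [← map_adAct_map_adAct_inv P τ, h1]
  exact Subgroup.map_top_of_surjective _ (adActEquiv τ).surjective

end Parabolic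

/-! ### Conjugacy classes -/

section Conj

variable {K A : Type u} [Field K] [CommRing A] [HopfAlgebra K A]

theorem subset_of_closedPoints {X : Type*} [TopologicalSpace X] [JacobsonSpace X] {L L' : Set X}
    (hL : IsLocallyClosed L) (hL' : IsLocallyClosed L')
    (h : ∀ x ∈ closedPoints X, x ∈ L → x ∈ L') : L ⊆ L' := by
  obtain ⟨U, Z, hU, hZ, rfl⟩ := hL'
  intro x hx
  refine ⟨?_, ?_⟩
  · by_contra hxU
    obtain ⟨y, hy, hyc⟩ := nonempty_inter_closedPoints (Z := L ∩ Uᶜ) ⟨x, hx, hxU⟩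
      (hL.inter hU.isClosed_compl.isLocallyClosed)
    exact hy.2 (h y hyc hy.1).1
  · by_contra hxZ
    obtain ⟨y, hy, hyc⟩ := nonempty_inter_closedPoints (Z := L ∩ Zᶜ) ⟨x, hx, hxZ⟩
      (hL.inter hZ.isOpen_compl.isLocallyClosed)
    exact hy.2 (h y hyc hy.1).2

theorem exists_geometric_point (K : Type*) {B : Type*} [Field K] [CommRing B] [Algebra K B]
    [Algebra.FiniteType K B] {x : PrimeSpectrum B} (hx : x ∈ closedPoints (PrimeSpectrum B)) :
    ∃ φ : B →ₐ[K] AlgebraicClosure K, x.asIdeal = RingHom.ker φ.toRingHom := by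
  have hmax : x.asIdeal.IsMaximal := (PrimeSpectrum.isClosed_singleton_iff_isMaximal x).1 hx
  let : Field (B ⧸ x.asIdeal) := Ideal.Quotient.field _
  have : Algebra.FiniteType K (B ⧸ x.asIdeal) :=
    Algebra.FiniteType.of_surjective (Ideal.Quotient.mkₐ K x.asIdeal) Ideal.Quotient.mk_surjective
  have : Module.Finite K (B ⧸ x.asIdeal) := finite_of_finite_type_of_isJacobsonRing K _
  let f : (B ⧸ x.asIdeal) →ₐ[K] AlgebraicClosure K := IsAlgClosed.lift
  refine ⟨f.comp (Ideal.Quotient.mkₐ K x.asIdeal), ?_⟩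
  ext b
  rw [RingHom.mem_ker, ← Ideal.Quotient.eq_zero_iff_mem]
  exact (map_eq_zero_iff f f.toRingHom.injective).symm

theorem ConjClass.conj_mem_iff [Algebra.FiniteType K A] (𝒦 : ConjClass K A) {S : Type u}
    [CommRing S] [Algebra K S] (g y : Pt K A S) (P : PrimeSpectrum S) :
    PrimeSpectrum.comap (g * y * g⁻¹).hom.toRingHom P ∈ 𝒦.carrier ↔
      PrimeSpectrum.comap y.hom.toRingHom P ∈ 𝒦.carrier := by
  let c := PrimeSpectrum.comap (conjComul K A).toRingHom
  let i : A →ₐ[K] A ⊗[K] A := Algebra.TensorProduct.includeRight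
  let r := PrimeSpectrum.comap i.toRingHom
  have : Algebra.FiniteType K (A ⊗[K] A) := by
    have : Algebra.FiniteType A (A ⊗[K] A) := inferInstance
    exact Algebra.FiniteType.trans (S := A) ‹_› this
  have : IsJacobsonRing (A ⊗[K] A) := isJacobsonRing_of_finiteType (A := K)
  have hc := 𝒦.isLocallyClosed.preimage
    (PrimeSpectrum.continuous_comap (conjComul K A).toRingHom)
  have hr := 𝒦.isLocallyClosed.preimage (PrimeSpectrum.continuous_comap i.toRingHom)
  have hclosed : ∀ x ∈ closedPoints (PrimeSpectrum (A ⊗[K] A)),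
      x ∈ c ⁻¹' 𝒦.carrier ↔ x ∈ r ⁻¹' 𝒦.carrier := by
    intro x hx
    obtain ⟨φ, hφ⟩ := exists_geometric_point K hx
    obtain ⟨x₀, hx₀⟩ := 𝒦.isConj
    let a : Pt K A (AlgebraicClosure K) := ⟨φ.comp Algebra.TensorProduct.includeLeft⟩
    let b : Pt K A (AlgebraicClosure K) := ⟨φ.comp Algebra.TensorProduct.includeRight⟩
    have hφ' : φ = Algebra.TensorProduct.lift a.hom b.hom (fun _ _ => .all _ _) := by
      ext <;> simp [a, b]
    have h1 : c x = ⟨RingHom.ker (a * b * a⁻¹).hom.toRingHom, RingHom.ker_isPrime _⟩ := by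
      apply PrimeSpectrum.ext
      rw [← lift_comp_conjComul, ← hφ']
      change x.asIdeal.comap _ = _
      rw [hφ]; rfl
    have h2 : r x = ⟨RingHom.ker b.hom.toRingHom, RingHom.ker_isPrime _⟩ := by
      apply PrimeSpectrum.ext
      change x.asIdeal.comap _ = _
      rw [hφ]; rfl
    rw [Set.mem_preimage, Set.mem_preimage, h1, h2, hx₀, hx₀]
    have h3 : IsConj b (a * b * a⁻¹) := isConj_iff.2 ⟨a, rfl⟩
    exact ⟨fun h => h.trans h3.symm, fun h => h.trans h3⟩
  have heq : c ⁻¹' 𝒦.carrier = r ⁻¹' 𝒦.carrier :=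
    Set.Subset.antisymm (subset_of_closedPoints hc hr fun x hx => (hclosed x hx).1)
      (subset_of_closedPoints hr hc fun x hx => (hclosed x hx).2)
  let l : A ⊗[K] A →ₐ[K] S := Algebra.TensorProduct.lift g.hom y.hom (fun _ _ => .all _ _)
  have h1 : PrimeSpectrum.comap (g * y * g⁻¹).hom.toRingHom P =
      c (PrimeSpectrum.comap l.toRingHom P) := by
    rw [← lift_comp_conjComul]; rfl
  have h2 : PrimeSpectrum.comap y.hom.toRingHom P = r (PrimeSpectrum.comap l.toRingHom P) := by
    have : y.hom = l.comp i := by ext; simp [l, i]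
    rw [this]; rfl
  rw [h1, h2]
  exact Set.ext_iff.1 heq _

theorem ConjClass.conj_mem [Algebra.FiniteType K A] {𝒦 : ConjClass K A} {x : Pt K A K}
    (hx : 𝒦.Mem x) {S : Type u} [CommRing S] [Algebra K S] (g : Pt K A S) (P : PrimeSpectrum S) :
    PrimeSpectrum.comap (g * Pt.map (Algebra.ofId K S) x * g⁻¹).hom.toRingHom P ∈ 𝒦.carrier := by
  rw [𝒦.conj_mem_iff]
  exact hx.2 ⟨PrimeSpectrum.comap (Algebra.ofId K S).toRingHom P, rfl⟩

theorem ConjClass.conj_univ_eq_zero [Algebra.FiniteType K A] [IsDomain A] {𝒦 : ConjClass K A}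
    {x : Pt K A K} (hx : 𝒦.Mem x) {a : A} (ha : a ∈ PrimeSpectrum.vanishingIdeal 𝒦.carrier) :
    (Pt.univ K A * Pt.map (Algebra.ofId K A) x * (Pt.univ K A)⁻¹).hom a = 0 := by
  have h := ConjClass.conj_mem hx (Pt.univ K A) ⟨⊥, Ideal.isPrime_bot⟩
  exact (PrimeSpectrum.mem_vanishingIdeal _ _).1 ha _ h

theorem univ_mul_injective {Q κ : Type u} [CommRing Q] [HopfAlgebra K Q] [CommRing κ] [Algebra K κ]
    [Nontrivial κ] (t : Pt K Q κ) : Function.Injective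
      ((⟨Algebra.TensorProduct.includeLeft⟩ : Pt K Q (Q ⊗[K] κ)) *
        Pt.map Algebra.TensorProduct.includeRight t).hom := by
  let v : Pt K Q (Q ⊗[K] κ) := ⟨Algebra.TensorProduct.includeLeft⟩
  let i : κ →ₐ[K] Q ⊗[K] κ := Algebra.TensorProduct.includeRight
  let r : Q ⊗[K] κ →ₐ[K] Q ⊗[K] κ :=
    Algebra.TensorProduct.lift (v * (Pt.map i t)⁻¹).hom i (fun _ _ => .all _ _)
  have h1 : Pt.map r v = v * (Pt.map i t)⁻¹ := by ext a; simp [r, v]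
  have h2 : r.comp i = i := by ext a; simp [r, i]
  have h3 : Pt.map r (v * Pt.map i t) = v := by
    rw [map_mul, h1, Pt.map_map, h2, inv_mul_cancel_right]
  have h4 : Function.Injective v.hom :=
    Algebra.TensorProduct.includeLeft_injective (algebraMap K κ).injective
  rw [← h3] at h4
  exact Function.Injective.of_comp h4

/-- The conjugates of a point of `𝒦` under the adjoint group lie in `𝒦`. -/
theorem ConjClass.mem_adAct [Algebra.FiniteType K A] [IsDomain A] {𝒦 : ConjClass K A}
    {x : Pt K A K} (hx : 𝒦.Mem x) {S : Type u} [CommRing S] [Algebra K S]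
    (t : Pt K (adCoord K A) S) : 𝒦.Mem (adAct t (Pt.map (Algebra.ofId K S) x)) := by
  refine ⟨fun a ha => ?_, ?_⟩
  · rw [← map_orbitPt]
    have h1 : (orbitPt x).hom a = 0 := Subtype.val_injective (ConjClass.conj_univ_eq_zero hx ha)
    rw [Pt.map_hom, AlgHom.comp_apply, h1, map_zero]
  · rintro _ ⟨P, rfl⟩
    let κ := P.asIdeal.ResidueField
    let π : S →ₐ[K] κ := IsScalarTower.toAlgHom K S κ
    let τ := Pt.map π t
    let i : κ →ₐ[K] A ⊗[K] κ := Algebra.TensorProduct.includeRight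
    let u : Pt K A (A ⊗[K] κ) := ⟨Algebra.TensorProduct.includeLeft⟩
    let w : Pt K (adCoord K A) (A ⊗[K] κ) := toAd u * Pt.map i τ
    have hinj : Function.Injective w.hom := by
      have h1 := univ_mul_injective τ
      let j : adCoord K A ⊗[K] κ →ₐ[K] A ⊗[K] κ :=
        Algebra.TensorProduct.map (adCoord K A).val (AlgHom.id K κ)
      have h2 : w = Pt.map j ((⟨Algebra.TensorProduct.includeLeft⟩ :
          Pt K (adCoord K A) (adCoord K A ⊗[K] κ)) *
            Pt.map Algebra.TensorProduct.includeRight τ) := by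
        rw [map_mul, Pt.map_map]
        congr 1
      rw [h2]
      exact (valid_injective (adCoord K A) κ).comp h1
    obtain ⟨p, hp, hp'⟩ := Ideal.exists_comap_eq_of_mem_minimalPrimes_of_injective
      (f := w.hom.toRingHom) hinj ⊥ (by
        rw [IsDomain.minimalPrimes_eq_singleton_bot]; exact Set.mem_singleton _)
    have h1 : PrimeSpectrum.comap (u * Pt.map i (adAct τ (Pt.map (Algebra.ofId K κ) x)) *
        u⁻¹).hom.toRingHom ⟨p, hp⟩ ∈ 𝒦.carrier := by
      have h2 : u * Pt.map i (adAct τ (Pt.map (Algebra.ofId K κ) x)) * u⁻¹ =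
          Pt.map w.hom (orbitPt x) := by
        rw [map_orbitPt, adAct_toAd_mul, map_adAct, Pt.map_ofId]
      rw [h2]
      have h3 := ConjClass.conj_mem hx (Pt.univ K A) ⟨⊥, Ideal.isPrime_bot⟩
      convert h3 using 1
      apply PrimeSpectrum.ext
      ext a
      change w.hom ((orbitPt x).hom a) ∈ p ↔ _
      have h4 : ∀ q, w.hom q ∈ p ↔ q = 0 := fun q => by
        rw [← Ideal.mem_bot, ← hp']; rfl
      rw [h4]
      exact Subtype.ext_iff
    rw [𝒦.conj_mem_iff] at h1
    convert h1 using 1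
    apply PrimeSpectrum.ext
    ext a
    change (adAct t (Pt.map (Algebra.ofId K S) x)).hom a ∈ P.asIdeal ↔
      i ((adAct τ (Pt.map (Algebra.ofId K κ) x)).hom a) ∈ p
    have h5 : adAct τ (Pt.map (Algebra.ofId K κ) x) =
        Pt.map π (adAct t (Pt.map (Algebra.ofId K S) x)) := by
      rw [map_adAct, Pt.map_ofId]
    rw [h5]
    have h6 : ∀ k : κ, i k ∈ p ↔ k = 0 := by
      intro k
      refine ⟨fun h => by_contra fun hk => hp.ne_top ?_, fun h => by rw [h, map_zero]; exact p.zero_mem⟩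
      exact Ideal.eq_top_of_isUnit_mem _ h ((isUnit_iff_ne_zero.2 hk).map i)
    rw [h6]
    exact (Ideal.algebraMap_residueField_eq_zero).symm

theorem isLeftCoideal_range_conj (x : Pt K A K) : IsLeftCoideal
    (Pt.univ K A * Pt.map (Algebra.ofId K A) x * (Pt.univ K A)⁻¹).hom.range := by
  let c := Pt.univ K A * Pt.map (Algebra.ofId K A) x * (Pt.univ K A)⁻¹
  let L : Pt K A (A ⊗[K] A) := ⟨Algebra.TensorProduct.includeLeft⟩
  let Rt : Pt K A (A ⊗[K] A) := ⟨Algebra.TensorProduct.includeRight⟩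
  have hΔ : (⟨Bialgebra.comulAlgHom K A⟩ : Pt K A (A ⊗[K] A)) = L * Rt := by
    ext a
    rw [Pt.mul_apply_repr _ _ (Coalgebra.Repr.arbitrary K a)]
    simp only [L, Rt, Algebra.TensorProduct.includeLeft_apply,
      Algebra.TensorProduct.includeRight_apply, Algebra.TensorProduct.tmul_mul_tmul, mul_one,
      one_mul]
    exact (Coalgebra.Repr.arbitrary K a).eq.symm
  have h1 : Pt.map (Bialgebra.comulAlgHom K A) c =
      L * Pt.map Algebra.TensorProduct.includeRight c * L⁻¹ := by
    have h2 : Pt.map (Bialgebra.comulAlgHom K A) (Pt.univ K A) = L * Rt := hΔ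
    have h3 : Pt.map (Algebra.TensorProduct.includeRight : A →ₐ[K] A ⊗[K] A) (Pt.univ K A) = Rt :=
      rfl
    simp only [c, map_mul, map_inv, h2, h3, Pt.map_ofId]
    group
  rintro _ ⟨a, rfl⟩
  change (Pt.map (Bialgebra.comulAlgHom K A) c).hom a ∈ _
  rw [h1, ← lift_comp_conjComul (S := A ⊗[K] A)]
  let c' : A →ₐ[K] c.hom.range := c.hom.rangeRestrict
  refine ⟨Algebra.TensorProduct.map (AlgHom.id K A) c' (conjComul K A a), ?_⟩
  have h4 : (Algebra.TensorProduct.map (AlgHom.id K A) c.hom.range.val).comp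
      (Algebra.TensorProduct.map (AlgHom.id K A) c') = Algebra.TensorProduct.lift L.hom
        (Pt.map Algebra.TensorProduct.includeRight c : Pt K A (A ⊗[K] A)).hom
          (fun _ _ => .all _ _) := by
    ext <;> simp [L, c']
  exact congrArg (fun f : A ⊗[K] A →ₐ[K] A ⊗[K] A => f (conjComul K A a)) h4

/-- The point `1 + ε D` of `G` over the dual numbers. -/
def expPt {D : A →ₗ[K] K} (hD : D ∈ pointDer K A) : Pt K A (DualNumber K) :=
  dualPt 1 D hD

@[simp] theorem expPt_fst {D : A →ₗ[K] K} (hD : D ∈ pointDer K A) : (expPt hD).fst = 1 := by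
  ext a; exact dualPt_fst 1 D hD a

@[simp] theorem expPt_snd {D : A →ₗ[K] K} (hD : D ∈ pointDer K A) : (expPt hD).snd = D := by
  ext a; exact dualPt_snd 1 D hD a

/-- The tangent vectors of `𝒦` are tangent to the orbit. -/
theorem ConjClass.exists_pointDer [CharZero K] [Algebra.FiniteType K A] [IsDomain A]
    {𝒦 : ConjClass K A} {y : Pt K A (DualNumber K)} (hfst : 𝒦.Mem y.fst)
    (hy : ∀ a ∈ PrimeSpectrum.vanishingIdeal 𝒦.carrier, y.hom a = 0) :
    ∃ (D : A →ₗ[K] K) (hD : D ∈ pointDer K A),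
      y = expPt hD * y.fst.inl * (expPt hD)⁻¹ := by
  set x := y.fst with hxdef
  let c := Pt.univ K A * Pt.map (Algebra.ofId K A) x * (Pt.univ K A)⁻¹
  have hJ : IsJacobsonRing A := isJacobsonRing_of_finiteType (A := K)
  have hker : ∀ a, c.hom a = 0 → y.hom a = 0 := by
    intro a ha
    refine hy a ((PrimeSpectrum.mem_vanishingIdeal _ _).2 ?_)
    have h1 : 𝒦.carrier ⊆ PrimeSpectrum.zeroLocus {a} := by
      refine subset_of_closedPoints 𝒦.isLocallyClosed
        (PrimeSpectrum.isClosed_zeroLocus _).isLocallyClosed fun p hp hpK => ?_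
      obtain ⟨φ, hφ⟩ := exists_geometric_point K hp
      obtain ⟨x₀, hx₀⟩ := 𝒦.isConj
      let Ω := AlgebraicClosure K
      have h2 : IsConj x₀ ⟨φ⟩ := by
        rw [← hx₀]
        convert hpK using 1
        exact PrimeSpectrum.ext hφ.symm
      have h3 : IsConj x₀ (Pt.map (Algebra.ofId K Ω) x) := by
        rw [← hx₀]
        refine hfst.2 ⟨⟨⊥, Ideal.isPrime_bot⟩, ?_⟩
        apply PrimeSpectrum.ext
        ext b
        change x.hom b = 0 ↔ algebraMap K Ω (x.hom b) = 0
        rw [map_eq_zero (algebraMap K Ω)]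
      obtain ⟨g, hg⟩ := isConj_iff.1 (h3.symm.trans h2)
      rw [PrimeSpectrum.mem_zeroLocus, Set.singleton_subset_iff]
      change a ∈ p.asIdeal
      rw [hφ, RingHom.mem_ker]
      change (⟨φ⟩ : Pt K A Ω).hom a = 0
      have h4 : Pt.map g.hom c = g * Pt.map (Algebra.ofId K Ω) x * g⁻¹ := by
        rw [map_mul, map_mul, map_inv, Pt.map_univ, Pt.map_ofId]
      rw [← hg, ← h4, Pt.map_hom, AlgHom.comp_apply, ha, map_zero]
    intro p hp
    exact h1 hp rfl
  let c' : A →ₐ[K] c.hom.range := c.hom.rangeRestrict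
  have hc' : Function.Surjective c' := c.hom.rangeRestrict_surjective
  let d : c.hom.range →ₐ[K] DualNumber K := AlgHom.liftOfSurjective c' hc' y.hom fun a ha =>
    hker a (congrArg Subtype.val ha)
  have hd : ∀ a, d (c' a) = y.hom a := fun a => AlgHom.liftOfSurjective_apply ..
  have hεc : ∀ a, Coalgebra.counit (R := K) (c.hom a) = x.hom a := by
    intro a
    have : Pt.map (1 : Pt K A K).hom c = x := by
      rw [map_mul, map_mul, map_inv, Pt.map_univ, Pt.map_ofId, one_mul, inv_one, mul_one]; rfl
    exact congrArg (fun t : Pt K A K => t.hom a) this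
  obtain ⟨D, hD, hDc⟩ := (isLeftCoideal_range_conj x).exists_pointDer d (by
    intro b
    obtain ⟨a, rfl⟩ := hc' b
    rw [hd]
    exact (hεc a).symm)
  refine ⟨D, hD, ?_⟩
  have h1 : expPt hD * x.inl * (expPt hD)⁻¹ = Pt.map (expPt hD).hom c := by
    rw [map_mul, map_mul, map_inv, Pt.map_univ, Pt.map_ofId]; rfl
  rw [h1]
  apply Pt.dual_ext
  · rw [← hxdef]
    ext a
    change x.hom a = TrivSqZeroExt.fst ((expPt hD).hom (c.hom a))
    rw [← Pt.fst_apply, expPt_fst, ← hεc]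
    rfl
  · ext a
    change y.snd a = (expPt hD).snd (c.hom a)
    rw [expPt_snd]
    exact ((hDc (c' a)).trans (congrArg _ (hd a))).symm

end Conj

/-! ### The unipotent subgroup attached to an invariant flag -/

section Flag

variable {K A Ω : Type u} [Field K] [CommRing A] [HopfAlgebra K A] [Field Ω] [Algebra K Ω]

/-- `W` is stable under right translations, that is, a subcomodule. -/
def IsSubcomodule (W : Submodule K A) : Prop := ∀ φ : A →ₗ[K] K, ∀ a ∈ W, rAct φ a ∈ W

theorem IsSubcomodule.conv_eq_zero {W : Submodule K A} (hW : IsSubcomodule W) {ψ : A →ₗ[K] Ω}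
    (hψ : ∀ a ∈ W, ψ a = 0) (f : A →ₗ[K] Ω) {a : A} (ha : a ∈ W) : conv ψ f a = 0 :=
  conv_eq_zero_of_slices _ _ _ fun _ => hψ _ (hW _ _ ha)

theorem sub_conv (f g h : A →ₗ[K] Ω) : conv (f - g) h = conv f h - conv g h := by
  ext a
  simp [conv_repr _ _ (Coalgebra.Repr.arbitrary K a), sub_mul]

/-- The condition that `g` acts trivially on the graded pieces of the flag `W`. -/
def ActsTrivially (W : ℕ → Submodule K A) (g : Pt K A Ω) : Prop :=
  ∀ (k : ℕ) (ψ : A →ₗ[K] Ω), (∀ a ∈ W (k + 1), ψ a = 0) → ∀ a ∈ W k,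
    (conv ψ g.hom.toLinearMap - ψ) a = 0

theorem conv_mul (ψ : A →ₗ[K] Ω) (g h : Pt K A Ω) :
    conv ψ (g * h).hom.toLinearMap = conv (conv ψ g.hom.toLinearMap) h.hom.toLinearMap := by
  rw [Pt.mul_toLinearMap, conv_assoc]

theorem conv_one (ψ : A →ₗ[K] Ω) : conv ψ (1 : Pt K A Ω).hom.toLinearMap = ψ := by
  rw [Pt.one_toLinearMap, conv_counit]

variable (Ω) in
/-- The group of points that act trivially on the graded pieces of the flag `W`. -/
def flagSubgroup (W : ℕ → Submodule K A) (hW : ∀ k, IsSubcomodule (W k)) :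
    Subgroup (Pt K A Ω) where
  carrier := {g | ActsTrivially W g}
  one_mem' := by
    intro k ψ _ a _
    rw [conv_one, sub_self, LinearMap.zero_apply]
  mul_mem' := by
    intro g h hg hh k ψ hψ a ha
    have h1 := (hW k).conv_eq_zero (hg k ψ hψ) h.hom.toLinearMap ha
    have h2 := hh k ψ hψ a ha
    rw [sub_conv, ← conv_mul] at h1
    simp only [LinearMap.sub_apply] at h1 h2 ⊢
    rw [← sub_add_sub_cancel, h1, h2, add_zero]
  inv_mem' := by
    intro g hg k ψ hψ a ha
    have h1 := (hW k).conv_eq_zero (hg k ψ hψ) g⁻¹.hom.toLinearMap ha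
    rw [sub_conv, ← conv_mul, mul_inv_cancel, conv_one] at h1
    rw [← neg_sub, LinearMap.neg_apply, h1, neg_zero]

theorem flagSubgroup_normal (W : ℕ → Submodule K A) (hW : ∀ k, IsSubcomodule (W k)) :
    (flagSubgroup Ω W hW).Normal := by
  refine ⟨fun g hg h k ψ hψ a ha => ?_⟩
  have h1 : ∀ a ∈ W (k + 1), conv ψ h.hom.toLinearMap a = 0 :=
    fun a ha => (hW (k + 1)).conv_eq_zero hψ _ ha
  have h2 := (hW k).conv_eq_zero (hg k _ h1) h⁻¹.hom.toLinearMap ha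
  rwa [sub_conv, ← conv_mul, ← conv_mul, ← conv_mul, mul_inv_cancel, conv_one, ← mul_assoc] at h2

theorem isClosed_setOf_eval_eq_zero (H : Ω ⊗[K] A) :
    @IsClosed _ (zariski K A Ω) {g : Pt K A Ω | g.eval H = 0} := by
  let := zariski K A Ω
  have h1 := (PrimeSpectrum.isClosed_zeroLocus ({H} : Set (Ω ⊗[K] A))).preimage
    (continuous_induced_dom (f := fun g : Pt K A Ω =>
      (⟨RingHom.ker g.eval.toRingHom, RingHom.ker_isPrime _⟩ : PrimeSpectrum (Ω ⊗[K] A))))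
  convert h1 using 1
  ext g
  simp only [Set.mem_ofPred_eq, Set.mem_preimage, PrimeSpectrum.mem_zeroLocus,
    Set.singleton_subset_iff]
  rfl

/-- The function on `G` whose value at `g` is `(conv ψ g - ψ) a`. -/
def translationDefect (ψ : A →ₗ[K] Ω) (a : A) : Ω ⊗[K] A :=
  TensorProduct.map ψ LinearMap.id (Coalgebra.comul (R := K) a) - ψ a ⊗ₜ 1

theorem eval_translationDefect (ψ : A →ₗ[K] Ω) (a : A) (g : Pt K A Ω) :
    g.eval (translationDefect ψ a) = (conv ψ g.hom.toLinearMap - ψ) a := by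
  rw [translationDefect, map_sub, LinearMap.sub_apply,
    conv_repr _ _ (Coalgebra.Repr.arbitrary K a)]
  conv_lhs => rw [← (Coalgebra.Repr.arbitrary K a).eq]
  simp [Pt.eval]

theorem flagSubgroup_isClosed (W : ℕ → Submodule K A) (hW : ∀ k, IsSubcomodule (W k)) :
    IsClosedSubgroup (flagSubgroup Ω W hW) := by
  let := zariski K A Ω
  have : (flagSubgroup Ω W hW : Set (Pt K A Ω)) = ⋂ (k : ℕ) (ψ : A →ₗ[K] Ω)
      (_ : ∀ a ∈ W (k + 1), ψ a = 0) (a : A) (_ : a ∈ W k),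
      {g : Pt K A Ω | g.eval (translationDefect ψ a) = 0} := by
    ext g
    simp only [Set.mem_iInter, Set.mem_ofPred_eq, eval_translationDefect]
    rfl
  rw [IsClosedSubgroup, this]
  exact isClosed_iInter fun k => isClosed_iInter fun ψ => isClosed_iInter fun _ =>
    isClosed_iInter fun a => isClosed_iInter fun _ => isClosed_setOf_eval_eq_zero _

/-- The slicing map `Ω ⊗ A → Ω` of a linear map `A → Ω`. -/
def slice (ψ : A →ₗ[K] Ω) : Ω ⊗[K] A →ₗ[Ω] Ω :=
  TensorProduct.AlgebraTensorModule.lift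
    ((LinearMap.lsmul Ω (A →ₗ[K] Ω)).flip ψ)

@[simp] theorem slice_tmul (ψ : A →ₗ[K] Ω) (ω : Ω) (a : A) : slice ψ (ω ⊗ₜ a) = ω * ψ a := by
  simp [slice]

theorem slice_sub (ψ χ : A →ₗ[K] Ω) (F : Ω ⊗[K] A) :
    slice (ψ - χ) F = slice ψ F - slice χ F := by
  induction F with
  | zero => simp
  | tmul ω a => simp [mul_sub]
  | add x y hx hy => simp only [map_add, hx, hy]; ring

theorem eq_zero_of_slice (F : Ω ⊗[K] A) (h : ∀ ψ : A →ₗ[K] Ω, slice ψ F = 0) : F = 0 := by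
  apply tensor_eq_zero_of_slices
  intro c
  rw [← h (scal Ω c)]
  have : ∀ F : Ω ⊗[K] A, TensorProduct.rid K Ω (c.lTensor Ω F) = slice (scal Ω c) F := by
    intro F
    induction F with
    | zero => simp
    | tmul ω a => simp [Algebra.smul_def, mul_comm]
    | add x y hx hy => simp only [map_add, hx, hy]
  exact this F

theorem slice_rightTranslation (ψ : A →ₗ[K] Ω) (g : Pt K A Ω) (F : Ω ⊗[K] A) :
    slice ψ (g.rightTranslation F) = slice (conv ψ g.hom.toLinearMap) F := by
  induction F with
  | zero => simp
  | add x y hx hy => simp only [map_add, hx, hy]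
  | tmul ω a =>
    have h1 : g.rightTranslation (ω ⊗ₜ a) = ω • g.rightTranslation (1 ⊗ₜ a) := by
      rw [← map_smul, TensorProduct.smul_tmul', smul_eq_mul, mul_one]
    rw [h1, map_smul, slice_tmul, smul_eq_mul]
    congr 1
    rw [Pt.rightTranslation, Algebra.TensorProduct.lift_tmul, map_one, one_mul,
      Pt.mul_apply_repr _ _ (Coalgebra.Repr.arbitrary K a), map_sum,
      conv_repr _ _ (Coalgebra.Repr.arbitrary K a)]
    refine Finset.sum_congr rfl fun i _ => ?_
    simp [mul_comm]

/-- The elements killed by a power of `r - 1`, for an algebra endomorphism `r`. -/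
theorem exists_pow_sub_one_mul {B : Type*} [CommRing B] [Algebra Ω B] (r : B →ₐ[Ω] B) (m : ℕ) :
    ∀ (n p : ℕ) (F G : B), n + p = m →
      ((r.toLinearMap - 1 : Module.End Ω B) ^ n) F = 0 →
      ((r.toLinearMap - 1 : Module.End Ω B) ^ p) G = 0 →
      ((r.toLinearMap - 1 : Module.End Ω B) ^ m) (F * G) = 0 := by
  set N : Module.End Ω B := r.toLinearMap - 1 with hN
  have hNmul : ∀ F G, N (F * G) = N F * G + F * N G + N F * N G := by
    intro F G
    simp only [hN, LinearMap.sub_apply, AlgHom.toLinearMap_apply, map_mul, Module.End.one_apply]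
    ring
  induction m with
  | zero =>
    intro n p F G hm hF hG
    obtain ⟨rfl, rfl⟩ : n = 0 ∧ p = 0 := by omega
    have hF' : F = 0 := hF
    rw [hF', zero_mul, map_zero]
  | succ m ih =>
    have ih' : ∀ (n p : ℕ) (F G : B), n + p ≤ m → (N ^ n) F = 0 → (N ^ p) G = 0 →
        (N ^ m) (F * G) = 0 := by
      intro n p F G hle hF hG
      refine ih n (m - n) F G (by omega) hF ?_
      rw [← Nat.sub_add_cancel (show p ≤ m - n by omega), pow_add, Module.End.mul_apply, hG,
        map_zero]
    intro n p F G hm hF hG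
    rcases n with _ | n
    · have hF' : F = 0 := hF
      rw [hF', zero_mul, map_zero]
    rcases p with _ | p
    · have hG' : G = 0 := hG
      rw [hG', mul_zero, map_zero]
    have hNF : (N ^ n) (N F) = 0 := by rw [← Module.End.mul_apply, ← pow_succ]; exact hF
    have hNG : (N ^ p) (N G) = 0 := by rw [← Module.End.mul_apply, ← pow_succ]; exact hG
    rw [pow_succ, Module.End.mul_apply, hNmul, map_add, map_add,
      ih' n (p + 1) _ _ (by omega) hNF hG, ih' (n + 1) p _ _ (by omega) hF hNG,
      ih' n p _ _ (by omega) hNF hNG, add_zero, add_zero]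

theorem flagSubgroup_isUnipotent (W : ℕ → Submodule K A) (hW : ∀ k, IsSubcomodule (W k)) {n : ℕ}
    (hn : W n = ⊥) (hgen : Algebra.adjoin K (W 0 : Set A) = ⊤) {g : Pt K A Ω}
    (hg : g ∈ flagSubgroup Ω W hW) : g.IsUnipotent := by
  set N : Module.End Ω (Ω ⊗[K] A) := g.rightTranslation.toLinearMap - 1 with hN
  have hpow : ∀ v ∈ W 0, ∀ k (ψ : A →ₗ[K] Ω), (∀ a ∈ W k, ψ a = 0) →
      slice ψ ((N ^ k) (1 ⊗ₜ v)) = 0 := by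
    intro v hv k
    induction k with
    | zero => intro ψ hψ; simp [hψ v hv]
    | succ k ih =>
      intro ψ hψ
      rw [pow_succ', Module.End.mul_apply]
      have := ih _ (hg k ψ hψ)
      rw [← this, hN, LinearMap.sub_apply, map_sub, AlgHom.toLinearMap_apply,
        slice_rightTranslation, Module.End.one_apply]
      exact (slice_sub _ _ _).symm
  have hV : ∀ v ∈ W 0, (N ^ n) (1 ⊗ₜ v) = 0 := by
    intro v hv
    refine eq_zero_of_slice _ fun ψ => hpow v hv n ψ fun a ha => ?_
    rw [hn, Submodule.mem_bot] at ha
    rw [ha, map_zero]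
  have hadd : ∀ F G, (∃ n, (N ^ n) F = 0) → (∃ n, (N ^ n) G = 0) → ∃ n, (N ^ n) (F + G) = 0 := by
    rintro F G ⟨n, hF⟩ ⟨m, hG⟩
    refine ⟨n + m, ?_⟩
    rw [map_add]
    nth_rewrite 1 [add_comm n m]
    rw [pow_add, pow_add, Module.End.mul_apply, Module.End.mul_apply, hF, hG, map_zero, map_zero,
      add_zero]
  intro F
  induction F with
  | zero => exact ⟨0, rfl⟩
  | add x y hx hy => exact hadd x y hx hy
  | tmul ω a =>
    have h1 : ∃ n, (N ^ n) ((1 : Ω) ⊗ₜ[K] a) = 0 := by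
      have ha : a ∈ Algebra.adjoin K (W 0 : Set A) := hgen ▸ trivial
      induction ha using Algebra.adjoin_induction with
      | mem v hv => exact ⟨n, hV v hv⟩
      | algebraMap r =>
        refine ⟨1, ?_⟩
        have : (1 : Ω) ⊗ₜ[K] algebraMap K A r = algebraMap Ω _ (algebraMap K Ω r) := by
          rw [Algebra.TensorProduct.algebraMap_apply, Algebra.algebraMap_eq_smul_one,
            TensorProduct.tmul_smul, TensorProduct.smul_tmul', Algebra.smul_def, mul_one]
          rfl
        rw [this, pow_one, hN, LinearMap.sub_apply, AlgHom.toLinearMap_apply, AlgHom.commutes,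
          Module.End.one_apply, sub_self]
      | add x y _ _ hx hy =>
        rw [TensorProduct.tmul_add]
        exact hadd _ _ hx hy
      | mul x y _ _ hx hy =>
        obtain ⟨n, hx⟩ := hx
        obtain ⟨m, hy⟩ := hy
        have := exists_pow_sub_one_mul g.rightTranslation (n + m) n m _ _ rfl hx hy
        rw [Algebra.TensorProduct.tmul_mul_tmul, one_mul] at this
        exact ⟨_, this⟩
    obtain ⟨n, hn⟩ := h1
    refine ⟨n, ?_⟩
    have : ω ⊗ₜ[K] a = ω • ((1 : Ω) ⊗ₜ[K] a) := by
      rw [TensorProduct.smul_tmul', smul_eq_mul, mul_one]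
    rw [this, map_smul, hn, smul_zero]

/-- The points of an affine line in `G` form a connected set. -/
theorem isPreconnected_range_curve [Infinite Ω] (P : A →ₐ[K] Polynomial Ω) :
    @IsPreconnected _ (zariski K A Ω) (Set.range fun c : Ω =>
      (⟨((Polynomial.aeval c).restrictScalars K).comp P⟩ : Pt K A Ω)) := by
  let := zariski K A Ω
  let ι : Ω → PrimeSpectrum (Polynomial Ω) := fun c =>
    ⟨RingHom.ker (Polynomial.aeval (R := Ω) c).toRingHom, RingHom.ker_isPrime _⟩
  have hdense : closure (Set.range ι) = Set.univ := by
    rw [← dense_iff_closure_eq, PrimeSpectrum.isTopologicalBasis_basic_opens.dense_iff]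
    rintro _ ⟨p, rfl⟩ ⟨x, hx⟩
    have hp : p ≠ 0 := fun h => hx (h ▸ x.asIdeal.zero_mem)
    obtain ⟨c, hc⟩ : ∃ c, p.eval c ≠ 0 := by
      by_contra! h
      exact hp (Polynomial.funext fun c => by rw [h c, Polynomial.eval_zero])
    refine ⟨ι c, ?_, c, rfl⟩
    change p ∉ RingHom.ker (Polynomial.aeval (R := Ω) c).toRingHom
    rw [RingHom.mem_ker]
    change Polynomial.aeval c p ≠ 0
    rwa [Polynomial.coe_aeval_eq_eval]
  have h1 : IsPreconnected (Set.range ι) := by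
    apply IsPreirreducible.isPreconnected
    rw [← isPreirreducible_iff_closure, hdense]
    exact PreirreducibleSpace.isPreirreducible_univ
  let Pt' : Ω ⊗[K] A →ₐ[Ω] Polynomial Ω :=
    Algebra.TensorProduct.lift (Algebra.ofId Ω _) P (fun _ _ => .all _ _)
  have hind : Topology.IsInducing (fun g : Pt K A Ω =>
      (⟨RingHom.ker g.eval.toRingHom, RingHom.ker_isPrime _⟩ : PrimeSpectrum (Ω ⊗[K] A))) := ⟨rfl⟩
  rw [← hind.isPreconnected_image]
  convert h1.image (PrimeSpectrum.comap Pt'.toRingHom)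
    (PrimeSpectrum.continuous_comap _).continuousOn using 1
  rw [← Set.range_comp, ← Set.range_comp]
  congr 1
  funext c
  apply PrimeSpectrum.ext
  change RingHom.ker _ = Ideal.comap _ (RingHom.ker _)
  rw [RingHom.comap_ker]
  congr 1
  have : (⟨((Polynomial.aeval c).restrictScalars K).comp P⟩ : Pt K A Ω).eval =
      (Polynomial.aeval c).comp Pt' := by
    apply Algebra.TensorProduct.ext'
    intro ω a
    simp [Pt.eval, Pt', Algebra.ofId_apply]
  rw [this]
  rfl

end Flag

section FlagCurves

variable {K A Ω : Type u} [Field K] [CommRing A] [HopfAlgebra K A] [Field Ω] [Algebra K Ω]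

theorem polynomial_eq_of_eval_natCast [CharZero Ω] {p q : Polynomial Ω}
    (h : ∀ m : ℕ, p.eval (m : Ω) = q.eval (m : Ω)) : p = q := by
  refine Polynomial.eq_of_infinite_eval_eq p q (Set.Infinite.mono ?_
    (Set.infinite_range_of_injective (Nat.cast_injective (R := Ω))))
  rintro _ ⟨m, rfl⟩
  exact h m

/-- Right convolution with a point, as an operator on linear maps. -/
def convRight (u : Pt K A Ω) : Module.End K (A →ₗ[K] Ω) where
  toFun ψ := conv ψ u.hom.toLinearMap
  map_add' f g := by
    ext a
    simp [conv_repr _ _ (Coalgebra.Repr.arbitrary K a), add_mul, Finset.sum_add_distrib]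
  map_smul' c f := by
    ext a
    simp [conv_repr _ _ (Coalgebra.Repr.arbitrary K a), Finset.smul_sum]

theorem convRight_pow (u : Pt K A Ω) (m : ℕ) (ψ : A →ₗ[K] Ω) :
    (convRight u ^ m) ψ = conv ψ (u ^ m).hom.toLinearMap := by
  induction m with
  | zero => rw [pow_zero, pow_zero, conv_one]; rfl
  | succ m ih => rw [pow_succ', Module.End.mul_apply, ih, pow_succ, conv_mul]; rfl

/-- The powers of an element of the flag subgroup lie on an affine line. -/
theorem exists_curve_of_mem_flagSubgroup [CharZero Ω] (W : ℕ → Submodule K A)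
    (hW : ∀ k, IsSubcomodule (W k)) {n : ℕ}
    (hn : W n = ⊥) (hgen : Algebra.adjoin K (W 0 : Set A) = ⊤) {u : Pt K A Ω}
    (hu : u ∈ flagSubgroup Ω W hW) :
    ∃ P : A →ₐ[K] Polynomial Ω, ∀ (m : ℕ) (a : A), (P a).eval (m : Ω) = (u ^ m).hom a := by
  set T : Module.End K (A →ₗ[K] Ω) := convRight u - 1 with hT
  have hTpow : ∀ (j : ℕ) (ψ : A →ₗ[K] Ω), (∀ a ∈ W j, ψ a = 0) → ∀ a ∈ W 0, (T ^ j) ψ a = 0 := by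
    intro j
    induction j with
    | zero => intro ψ hψ a ha; exact hψ a ha
    | succ j ih =>
      intro ψ hψ a ha
      rw [pow_succ, Module.End.mul_apply]
      exact ih _ (hu j ψ hψ) a ha
  have hTn : ∀ j, n ≤ j → ∀ ψ, ∀ a ∈ W 0, (T ^ j) ψ a = 0 := by
    intro j hj ψ a ha
    rw [← Nat.add_sub_cancel' hj, pow_add, Module.End.mul_apply]
    refine hTpow n _ (fun a ha => ?_) a ha
    rw [hn, Submodule.mem_bot] at ha
    rw [ha, map_zero]
  let ψ₀ : A →ₗ[K] Ω := scal Ω Coalgebra.counit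
  have hV : ∀ v ∈ W 0, ∃ p : Polynomial Ω, ∀ m : ℕ, p.eval (m : Ω) = (u ^ m).hom v := by
    intro v hv
    refine ⟨∑ j ∈ Finset.range n, Polynomial.C ((T ^ j) ψ₀ v / (j.factorial : Ω)) *
      descPochhammer Ω j, fun m => ?_⟩
    have h1 : (u ^ m).hom v = (convRight u ^ m) ψ₀ v := by
      rw [convRight_pow, counit_conv]; rfl
    have h2 : convRight u = T + 1 := (sub_add_cancel (convRight u) 1).symm
    rw [h1, h2, (Commute.one_right T).add_pow]
    simp only [one_pow, mul_one, LinearMap.sum_apply, Polynomial.eval_finsetSum,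
      Polynomial.eval_mul, Polynomial.eval_C]
    have h3 : ∀ j : ℕ, (T ^ j * (m.choose j : Module.End K (A →ₗ[K] Ω))) ψ₀ v =
        (m.choose j : Ω) * (T ^ j) ψ₀ v := by
      intro j
      rw [← nsmul_eq_mul', LinearMap.smul_apply, LinearMap.smul_apply, nsmul_eq_mul]
    have h4 : ∀ j : ℕ, (T ^ j) ψ₀ v / (j.factorial : Ω) * (descPochhammer Ω j).eval (m : Ω) =
        (m.choose j : Ω) * (T ^ j) ψ₀ v := by
      intro j
      rw [Nat.cast_choose_eq_descPochhammer_div]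
      ring
    simp only [h3, h4]
    have h5 : ∀ N, (n ≤ N → ∑ j ∈ Finset.range n, (m.choose j : Ω) * (T ^ j) ψ₀ v =
        ∑ j ∈ Finset.range N, (m.choose j : Ω) * (T ^ j) ψ₀ v) ∧
        (m + 1 ≤ N → ∑ j ∈ Finset.range (m + 1), (m.choose j : Ω) * (T ^ j) ψ₀ v =
        ∑ j ∈ Finset.range N, (m.choose j : Ω) * (T ^ j) ψ₀ v) := by
      refine fun N => ⟨fun h => Finset.sum_subset (Finset.range_mono h) fun j _ hj => ?_,
        fun h => Finset.sum_subset (Finset.range_mono h) fun j _ hj => ?_⟩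
      · rw [hTn j (by simpa using hj) ψ₀ v hv, mul_zero]
      · rw [Nat.choose_eq_zero_of_lt (by simpa using hj), Nat.cast_zero, zero_mul]
    rw [(h5 (n + (m + 1))).1 (by omega), (h5 (n + (m + 1))).2 (by omega)]
  have hall : ∀ a : A, ∃ p : Polynomial Ω, ∀ m : ℕ, p.eval (m : Ω) = (u ^ m).hom a := by
    intro a
    have ha : a ∈ Algebra.adjoin K (W 0 : Set A) := hgen ▸ trivial
    induction ha using Algebra.adjoin_induction with
    | mem v hv => exact hV v hv
    | algebraMap r => exact ⟨Polynomial.C (algebraMap K Ω r), fun m => by simp⟩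
    | add x y _ _ hx hy =>
      obtain ⟨p, hp⟩ := hx
      obtain ⟨q, hq⟩ := hy
      exact ⟨p + q, fun m => by simp [hp, hq]⟩
    | mul x y _ _ hx hy =>
      obtain ⟨p, hp⟩ := hx
      obtain ⟨q, hq⟩ := hy
      exact ⟨p * q, fun m => by simp [hp, hq]⟩
  choose p hp using hall
  exact ⟨
    { toFun := p
      map_one' := polynomial_eq_of_eval_natCast fun m => by simp [hp]
      map_mul' := fun a b => polynomial_eq_of_eval_natCast fun m => by simp [hp]
      map_zero' := polynomial_eq_of_eval_natCast fun m => by simp [hp]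
      map_add' := fun a b => polynomial_eq_of_eval_natCast fun m => by simp [hp]
      commutes' := fun r => polynomial_eq_of_eval_natCast fun m => by
        simp [hp, Polynomial.algebraMap_apply] }, fun m a => hp a m⟩

theorem flagSubgroup_isConnected [CharZero Ω] (W : ℕ → Submodule K A)
    (hW : ∀ k, IsSubcomodule (W k)) {n : ℕ}
    (hn : W n = ⊥) (hgen : Algebra.adjoin K (W 0 : Set A) = ⊤) :
    IsConnectedSubgroup (flagSubgroup Ω W hW) := by
  let := zariski K A Ω
  refine ⟨⟨1, one_mem _⟩, isPreconnected_of_forall 1 fun u hu => ?_⟩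
  obtain ⟨P, hP⟩ := exists_curve_of_mem_flagSubgroup W hW hn hgen hu
  have hpt : ∀ m : ℕ, (⟨((Polynomial.aeval (m : Ω)).restrictScalars K).comp P⟩ : Pt K A Ω) =
      u ^ m := by
    intro m
    ext a
    rw [← hP m a, ← Polynomial.coe_aeval_eq_eval]
    rfl
  refine ⟨Set.range fun c : Ω => (⟨((Polynomial.aeval c).restrictScalars K).comp P⟩ : Pt K A Ω), ?_,
    ⟨((0 : ℕ) : Ω), by simpa using hpt 0⟩, ⟨((1 : ℕ) : Ω), by simpa using hpt 1⟩,
    isPreconnected_range_curve P⟩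
  rintro _ ⟨c, rfl⟩ k ψ hψ a ha
  rw [← eval_translationDefect]
  let P' : Ω ⊗[K] A →ₐ[Ω] Polynomial Ω :=
    Algebra.TensorProduct.lift (Algebra.ofId Ω _) P (fun _ _ => .all _ _)
  have heval : ∀ c : Ω, (⟨((Polynomial.aeval c).restrictScalars K).comp P⟩ : Pt K A Ω).eval =
      (Polynomial.aeval c).comp P' := by
    intro c
    apply Algebra.TensorProduct.ext'
    intro ω a
    simp [Pt.eval, P', Algebra.ofId_apply]
  have hzero : P' (translationDefect ψ a) = 0 := by
    refine polynomial_eq_of_eval_natCast fun m => ?_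
    have h1 := (flagSubgroup Ω W hW).pow_mem hu m k ψ hψ a ha
    rw [← hpt m, ← eval_translationDefect, heval] at h1
    rw [Polynomial.eval_zero, ← h1, ← Polynomial.coe_aeval_eq_eval]
    rfl
  rw [heval, AlgHom.comp_apply, hzero, map_zero]

/-- Iterates of a derivation on a product. -/
theorem pow_derivation_mul (d : Module.End K A) (hd : ∀ a b, d (a * b) = a * d b + d a * b) (n : ℕ)
    (a b : A) : (d ^ n) (a * b) =
      ∑ m ∈ Finset.HasAntidiagonal.antidiagonal n, n.choose m.1 • ((d ^ m.1) a * (d ^ m.2) b) := by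
  let x : Module.End K (A ⊗[K] A) := d.rTensor A
  let y : Module.End K (A ⊗[K] A) := d.lTensor A
  have hxy : Commute x y := by
    refine TensorProduct.ext' fun a b => ?_
    simp [x, y]
  have h1 : d ∘ₗ LinearMap.mul' K A = LinearMap.mul' K A ∘ₗ (x + y) := by
    refine TensorProduct.ext' fun a b => ?_
    simp [x, y, hd, add_comm]
  have h2 : ∀ n : ℕ, (d ^ n) ∘ₗ LinearMap.mul' K A = LinearMap.mul' K A ∘ₗ ((x + y) ^ n) := by
    intro n
    induction n with
    | zero => rfl
    | succ n ih =>
      rw [pow_succ, pow_succ', Module.End.mul_eq_comp, LinearMap.comp_assoc, h1,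
        ← LinearMap.comp_assoc, ih, LinearMap.comp_assoc, ← Module.End.mul_eq_comp, ← pow_succ,
        ← pow_succ']
  have h3 := LinearMap.congr_fun (h2 n) (a ⊗ₜ b)
  rw [hxy.add_pow'] at h3
  simp only [LinearMap.comp_apply, LinearMap.mul'_apply, LinearMap.sum_apply, map_sum] at h3
  rw [h3]
  refine Finset.sum_congr rfl fun m _ => ?_
  rw [LinearMap.smul_apply, map_nsmul, Module.End.mul_apply]
  congr 1
  have h4 : ∀ i, x ^ i = (d ^ i).rTensor A := fun i => LinearMap.rTensor_pow _ _
  have h5 : ∀ i, y ^ i = (d ^ i).lTensor A := fun i => LinearMap.lTensor_pow _ _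
  rw [h4, h5]
  simp

theorem rAct_counit_comp (D : A →ₗ[K] K) (j : ℕ) :
    rAct ((Coalgebra.counit : A →ₗ[K] K) ∘ₗ (rAct D ^ j : Module.End K A)) = rAct D ^ j := by
  induction j with
  | zero => exact rAct_counit
  | succ j ih =>
    rw [pow_succ, Module.End.mul_eq_comp, ← LinearMap.comp_assoc]
    rw [show (Coalgebra.counit ∘ₗ (rAct D ^ j : Module.End K A)) ∘ₗ rAct D =
      conv (Coalgebra.counit ∘ₗ (rAct D ^ j : Module.End K A)) D from comp_rAct _ _,
      ← rAct_rAct, ih]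

/-- The exponential curve of a Lie algebra element that acts nilpotently on generators. -/
theorem exists_exp_curve [CharZero Ω] (V : Submodule K A)
    (hgen : Algebra.adjoin K (V : Set A) = ⊤) {D : A →ₗ[K] K} (hD : D ∈ pointDer K A) {n : ℕ}
    (hn : ∀ v ∈ V, ∀ k, n ≤ k → (rAct D ^ k : Module.End K A) v = 0) :
    ∃ P : A →ₐ[K] Polynomial Ω, ∀ (k : ℕ) (a : A), (P a).coeff k * (k.factorial : Ω) =
      algebraMap K Ω (Coalgebra.counit (R := K) ((rAct D ^ k : Module.End K A) a)) := by
  set d : Module.End K A := rAct D with hd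
  have hfac : ∀ k : ℕ, (k.factorial : Ω) ≠ 0 := fun k => Nat.cast_ne_zero.2 k.factorial_ne_zero
  have hone : ∀ k, 0 < k → (d ^ k) 1 = 0 := by
    intro k hk
    obtain ⟨k, rfl⟩ := Nat.exists_eq_succ_of_ne_zero hk.ne'
    rw [Nat.succ_eq_add_one, pow_succ, Module.End.mul_apply]
    have h1 := rAct_mul hD 1 1
    rw [mul_one, one_mul, mul_one] at h1
    have h2 : rAct D 1 = 0 := by simpa using h1
    rw [hd, h2, map_zero]
  have halg : ∀ (r : K) (k : ℕ), ((Polynomial.C (algebraMap K Ω r)).coeff k) * (k.factorial : Ω) =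
      algebraMap K Ω (Coalgebra.counit (R := K) ((d ^ k) (algebraMap K A r))) := by
    intro r k
    rw [Algebra.algebraMap_eq_smul_one (A := A) r, map_smul]
    rcases k.eq_zero_or_pos with rfl | hk
    · simp
    · rw [hone k hk, Polynomial.coeff_C, if_neg hk.ne']
      simp
  have hmul : ∀ a b (p q : Polynomial Ω),
      (∀ k, p.coeff k * (k.factorial : Ω) =
        algebraMap K Ω (Coalgebra.counit (R := K) ((d ^ k) a))) →
      (∀ k, q.coeff k * (k.factorial : Ω) =
        algebraMap K Ω (Coalgebra.counit (R := K) ((d ^ k) b))) →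
      ∀ k, (p * q).coeff k * (k.factorial : Ω) =
        algebraMap K Ω (Coalgebra.counit (R := K) ((d ^ k) (a * b))) := by
    intro a b p q hp hq k
    rw [pow_derivation_mul d (rAct_mul hD), Polynomial.coeff_mul, Finset.sum_mul, map_sum, map_sum]
    refine Finset.sum_congr rfl fun m hm => ?_
    rw [map_nsmul, map_nsmul, Bialgebra.counit_mul, map_mul, ← hp, ← hq, nsmul_eq_mul]
    rw [Finset.HasAntidiagonal.mem_antidiagonal] at hm
    have h1 : (k.choose m.1 : Ω) * (m.1.factorial : Ω) * (m.2.factorial : Ω) =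
        (k.factorial : Ω) := by
      rw [← hm]
      rw [Nat.choose_symm_add]
      exact_mod_cast Nat.add_choose_mul_factorial_mul_factorial m.1 m.2
    rw [← h1]
    ring
  have hall : ∀ a : A, ∃ p : Polynomial Ω, ∀ k : ℕ, p.coeff k * (k.factorial : Ω) =
      algebraMap K Ω (Coalgebra.counit (R := K) ((d ^ k) a)) := by
    intro a
    have ha : a ∈ Algebra.adjoin K (V : Set A) := hgen ▸ trivial
    induction ha using Algebra.adjoin_induction with
    | mem v hv =>
      refine ⟨∑ j ∈ Finset.range n, Polynomial.monomial j
        (algebraMap K Ω (Coalgebra.counit (R := K) ((d ^ j) v)) / (j.factorial : Ω)), fun k => ?_⟩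
      simp only [Polynomial.finsetSum_coeff, Polynomial.coeff_monomial, Finset.sum_ite_eq',
        Finset.mem_range]
      split_ifs with hk
      · exact div_mul_cancel₀ _ (hfac k)
      · rw [hn v hv k (by omega), map_zero, map_zero, zero_mul]
    | algebraMap r => exact ⟨_, halg r⟩
    | add x y _ _ hx hy =>
      obtain ⟨p, hp⟩ := hx
      obtain ⟨q, hq⟩ := hy
      exact ⟨p + q, fun k => by simp [hp, hq, add_mul]⟩
    | mul x y _ _ hx hy =>
      obtain ⟨p, hp⟩ := hx
      obtain ⟨q, hq⟩ := hy
      exact ⟨p * q, hmul _ _ _ _ hp hq⟩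
  choose p hp using hall
  have huniq : ∀ a (q : Polynomial Ω), (∀ k, q.coeff k * (k.factorial : Ω) =
      algebraMap K Ω (Coalgebra.counit (R := K) ((d ^ k) a))) → p a = q := by
    intro a q hq
    ext k
    exact mul_right_cancel₀ (hfac k) ((hp a k).trans (hq k).symm)
  exact ⟨
    { toFun := p
      map_one' := huniq _ _ fun k => by simpa using halg 1 k
      map_mul' := fun a b => huniq _ _ (hmul _ _ _ _ (hp a) (hp b))
      map_zero' := huniq _ _ fun k => by simp
      map_add' := fun a b => huniq _ _ fun k => by simp [add_mul, hp]
      commutes' := fun r => huniq _ _ (halg r) }, fun k a => hp a k⟩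

/-- In a reductive group, a Lie algebra element that strictly lowers an invariant flag is zero. -/
theorem eq_zero_of_lowers_flag [CharZero Ω] (W : ℕ → Submodule K A)
    (hW : ∀ k, IsSubcomodule (W k)) (hanti : ∀ k, W (k + 1) ≤ W k) {n : ℕ}
    (hn : W n = ⊥) (hgen : Algebra.adjoin K (W 0 : Set A) = ⊤)
    (hU : flagSubgroup Ω W hW = ⊥) {D : A →ₗ[K] K} (hD : D ∈ pointDer K A)
    (hDW : ∀ k, ∀ a ∈ W k, rAct D a ∈ W (k + 1)) : D = 0 := by
  have hpowW : ∀ j k, ∀ a ∈ W k, (rAct D ^ j : Module.End K A) a ∈ W (k + j) := by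
    intro j
    induction j with
    | zero => intro k a ha; exact ha
    | succ j ih =>
      intro k a ha
      rw [pow_succ', Module.End.mul_apply]
      exact hDW _ _ (ih k a ha)
  have hle : ∀ {j k : ℕ}, j ≤ k → W k ≤ W j := fun h => antitone_nat_of_succ_le hanti h
  obtain ⟨P, hP⟩ := exists_exp_curve (Ω := Ω) (W 0) hgen hD (n := n) fun v hv k hk => by
    have h1 := hle hk (by simpa using hpowW k 0 v hv)
    rwa [hn, Submodule.mem_bot] at h1
  have hfac : ∀ k : ℕ, (k.factorial : Ω) ≠ 0 := fun k => Nat.cast_ne_zero.2 k.factorial_ne_zero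
  have hmem : ∀ c : Ω, (⟨((Polynomial.aeval c).restrictScalars K).comp P⟩ : Pt K A Ω) ∈
      flagSubgroup Ω W hW := by
    intro c k ψ hψ a ha
    let ev : Polynomial Ω →ₐ[K] Ω := (Polynomial.aeval c).restrictScalars K
    let C : Ω →ₐ[K] Polynomial Ω := (Algebra.ofId Ω (Polynomial Ω)).restrictScalars K
    have h1 : conv (C.toLinearMap ∘ₗ ψ) P.toLinearMap a = Polynomial.C (ψ a) := by
      ext j
      have h2 : (conv (C.toLinearMap ∘ₗ ψ) P.toLinearMap a).coeff j * (j.factorial : Ω) =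
          conv ψ (scal Ω ((Coalgebra.counit : A →ₗ[K] K) ∘ₗ (rAct D ^ j : Module.End K A))) a := by
        rw [conv_repr _ _ (Coalgebra.Repr.arbitrary K a),
          conv_repr _ _ (Coalgebra.Repr.arbitrary K a), Polynomial.finsetSum_coeff,
          Finset.sum_mul]
        refine Finset.sum_congr rfl fun i _ => ?_
        have h5 := hP j ((Coalgebra.Repr.arbitrary K a).right i)
        rw [scal_apply]
        change _ = _ * algebraMap K Ω (Coalgebra.counit ((rAct D ^ j : Module.End K A) _))
        rw [← h5, AlgHom.toLinearMap_apply, ← mul_assoc]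
        congr 1
        exact Polynomial.coeff_C_mul _
      rw [← comp_rAct, rAct_counit_comp, LinearMap.comp_apply] at h2
      apply mul_right_cancel₀ (hfac j)
      rw [h2]
      rcases j.eq_zero_or_pos with rfl | hj
      · simp
      · rw [Polynomial.coeff_C, if_neg hj.ne', zero_mul]
        exact hψ _ (hle (by omega) (hpowW j k a ha))
    have h3 := LinearMap.congr_fun (conv_comp ev (C.toLinearMap ∘ₗ ψ) P.toLinearMap) a
    have h4 : ev.toLinearMap ∘ₗ (C.toLinearMap ∘ₗ ψ) = ψ := by
      ext a
      simp [ev, C, Algebra.ofId_apply]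
    rw [LinearMap.comp_apply, h1, h4] at h3
    rw [LinearMap.sub_apply, sub_eq_zero]
    refine Eq.trans h3.symm ?_
    simp [ev]
  ext a
  have h1 : P a = Polynomial.C (algebraMap K Ω (Coalgebra.counit (R := K) a)) := by
    refine polynomial_eq_of_eval_natCast fun m => ?_
    have h2 := hmem (m : Ω)
    rw [hU, Subgroup.mem_bot] at h2
    have h3 := congrArg (fun t : Pt K A Ω => t.hom a) h2
    rw [Polynomial.eval_C, ← Polynomial.coe_aeval_eq_eval]
    exact h3
  have h2 := hP 1 a
  rw [h1, Polynomial.coeff_C, if_neg one_ne_zero, zero_mul, pow_one, counit_rAct] at h2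
  exact ((map_eq_zero (algebraMap K Ω)).1 h2.symm)

end FlagCurves

/-! ### The Lie algebra of a reductive group -/

section LieAlgebra

variable {K A : Type u} [Field K] [CommRing A] [HopfAlgebra K A]

theorem rAct_add (φ ψ : A →ₗ[K] K) : rAct (φ + ψ) = rAct φ + rAct ψ := by
  ext a
  simp [rAct_repr _ (Coalgebra.Repr.arbitrary K a), add_smul, Finset.sum_add_distrib]

theorem rAct_smul (c : K) (φ : A →ₗ[K] K) : rAct (c • φ) = c • rAct φ := by
  ext a
  simp [rAct_repr _ (Coalgebra.Repr.arbitrary K a), mul_smul, Finset.smul_sum]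

theorem rAct_sub (φ ψ : A →ₗ[K] K) : rAct (φ - ψ) = rAct φ - rAct ψ := by
  ext a
  simp [rAct_repr _ (Coalgebra.Repr.arbitrary K a), sub_smul, Finset.sum_sub_distrib]

theorem rAct_injective : Function.Injective (rAct : (A →ₗ[K] K) → A →ₗ[K] A) := by
  intro φ ψ h
  ext a
  rw [← counit_rAct, h, counit_rAct]

theorem counit_comp_derivation_mem (δ : Derivation K A A) :
    Coalgebra.counit ∘ₗ (δ : A →ₗ[K] A) ∈ pointDer K A := by
  intro a b
  simp [mul_comm]

variable (K A) in
/-- The Lie algebra of left invariant derivations of `A`. -/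
def lieAlg : LieSubalgebra K (Derivation K A A) where
  carrier := {δ | ∃ D ∈ pointDer K A, (δ : A →ₗ[K] A) = rAct D}
  zero_mem' := ⟨0, zero_mem _, by ext a; simp [rAct_repr _ (Coalgebra.Repr.arbitrary K a)]⟩
  add_mem' := by
    rintro δ δ' ⟨D, hD, h⟩ ⟨D', hD', h'⟩
    exact ⟨D + D', add_mem hD hD', by rw [rAct_add, ← h, ← h']; rfl⟩
  smul_mem' := by
    rintro c δ ⟨D, hD, h⟩
    exact ⟨c • D, Submodule.smul_mem _ c hD, by rw [rAct_smul, ← h]; rfl⟩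
  lie_mem' := by
    rintro δ δ' ⟨D, hD, h⟩ ⟨D', hD', h'⟩
    have h1 : ((⁅δ, δ'⁆ : Derivation K A A) : A →ₗ[K] A) = rAct (conv D D' - conv D' D) := by
      rw [rAct_sub, ← rAct_rAct, ← rAct_rAct, ← h, ← h']
      ext a
      exact Derivation.commutator_apply a
    refine ⟨_, ?_, h1⟩
    have h2 := counit_comp_derivation_mem ⁅δ, δ'⁆
    rw [h1] at h2
    convert h2 using 1
    ext a
    rw [LinearMap.comp_apply, counit_rAct]

/-- The left invariant derivation attached to a point derivation. -/
def invDer {D : A →ₗ[K] K} (hD : D ∈ pointDer K A) : lieAlg K A :=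
  ⟨Derivation.mk' (rAct D) fun a b => by
    rw [rAct_mul hD, smul_eq_mul, smul_eq_mul, mul_comm b], D, hD, rfl⟩

/-- The point derivation attached to a left invariant derivation. -/
def toPointDer : lieAlg K A →ₗ[K] pointDer K A where
  toFun δ := ⟨Coalgebra.counit ∘ₗ (δ.1 : A →ₗ[K] A), counit_comp_derivation_mem δ.1⟩
  map_add' δ δ' := by ext a; simp
  map_smul' c δ := by ext a; simp

theorem rAct_toPointDer (δ : lieAlg K A) : rAct (toPointDer δ).1 = (δ.1 : A →ₗ[K] A) := by
  obtain ⟨δ, D, hD, h⟩ := δ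
  have : (toPointDer ⟨δ, D, hD, h⟩).1 = D := by
    ext a
    change Coalgebra.counit ((δ : A →ₗ[K] A) a) = D a
    rw [h, counit_rAct]
  rw [this, h]

theorem toPointDer_invDer {D : A →ₗ[K] K} (hD : D ∈ pointDer K A) :
    (toPointDer (invDer hD)).1 = D :=
  rAct_injective (rAct_toPointDer _)

theorem toPointDer_injective : Function.Injective (toPointDer : lieAlg K A →ₗ[K] pointDer K A) := by
  intro δ δ' h
  apply Subtype.ext
  apply Derivation.coe_injective
  funext a
  have := rAct_toPointDer δ
  rw [h, rAct_toPointDer] at this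
  exact (LinearMap.congr_fun this a).symm

theorem toPointDer_lie (δ δ' : lieAlg K A) : (toPointDer ⁅δ, δ'⁆).1 =
    conv (toPointDer δ).1 (toPointDer δ').1 - conv (toPointDer δ').1 (toPointDer δ).1 := by
  apply rAct_injective
  rw [rAct_toPointDer, rAct_sub, ← rAct_rAct, ← rAct_rAct, rAct_toPointDer, rAct_toPointDer]
  ext a
  exact Derivation.commutator_apply a

instance [Algebra.FiniteType K A] : FiniteDimensional K (lieAlg K A) := by
  obtain ⟨s, f, hf⟩ := exists_pointDer_injective (K := K) (A := A)
  exact FiniteDimensional.of_injective (f ∘ₗ toPointDer (K := K) (A := A))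
    (hf.comp toPointDer_injective)

theorem isSubcomodule_of_stable [CharZero K] [Algebra.FiniteType K A]
    [ConnectedSpace (PrimeSpectrum A)]
    (X : Submodule K A) (hX : ∀ D ∈ pointDer K A, ∀ a ∈ X, rAct D a ∈ X) : IsSubcomodule X := by
  intro ψ a ha
  by_contra hne
  obtain ⟨φ, hφ, hle⟩ := Submodule.exists_le_ker_of_notMem hne
  apply hφ
  rw [apply_rAct, ← apply_lAct, rAct_mem_of_stable X hX φ (fun b hb => hle hb) ha, map_zero]

theorem exists_generating_subcomodule [Algebra.FiniteType K A] :
    ∃ V : Submodule K A, FiniteDimensional K V ∧ IsSubcomodule V ∧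
      Algebra.adjoin K (V : Set A) = ⊤ := by
  obtain ⟨s, hs⟩ := (‹Algebra.FiniteType K A›).out
  let R (a : A) : (A →ₗ[K] K) →ₗ[K] A :=
    { toFun := fun φ => rAct φ a
      map_add' := fun φ ψ => by rw [rAct_add]; rfl
      map_smul' := fun c φ => by rw [rAct_smul]; rfl }
  have hfin : ∀ a, FiniteDimensional K (LinearMap.range (R a)) := by
    intro a
    let r := Coalgebra.Repr.arbitrary K a
    have hle : LinearMap.range (R a) ≤ Submodule.span K (r.left '' r.index) := by
      rintro _ ⟨φ, rfl⟩
      change rAct φ a ∈ _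
      rw [rAct_repr φ r]
      exact Submodule.sum_mem _ fun i hi =>
        Submodule.smul_mem _ _ (Submodule.subset_span ⟨i, hi, rfl⟩)
    have : FiniteDimensional K (Submodule.span K (r.left '' r.index)) :=
      FiniteDimensional.span_of_finite K (r.index.finite_toSet.image _)
    exact Submodule.finiteDimensional_of_le hle
  refine ⟨⨆ a ∈ s, LinearMap.range (R a), ?_, ?_, ?_⟩
  · rw [← Finset.sup_eq_iSup]
    exact Submodule.finiteDimensional_finset_sup s fun a => LinearMap.range (R a)
  · intro φ a ha
    have : (⨆ a ∈ s, LinearMap.range (R a)) ≤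
        (⨆ a ∈ s, LinearMap.range (R a)).comap (rAct φ) := by
      refine iSup₂_le fun b hb => ?_
      rintro _ ⟨ψ, rfl⟩
      refine (le_iSup₂_of_le (f := fun a (_ : a ∈ s) => LinearMap.range (R a)) b hb le_rfl) ?_
      exact ⟨conv φ ψ, (LinearMap.congr_fun (rAct_rAct φ ψ) b).symm⟩
    exact this ha
  · rw [eq_top_iff, ← hs]
    refine Algebra.adjoin_mono fun a ha => ?_
    refine (le_iSup₂_of_le (f := fun a (_ : a ∈ s) => LinearMap.range (R a)) a ha le_rfl) ?_
    exact ⟨Coalgebra.counit, LinearMap.congr_fun rAct_counit a⟩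

theorem mem_lieDer_of_abCoord {D : A →ₗ[K] K} (hD : D ∈ pointDer K A)
    (h : ∀ c ∈ abCoord K A, D c = 0) : D ∈ lieDer K A := by
  refine ⟨hD, fun a ha => ?_⟩
  have hone := pointDer_one hD
  induction ha using Submodule.span_induction with
  | mem x hx =>
    obtain ⟨c, hc, rfl⟩ := hx
    rw [map_sub, h c hc, Algebra.algebraMap_eq_smul_one, map_smul, hone, smul_zero, sub_zero]
  | zero => exact map_zero D
  | add x y _ _ hx hy => rw [map_add, hx, hy, add_zero]
  | smul b x hx hx' =>
    have hε : Coalgebra.counit (R := K) x = 0 := by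
      have hle : derIdeal K A ≤ RingHom.ker (Bialgebra.counitAlgHom K A) := by
        refine Ideal.span_le.2 ?_
        rintro _ ⟨c, _, rfl⟩
        simp [RingHom.mem_ker]
      exact hle hx
    rw [smul_eq_mul, hD, hx', hε, mul_zero, mul_zero, add_zero]

theorem conv_comm_on_abCoord (f g : A →ₗ[K] K) {c : A} (hc : c ∈ abCoord K A) :
    conv f g c = conv g f c := by
  have hle : abCoord K A ≤ AlgHom.equalizer
      ((Algebra.TensorProduct.comm K A A).toAlgHom.comp (Bialgebra.comulAlgHom K A))
      (Bialgebra.comulAlgHom K A) := sSup_le fun C hC c hc => hC.2 c hc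
  have h1 : TensorProduct.comm K A A (Coalgebra.comul (R := K) c) = Coalgebra.comul c := hle hc
  have h2 : LinearMap.mul' K K ∘ₗ TensorProduct.map f g ∘ₗ (TensorProduct.comm K A A).toLinearMap =
      LinearMap.mul' K K ∘ₗ TensorProduct.map g f := by
    ext a b; simp [mul_comm]
  have h3 := LinearMap.congr_fun h2 (Coalgebra.comul (R := K) c)
  simp only [LinearMap.comp_apply, LinearEquiv.coe_coe, h1] at h3
  exact h3

/-- The Lie algebra of a reductive group is the sum of its center and of `𝔤^der`. -/
theorem exists_central_add_lieDer [CharZero K] (hG : IsSplitConnectedReductive K A)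
    {D : A →ₗ[K] K} (hD : D ∈ pointDer K A) :
    ∃ z ∈ pointDer K A, ∃ h ∈ lieDer K A, rAct z = lAct z ∧ D = z + h := by
  have := hG.smooth
  have := hG.connected
  have : Algebra.FiniteType K A := inferInstance
  obtain ⟨V, hVfin, hV, hgen⟩ := exists_generating_subcomodule (K := K) (A := A)
  let VL : LieSubmodule K (lieAlg K A) A :=
    { V with
      lie_mem := by
        rintro ⟨δ, D, hD, h⟩ v hv
        change (δ : A →ₗ[K] A) v ∈ V
        rw [h]
        exact hV D v hv }
  have : FiniteDimensional K VL := hVfin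
  have hmain := center_sup_derived_eq_top (K := K) (L := lieAlg K A) (V := VL) (by
    intro I hI
    rw [LieSubmodule.eq_bot_iff]
    intro δ hδ
    obtain ⟨n, hn⟩ := LieModule.IsNilpotent.nilpotent K I VL
    let W : ℕ → Submodule K A := fun k => (I.lcs VL k).toSubmodule.map VL.toSubmodule.subtype
    have hW : ∀ k, IsSubcomodule (W k) := by
      intro k
      refine isSubcomodule_of_stable _ fun D hD a ha => ?_
      obtain ⟨v, hv, rfl⟩ := ha
      exact ⟨Bracket.bracket (M := VL) (invDer hD) v, (I.lcs VL k).lie_mem hv, rfl⟩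
    have hsucc : ∀ k, I.lcs VL (k + 1) = ⁅I, I.lcs VL k⁆ := fun k => I.lcs_succ VL k
    have h0 : W 0 = V := by
      change Submodule.map _ (I.lcs VL 0).toSubmodule = V
      rw [LieIdeal.lcs_zero, LieSubmodule.top_toSubmodule, Submodule.map_top,
        Submodule.range_subtype]
    have hanti : ∀ k, W (k + 1) ≤ W k := by
      intro k
      refine Submodule.map_mono ?_
      rw [hsucc]
      exact LieSubmodule.lie_le_right (I.lcs VL k) I
    have hbot : W n = ⊥ := by
      change Submodule.map _ (I.lcs VL n).toSubmodule = ⊥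
      have hn' : (I.lcs VL n).toSubmodule = ⊥ := by
        rw [LieIdeal.coe_lcs_eq, hn, LieSubmodule.bot_toSubmodule]
      rw [hn', Submodule.map_bot]
    have hgen' : Algebra.adjoin K (W 0 : Set A) = ⊤ := by rw [h0, hgen]
    have hU := hG.reductive (flagSubgroup _ W hW) (flagSubgroup_isClosed W hW)
      (flagSubgroup_isConnected W hW hbot hgen') (flagSubgroup_normal W hW)
      (fun u hu => flagSubgroup_isUnipotent W hW hbot hgen' hu)
    have hzero := eq_zero_of_lowers_flag W hW hanti hbot hgen' hU (toPointDer δ).2 (by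
      rintro k _ ⟨v, hv, rfl⟩
      rw [rAct_toPointDer]
      refine ⟨Bracket.bracket (M := VL) δ v, ?_, rfl⟩
      rw [hsucc]
      exact LieSubmodule.lie_mem_lie (M := VL) (N := I.lcs VL k) hδ hv)
    exact toPointDer_injective (Subtype.ext (by rw [hzero, map_zero]; rfl)))
  have hx : invDer hD ∈ (⊤ : Submodule K (lieAlg K A)) := trivial
  rw [← hmain] at hx
  obtain ⟨z, hz, h, hh, hzh⟩ := Submodule.mem_sup.1 hx
  have hlin : D = (toPointDer z).1 + (toPointDer h).1 := by
    rw [← toPointDer_invDer hD, ← hzh, map_add]; rfl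
  clear hzh
  refine ⟨(toPointDer z).1, (toPointDer z).2, (toPointDer h).1, ?_, ?_, hlin⟩
  · clear hlin
    refine mem_lieDer_of_abCoord (toPointDer h).2 fun c hc => ?_
    rw [LieSubmodule.mem_toSubmodule, ← LieSubmodule.mem_toSubmodule,
      LieSubmodule.lieIdeal_oper_eq_linear_span'] at hh
    induction hh using Submodule.span_induction with
    | mem x hx =>
      obtain ⟨x, -, y, -, rfl⟩ := hx
      rw [toPointDer_lie, LinearMap.sub_apply, conv_comm_on_abCoord _ _ hc, sub_self]
    | zero => rw [map_zero]; rfl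
    | add x y _ _ hx hy =>
      rw [map_add]
      change (toPointDer x).1 c + (toPointDer y).1 c = 0
      rw [hx, hy, add_zero]
    | smul r x _ hx =>
      rw [map_smul]
      change r • (toPointDer x).1 c = 0
      rw [hx, smul_zero]
  · refine rAct_eq_lAct_of_commute _ fun E hE => ?_
    have h1 : ⁅invDer hE, z⁆ = 0 := (LieModule.mem_maxTrivSubmodule K _ _ z).1 hz _
    have h2 := toPointDer_lie (invDer hE) z
    rw [h1, map_zero, toPointDer_invDer] at h2
    exact (sub_eq_zero.1 h2.symm)

end LieAlgebra

/-! ### Morphisms of deformations from sections -/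

section Sections

variable {K A Γ : Type u} [Field K] [CommRing A] [HopfAlgebra K A] [Group Γ]
  {N : ℕ} {ρ₀ : Γ →* Pt K A K} {γ : Fin N → Γ} {𝒦 : Fin N → ConjClass K A}
  {R R' : Type u} [CommRing R] [Algebra K R] [CommRing R'] [Algebra K R']
  {aug : R →ₐ[K] K} {aug' : R' →ₐ[K] K}

/-- The identification of the special fibre of a deformation with the adjoint group. -/
def Deformation.toQ (X : Deformation ρ₀ γ 𝒦 R aug) : X.obj.B →ₐ[K] adCoord K A := X.mark

theorem Deformation.isMark (X : Deformation ρ₀ γ 𝒦 R aug) :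
    X.obj.toTorsor.IsMark aug X.toQ :=
  ⟨X.mark_isHom.over_base, X.mark_isHom.equivariant⟩

/-- `s` is a point of the torsor of `X` over `φ : R → R'` that extends the base point. -/
structure Deformation.IsSection (X : Deformation ρ₀ γ 𝒦 R aug) (aug' : R' →ₐ[K] K)
    (φ : R →ₐ[K] R') (s : X.obj.B →ₐ[K] R') : Prop where
  comp_p : s.comp X.obj.p = φ
  aug_comp : aug'.comp s = (LocObj.basePt ρ₀).comp X.mark

theorem Deformation.IsSection.ofId_comp {S : Type u} [CommRing S] [Algebra K S]
    {X : Deformation ρ₀ γ 𝒦 R aug} {φ : R →ₐ[K] R'}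
    {s : X.obj.B →ₐ[K] R'} (hs : X.IsSection aug' φ s) :
    ((Algebra.ofId K S).comp aug').comp s = X.obj.toTorsor.base X.toQ S := by
  rw [AlgHom.comp_assoc, hs.aug_comp]
  rfl

theorem Torsor.equivariant_of_act {Q : Type u} [CommRing Q] [HopfAlgebra K Q]
    (E : Torsor K Q R) (E' : Torsor K Q R') (h : E.B →ₐ[K] E'.B)
    (H : ∀ (S : Type u) [CommRing S] [Algebra K S] (g : Pt K Q S) (e : E'.B →ₐ[K] S),
      (E'.act g e).comp h = E.act g (e.comp h)) :
    E'.coact.comp h = (Algebra.TensorProduct.map (AlgHom.id K Q) h).comp E.coact := by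
  have h1 := H (Q ⊗[K] E'.B) ⟨Algebra.TensorProduct.includeLeft⟩ Algebra.TensorProduct.includeRight
  have h2 : E'.act (⟨Algebra.TensorProduct.includeLeft⟩ : Pt K Q (Q ⊗[K] E'.B))
      Algebra.TensorProduct.includeRight = E'.coact := by
    rw [Torsor.act]
    have h3 : Algebra.TensorProduct.lift (Algebra.TensorProduct.includeLeft : Q →ₐ[K] Q ⊗[K] E'.B)
        Algebra.TensorProduct.includeRight (fun _ _ => .all _ _) = AlgHom.id K _ := by
      ext <;> simp
    change (Algebra.TensorProduct.lift _ _ _).comp _ = _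
    rw [h3]; rfl
  rw [h2] at h1
  rw [h1, Torsor.act]
  congr 1
  ext <;> simp

theorem Deformation.exists_isHom_of_sections {φ : R →ₐ[K] R'} (haug : aug'.comp φ = aug)
    {X : Deformation ρ₀ γ 𝒦 R aug} {X' : Deformation ρ₀ γ 𝒦 R' aug'}
    {s : X.obj.B →ₐ[K] R} {s' : X'.obj.B →ₐ[K] R'} (hs : X.IsSection aug (AlgHom.id K R) s)
    (hs' : X'.IsSection aug' (AlgHom.id K R') s')
    (hρ : ∀ δ, Pt.map s' (X'.obj.ρ δ) = Pt.map (φ.comp s) (X.obj.ρ δ)) :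
    ∃ h : X.obj.B →ₐ[K] X'.obj.B, LocObj.IsHom φ X.obj X'.obj h ∧ X'.mark.comp h = X.mark ∧
      s'.comp h = φ.comp s := by
  subst haug
  have h0 : (X'.obj.p.comp s').comp X'.obj.p = (AlgHom.id K X'.obj.B).comp X'.obj.p := by
    rw [AlgHom.comp_assoc, hs'.comp_p]; rfl
  obtain ⟨g, hg⟩ := X'.obj.exists_act_eq _ _ h0
  have hgS : ∀ {S : Type u} [CommRing S] [Algebra K S] (e : X'.obj.B →ₐ[K] S),
      X'.obj.act (Pt.map e g) ((e.comp X'.obj.p).comp s') = e := by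
    intro S _ _ e
    rw [AlgHom.comp_assoc, ← X'.obj.comp_act, hg]; rfl
  let h : X.obj.B →ₐ[K] X'.obj.B := X.obj.act g (X'.obj.p.comp (φ.comp s))
  have hh : ∀ {S : Type u} [CommRing S] [Algebra K S] (e : X'.obj.B →ₐ[K] S),
      e.comp h = X.obj.act (Pt.map e g) ((e.comp X'.obj.p).comp (φ.comp s)) := by
    intro S _ _ e
    rw [X.obj.comp_act, AlgHom.comp_assoc]
  refine ⟨h, ⟨?_, ?_, ?_⟩, ?_, ?_⟩
  · rw [X.obj.act_comp_p, AlgHom.comp_assoc, AlgHom.comp_assoc, hs.comp_p]; rfl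
  · refine X.obj.equivariant_of_act X'.obj.toTorsor h ?_
    intro S _ _ g₁ e
    have h1 : Pt.map (X'.obj.act g₁ e) g = g₁ * Pt.map e g := by
      apply X'.obj.act_injective ((e.comp X'.obj.p).comp s')
      change X'.obj.act _ _ = X'.obj.act _ _
      rw [X'.obj.act_mul, hgS e, ← X'.obj.act_comp_p g₁ e, hgS]
    rw [hh, hh, h1, X'.obj.act_comp_p, X.obj.act_mul]
  · intro δ
    rw [X.obj.map_act, ← Pt.map_map, ← hρ, Pt.map_map, ← X'.obj.map_act, hg]; rfl
  · have h1 : Pt.map X'.toQ g = Pt.univ K (adCoord K A) := by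
      apply X'.obj.act_injective (X'.obj.toTorsor.base X'.toQ (adCoord K A))
      change X'.obj.act _ _ = X'.obj.act _ _
      refine Eq.trans ?_ (X'.isMark.act_base _).symm
      rw [← hs'.ofId_comp]
      have := hgS X'.toQ
      rw [X'.isMark.over_base] at this
      exact this
    change X'.toQ.comp h = X.toQ
    rw [hh]
    have h2 : (X'.toQ.comp X'.obj.p).comp (φ.comp s) =
        X.obj.toTorsor.base X.toQ (adCoord K A) := by
      rw [X'.isMark.over_base, ← hs.ofId_comp]; rfl
    have h3 := X.isMark.act_base (Pt.univ K (adCoord K A))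
    refine Eq.trans ?_ h3
    rw [← h1, ← h2]
  · have h1 : Pt.map s' g = 1 := by
      apply X'.obj.act_injective s'
      change X'.obj.act _ _ = X'.obj.act _ _
      rw [X'.obj.act_one]
      have := hgS s'
      rw [hs'.comp_p] at this
      exact this
    rw [hh, h1, X.obj.act_one, hs'.comp_p]; rfl

theorem Deformation.isPullback_of_sections {φ : R →ₐ[K] R'} (haug : aug'.comp φ = aug)
    {X : Deformation ρ₀ γ 𝒦 R aug} {X' : Deformation ρ₀ γ 𝒦 R' aug'}
    {s : X.obj.B →ₐ[K] R} {s' : X'.obj.B →ₐ[K] R'} (hs : X.IsSection aug (AlgHom.id K R) s)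
    (hs' : X'.IsSection aug' (AlgHom.id K R') s')
    (hρ : ∀ δ, Pt.map s' (X'.obj.ρ δ) = Pt.map (φ.comp s) (X.obj.ρ δ)) : X.IsPullback φ X' := by
  obtain ⟨h, h1, h2, -⟩ := exists_isHom_of_sections haug hs hs' hρ
  exact ⟨h, h1, h2⟩

/-- An equivariant endomorphism of a torsor that fixes a section is the identity. -/
theorem Torsor.eq_id_of_fixes_section {Q : Type u} [CommRing Q] [HopfAlgebra K Q]
    (E : Torsor K Q R) {s : E.B →ₐ[K] R} (hs : s.comp E.p = AlgHom.id K R) (k : E.B →ₐ[K] E.B)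
    (hk : E.coact.comp k = (Algebra.TensorProduct.map (AlgHom.id K Q) k).comp E.coact)
    (hsk : s.comp k = s) : k = AlgHom.id K E.B := by
  have h0 : (E.p.comp s).comp E.p = (AlgHom.id K E.B).comp E.p := by
    rw [AlgHom.comp_assoc, hs]; rfl
  obtain ⟨g, hg⟩ := E.exists_act_eq _ _ h0
  have h1 := E.act_comp_of_equivariant E k hk g (E.p.comp s)
  rw [AlgHom.comp_assoc, hsk, hg] at h1
  exact h1

theorem LocObj.IsHom.equivariant_comp {θ : Γ → (abCoord K A →ₐ[K] K)} {X X' X'' : LocObj θ R}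
    {φ φ' : R →ₐ[K] R} {h : X.B →ₐ[K] X'.B} {h' : X'.B →ₐ[K] X''.B}
    (hh : LocObj.IsHom φ X X' h) (hh' : LocObj.IsHom φ' X' X'' h') :
    X''.coact.comp (h'.comp h) =
      (Algebra.TensorProduct.map (AlgHom.id K _) (h'.comp h)).comp X.coact := by
  rw [← AlgHom.comp_assoc, hh'.equivariant, AlgHom.comp_assoc, hh.equivariant, ← AlgHom.comp_assoc,
    ← Algebra.TensorProduct.map_comp]
  rfl

theorem Deformation.iso_of_sections {X X' : Deformation ρ₀ γ 𝒦 R aug}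
    {s : X.obj.B →ₐ[K] R} {s' : X'.obj.B →ₐ[K] R} (hs : X.IsSection aug (AlgHom.id K R) s)
    (hs' : X'.IsSection aug (AlgHom.id K R) s')
    (hρ : ∀ δ, Pt.map s' (X'.obj.ρ δ) = Pt.map s (X.obj.ρ δ)) : X.Iso X' := by
  obtain ⟨h, h1, h2, h3⟩ := exists_isHom_of_sections (φ := AlgHom.id K R) rfl hs hs' hρ
  obtain ⟨k, k1, k2, k3⟩ := exists_isHom_of_sections (φ := AlgHom.id K R) rfl hs' hs
    (fun δ => (hρ δ).symm)
  rw [AlgHom.id_comp] at h3 k3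
  have e1 := X.obj.eq_id_of_fixes_section hs.comp_p (k.comp h) (h1.equivariant_comp k1)
    (by rw [← AlgHom.comp_assoc, k3, h3])
  have e2 := X'.obj.eq_id_of_fixes_section hs'.comp_p (h.comp k) (k1.equivariant_comp h1)
    (by rw [← AlgHom.comp_assoc, h3, k3])
  exact ⟨AlgEquiv.ofAlgHom h k e2 e1, h1, h2⟩

/-- A section of a pullback induces a point of the original torsor. -/
theorem Deformation.IsSection.comp_isHom {R'' : Type u} [CommRing R''] [Algebra K R'']
    {aug'' : R'' →ₐ[K] K} {φ : R →ₐ[K] R'} {ψ : R' →ₐ[K] R''}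
    {X : Deformation ρ₀ γ 𝒦 R aug} {X' : Deformation ρ₀ γ 𝒦 R' aug'}
    {h : X.obj.B →ₐ[K] X'.obj.B} (hh : LocObj.IsHom φ X.obj X'.obj h)
    (hm : X'.mark.comp h = X.mark) {s : X'.obj.B →ₐ[K] R''} (hs : X'.IsSection aug'' ψ s) :
    X.IsSection aug'' (ψ.comp φ) (s.comp h) := by
  refine ⟨?_, ?_⟩
  · rw [AlgHom.comp_assoc, hh.over_base, ← AlgHom.comp_assoc, hs.comp_p]
  · rw [← AlgHom.comp_assoc, hs.aug_comp, AlgHom.comp_assoc, hm]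

theorem Deformation.IsSection.comp {R'' : Type u} [CommRing R''] [Algebra K R'']
    {aug'' : R'' →ₐ[K] K} {φ : R →ₐ[K] R'} {X : Deformation ρ₀ γ 𝒦 R aug}
    {s : X.obj.B →ₐ[K] R'} (hs : X.IsSection aug' φ s) (ψ : R' →ₐ[K] R'')
    (hψ : aug''.comp ψ = aug') : X.IsSection aug'' (ψ.comp φ) (ψ.comp s) :=
  ⟨by rw [AlgHom.comp_assoc, hs.comp_p], by rw [← AlgHom.comp_assoc, hψ, hs.aug_comp]⟩

theorem Deformation.IsSection.exists_act {φ : R →ₐ[K] R'} {X : Deformation ρ₀ γ 𝒦 R aug}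
    {s s' : X.obj.B →ₐ[K] R'} (hs : X.IsSection aug' φ s) (hs' : X.IsSection aug' φ s') :
    ∃ t : Pt K (adCoord K A) R', Pt.map aug' t = 1 ∧
      ∀ δ, Pt.map s' (X.obj.ρ δ) = adAct t (Pt.map s (X.obj.ρ δ)) := by
  obtain ⟨t, ht⟩ := X.obj.exists_act_eq s s' (by rw [hs.comp_p, hs'.comp_p])
  refine ⟨t, ?_, fun δ => by rw [← ht, X.obj.map_act]⟩
  apply X.obj.act_injective (aug'.comp s)
  change X.obj.act _ _ = X.obj.act _ _
  rw [X.obj.act_one, ← X.obj.comp_act, ht, hs.aug_comp, hs'.aug_comp]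

theorem Deformation.IsSection.map_aug {φ : R →ₐ[K] R'} {X : Deformation ρ₀ γ 𝒦 R aug}
    {s : X.obj.B →ₐ[K] R'} (hs : X.IsSection aug' φ s) (δ : Γ) :
    Pt.map aug' (Pt.map s (X.obj.ρ δ)) = ρ₀ δ := by
  rw [Pt.map_map, hs.aug_comp, ← Pt.map_map, X.mark_isHom.rep]
  have h := map_toAd_orbitPt (ρ₀ δ) (1 : Pt K A K)
  rw [one_mul, inv_one, mul_one] at h
  exact h

end Sections

/-! ### Deformations from representations -/

section Construction

variable {K Q R S : Type u} [Field K] [CommRing Q] [HopfAlgebra K Q] [CommRing R] [Algebra K R]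
  [CommRing S] [Algebra K S]

variable (K Q R) in
/-- The structure morphism of the trivial torsor over `Spec R`. -/
def inR : R →ₐ[K] R ⊗[K] Q := Algebra.TensorProduct.includeLeft

variable (K Q R) in
/-- The projection of the trivial torsor over `Spec R` to the group. -/
def inQ : Pt K Q (R ⊗[K] Q) := ⟨Algebra.TensorProduct.includeRight⟩

/-- The point of the trivial torsor given by a point of the base and a point of the group. -/
def pairHom (f : R →ₐ[K] S) (x : Pt K Q S) : R ⊗[K] Q →ₐ[K] S :=
  Algebra.TensorProduct.lift f x.hom (fun _ _ => .all _ _)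

@[simp] theorem pairHom_comp_inR (f : R →ₐ[K] S) (x : Pt K Q S) :
    (pairHom f x).comp (inR K Q R) = f :=
  Algebra.TensorProduct.lift_comp_includeLeft _ _ _

@[simp] theorem map_pairHom_inQ (f : R →ₐ[K] S) (x : Pt K Q S) :
    Pt.map (pairHom f x) (inQ K Q R) = x := by
  ext q
  simp [pairHom, inQ]

theorem pairHom_ext {e e' : R ⊗[K] Q →ₐ[K] S} (h1 : e.comp (inR K Q R) = e'.comp (inR K Q R))
    (h2 : Pt.map e (inQ K Q R) = Pt.map e' (inQ K Q R)) : e = e' :=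
  Algebra.TensorProduct.ext h1 (congrArg Pt.hom h2)

variable (K Q R) in
/-- The comorphism of the action of `H = Spec Q` on the trivial torsor over `R`. -/
def trivialCoact : R ⊗[K] Q →ₐ[K] Q ⊗[K] (R ⊗[K] Q) :=
  pairHom (Algebra.TensorProduct.includeRight.comp (inR K Q R))
    (⟨Algebra.TensorProduct.includeLeft⟩ * Pt.map Algebra.TensorProduct.includeRight (inQ K Q R))

theorem lift_trivialCoact (g : Pt K Q S) (e : R ⊗[K] Q →ₐ[K] S) :
    (Algebra.TensorProduct.lift g.hom e (fun _ _ => .all _ _)).comp (trivialCoact K Q R) =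
      pairHom (e.comp (inR K Q R)) (g * Pt.map e (inQ K Q R)) := by
  have hR : (Algebra.TensorProduct.lift g.hom e (fun _ _ => .all _ _)).comp
      Algebra.TensorProduct.includeRight = e := by
    ext <;> simp
  apply pairHom_ext
  · rw [pairHom_comp_inR, AlgHom.comp_assoc, trivialCoact, pairHom_comp_inR, ← AlgHom.comp_assoc,
      hR]
  · rw [map_pairHom_inQ, ← Pt.map_map, trivialCoact, map_pairHom_inQ, map_mul, Pt.map_map, hR]
    congr 1
    ext q
    simp

variable (K Q R) in
/-- The trivial torsor over `Spec R`. -/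
def Torsor.trivialOver : Torsor K Q R where
  B := R ⊗[K] Q
  p := inR K Q R
  faithfullyFlat := by
    have : Nontrivial Q := (Bialgebra.counitAlgHom K Q).toRingHom.domain_nontrivial
    have h : Module.FaithfullyFlat R (R ⊗[K] Q) := inferInstance
    exact RingHom.faithfullyFlat_algebraMap_iff.2 h
  coact := trivialCoact K Q R
  one_act S _ _ e := by
    rw [lift_trivialCoact, one_mul]
    exact pairHom_ext (pairHom_comp_inR _ _) (map_pairHom_inQ _ _)
  mul_act S _ _ g h e := by
    rw [lift_trivialCoact, lift_trivialCoact h, lift_trivialCoact, mul_assoc, pairHom_comp_inR,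
      map_pairHom_inQ]
  act_over S _ _ g e := by
    rw [lift_trivialCoact, pairHom_comp_inR]
  simplyTransitive S _ _ e e' hee := by
    refine ⟨Pt.map e' (inQ K Q R) * (Pt.map e (inQ K Q R))⁻¹, ?_, fun g hg => ?_⟩
    · change (Algebra.TensorProduct.lift _ _ _).comp (trivialCoact K Q R) = e'
      rw [lift_trivialCoact, inv_mul_cancel_right]
      apply pairHom_ext
      · rw [pairHom_comp_inR, hee]
      · rw [map_pairHom_inQ]
    · change (Algebra.TensorProduct.lift _ _ _).comp (trivialCoact K Q R) = e' at hg
      rw [lift_trivialCoact] at hg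
      rw [← hg, map_pairHom_inQ, mul_inv_cancel_right]

theorem Torsor.trivialOver_act (g : Pt K Q S) (e : R ⊗[K] Q →ₐ[K] S) :
    (Torsor.trivialOver K Q R).act g e = pairHom (e.comp (inR K Q R)) (g * Pt.map e (inQ K Q R)) :=
  lift_trivialCoact g e

variable (Q) in
/-- The special fibre of the trivial torsor over an augmented algebra. -/
def specialFibre (aug : R →ₐ[K] K) : R ⊗[K] Q →ₐ[K] Q :=
  pairHom ((Algebra.ofId K _).comp aug) (Pt.univ K Q)

theorem comp_specialFibre (aug : R →ₐ[K] K) (x : Pt K Q S) :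
    x.hom.comp (specialFibre Q aug) = pairHom ((Algebra.ofId K S).comp aug) x := by
  apply pairHom_ext
  · rw [pairHom_comp_inR, AlgHom.comp_assoc, specialFibre, pairHom_comp_inR, ← AlgHom.comp_assoc,
      Subsingleton.elim (x.hom.comp (Algebra.ofId K Q)) (Algebra.ofId K S)]
  · rw [map_pairHom_inQ, ← Pt.map_map, specialFibre, map_pairHom_inQ]; rfl

theorem specialFibre_equivariant (aug : R →ₐ[K] K) :
    (Torsor.trivial K Q).coact.comp (specialFibre Q aug) =
      (Algebra.TensorProduct.map (AlgHom.id K Q) (specialFibre Q aug)).comp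
        (Torsor.trivialOver K Q R).coact := by
  refine Torsor.equivariant_of_act (Torsor.trivialOver K Q R)
    (Torsor.trivial K Q) (specialFibre Q aug) fun S _ _ g e => ?_
  have h1 := comp_specialFibre aug (g * (⟨e⟩ : Pt K Q S))
  have h2 := comp_specialFibre aug (⟨e⟩ : Pt K Q S)
  refine h1.trans ?_
  refine Eq.trans ?_ (congrArg (fun t => (Torsor.trivialOver K Q R).act g t) h2).symm
  refine Eq.trans ?_ (Torsor.trivialOver_act g _).symm
  rw [pairHom_comp_inR, map_pairHom_inQ]

end Construction

section ConstructionRep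

variable {K A Γ : Type u} [Field K] [CommRing A] [HopfAlgebra K A] [Group Γ]
  {R S : Type u} [CommRing R] [Algebra K R] [CommRing S] [Algebra K S]

theorem Pt.map_ab (φ : R →ₐ[K] S) (x : Pt K A R) : (Pt.map φ x).ab = φ.comp x.ab := rfl

/-- The representation over the trivial torsor attached to a representation over `R`. -/
def orbitRep (r : Γ →* Pt K A R) : Γ →* Pt K A (R ⊗[K] adCoord K A) :=
  (adActEquiv (inQ K (adCoord K A) R)).toMonoidHom.comp ((Pt.map (inR K (adCoord K A) R)).comp r)

theorem orbitRep_apply (r : Γ →* Pt K A R) (δ : Γ) : orbitRep r δ =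
    adAct (inQ K (adCoord K A) R) (Pt.map (inR K (adCoord K A) R) (r δ)) :=
  rfl

theorem map_orbitRep (r : Γ →* Pt K A R) (e : R ⊗[K] adCoord K A →ₐ[K] S) (δ : Γ) :
    Pt.map e (orbitRep r δ) = adAct (Pt.map e (inQ K (adCoord K A) R))
      (Pt.map (e.comp (inR K (adCoord K A) R)) (r δ)) := by
  rw [orbitRep_apply, map_adAct, Pt.map_map]

theorem map_pairHom_orbitRep (r : Γ →* Pt K A R) (f : R →ₐ[K] S) (x : Pt K (adCoord K A) S)
    (δ : Γ) : Pt.map (pairHom f x) (orbitRep r δ) = adAct x (Pt.map f (r δ)) := by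
  rw [map_orbitRep, map_pairHom_inQ, pairHom_comp_inR]

theorem orbitRep_equivariant (r : Γ →* Pt K A R) (g : Pt K A S) (e : R ⊗[K] adCoord K A →ₐ[K] S)
    (δ : Γ) : Pt.map (pairHom (e.comp (inR K (adCoord K A) R))
      (toAd g * Pt.map e (inQ K (adCoord K A) R))) (orbitRep r δ) =
        g * Pt.map e (orbitRep r δ) * g⁻¹ := by
  rw [map_pairHom_orbitRep, adAct_toAd_mul, ← map_orbitRep]

theorem map_specialFibre_orbitRep (r : Γ →* Pt K A R) {aug : R →ₐ[K] K} {x : Pt K A K} {δ : Γ}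
    (hr : Pt.map aug (r δ) = x) :
    Pt.map (specialFibre (adCoord K A) aug) (orbitRep r δ) = orbitPt x := by
  rw [specialFibre, map_pairHom_orbitRep, ← Pt.map_map, hr, ← map_orbitPt]
  rfl

/-- The object over `Spec R` given by the trivial torsor and a representation over `R`. -/
def LocObj.ofRepOver {θ : Γ → (abCoord K A →ₐ[K] K)} (r : Γ →* Pt K A R)
    (hr : ∀ δ, (r δ).ab = (Algebra.ofId K R).comp (θ δ)) : LocObj θ R where
  toTorsor := Torsor.trivialOver K (adCoord K A) R
  ρ := orbitRep r
  ab_eq δ := by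
    change (orbitRep r δ).ab = _
    rw [orbitRep_apply, adAct_ab, Pt.map_ab, hr, ← AlgHom.comp_assoc]
    congr 1
  equivariant S _ _ g e δ := by
    refine (congrArg (fun t => Pt.map t (orbitRep r δ)) (Torsor.trivialOver_act _ e)).trans ?_
    exact orbitRep_equivariant r g e δ

theorem exists_deformation [Algebra.FiniteType K A] [IsDomain A] {N : ℕ} {ρ₀ : Γ →* Pt K A K}
    {γ : Fin N → Γ} {𝒦 : Fin N → ConjClass K A} (hirr : IsGIrreducible ρ₀)
    (hconj : ∀ i, (𝒦 i).Mem (ρ₀ (γ i))) {aug : R →ₐ[K] K}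
    (hnil : ∀ x, aug x = 0 → IsNilpotent x) (r : Γ →* Pt K A R)
    (hab : ∀ δ, (r δ).ab = (Algebra.ofId K R).comp (abelianization ρ₀ δ))
    (hr : ∀ δ, Pt.map aug (r δ) = ρ₀ δ)
    (hrγ : ∀ i, ∃ g : Pt K A R, r (γ i) = g * Pt.map (Algebra.ofId K R) (ρ₀ (γ i)) * g⁻¹) :
    ∃ (X : Deformation ρ₀ γ 𝒦 R aug) (s : X.obj.B →ₐ[K] R),
      X.IsSection aug (AlgHom.id K R) s ∧ ∀ δ, Pt.map s (X.obj.ρ δ) = r δ := by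
  have hmod : (LocObj.ofRepOver r hab).InModuli γ 𝒦 := by
    refine ⟨?_, fun i => ?_⟩
    · refine hirr.of_adAct (orbitRep r) fun Ω _ _ t => ⟨Pt.map t (inQ K (adCoord K A) R),
        fun δ => ?_⟩
      have ht : t.comp (inR K (adCoord K A) R) = (Algebra.ofId K Ω).comp aug := by
        ext x
        have h1 := (hnil (x - algebraMap K R (aug x)) (by simp)).map
          (t.comp (inR K (adCoord K A) R))
        have h2 := h1.eq_zero
        rw [map_sub, sub_eq_zero, AlgHom.commutes] at h2
        exact h2
      rw [map_orbitRep, ht, ← Pt.map_map, hr]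
    · obtain ⟨g, hg⟩ := hrγ i
      change (𝒦 i).Mem (orbitRep r (γ i))
      rw [orbitRep_apply, hg, map_mul, map_mul, map_inv, Pt.map_ofId, ← adAct_toAd, ← adAct_mul]
      exact ConjClass.mem_adAct (hconj i) _
  have hmark : LocObj.IsHom aug (LocObj.ofRepOver r hab) (LocObj.ofRep ρ₀)
      (specialFibre (adCoord K A) aug) :=
    ⟨pairHom_comp_inR _ _, specialFibre_equivariant aug,
      fun δ => map_specialFibre_orbitRep r (hr δ)⟩
  refine ⟨⟨LocObj.ofRepOver r hab, hmod, _, hmark⟩, pairHom (AlgHom.id K R) 1,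
    ⟨?_, ?_⟩, fun δ => ?_⟩
  · exact pairHom_comp_inR _ _
  · change aug.comp (pairHom (AlgHom.id K R) 1) =
      (Bialgebra.counitAlgHom K (adCoord K A)).comp (specialFibre (adCoord K A) aug)
    refine Eq.trans ?_ (comp_specialFibre aug (1 : Pt K (adCoord K A) K)).symm
    apply pairHom_ext
    · rw [AlgHom.comp_assoc, pairHom_comp_inR, pairHom_comp_inR]
      ext; simp
    · rw [← Pt.map_map, map_pairHom_inQ, map_pairHom_inQ, map_one]
  · refine (map_pairHom_orbitRep r _ _ δ).trans ?_
    rw [adAct_one]; rfl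

end ConstructionRep

/-! ### Cocycles with values in `𝔤^der` and lifts to the dual numbers -/

section Exponential

variable {K A : Type u} [Field K] [CommRing A] [HopfAlgebra K A]

theorem conv_one_right (f : A →ₗ[K] K) : conv f (1 : Pt K A K).hom.toLinearMap = f := conv_counit f

theorem conv_one_left (f : A →ₗ[K] K) : conv (1 : Pt K A K).hom.toLinearMap f = f := counit_conv f

theorem expPt_mul {D D' : A →ₗ[K] K} (hD : D ∈ pointDer K A) (hD' : D' ∈ pointDer K A) :
    expPt hD * expPt hD' = expPt (add_mem hD hD') := by
  apply Pt.dual_ext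
  · rw [Pt.fst_mul, expPt_fst, expPt_fst, expPt_fst, mul_one]
  · rw [Pt.snd_mul, expPt_fst, expPt_fst, expPt_snd, expPt_snd, expPt_snd, conv_one_left,
      conv_one_right, add_comm]

theorem expPt_commute_of_central {z : A →ₗ[K] K} (hz : z ∈ pointDer K A)
    (hc : rAct z = lAct z) (y : Pt K A (DualNumber K)) : Commute (expPt hz) y := by
  apply Pt.dual_ext
  · rw [Pt.fst_mul, Pt.fst_mul, expPt_fst, mul_one, one_mul]
  · have h : conv z y.fst.hom.toLinearMap = conv y.fst.hom.toLinearMap z := by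
      ext a
      rw [← apply_lAct, ← apply_rAct, hc]
    rw [Pt.snd_mul, Pt.snd_mul, expPt_fst, expPt_snd, conv_one_left, conv_one_right, h, add_comm]

/-- The point `1 + ε h` of `G` over the dual numbers, for `h ∈ 𝔤^der`. -/
def derExp (h : lieDer K A) : Pt K A (DualNumber K) := expPt (lieDer_le_pointDer h.2)

@[simp] theorem derExp_fst (h : lieDer K A) : (derExp h).fst = 1 := expPt_fst _

@[simp] theorem derExp_snd (h : lieDer K A) : (derExp h).snd = h.1 := expPt_snd _

theorem derExp_add (h h' : lieDer K A) : derExp (h + h') = derExp h * derExp h' :=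
  (expPt_mul _ _).symm

theorem derExp_injective : Function.Injective (derExp : lieDer K A → Pt K A (DualNumber K)) := by
  intro h h' e
  apply Subtype.ext
  rw [← derExp_snd, e, derExp_snd]

theorem derExp_zero : derExp (0 : lieDer K A) = 1 := by
  have h := derExp_add (0 : lieDer K A) 0
  rw [add_zero] at h
  exact (mul_eq_left.1 h.symm)

theorem derExp_neg (h : lieDer K A) : derExp (-h) = (derExp h)⁻¹ := by
  rw [eq_inv_iff_mul_eq_one, ← derExp_add, ← derExp_zero]
  exact congrArg derExp (neg_add_cancel h)

theorem Pt.inl_eq_map_ofId (x : Pt K A K) :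
    x.inl = Pt.map (Algebra.ofId K (DualNumber K)) x := by
  rw [Pt.inl, Subsingleton.elim (TrivSqZeroExt.inlAlgHom K K K) (Algebra.ofId K (DualNumber K))]

theorem inl_mul_derExp (g : Pt K A K) (h : lieDer K A) :
    g.inl * derExp h = derExp (Ad g h) * g.inl := by
  rw [← mul_inv_eq_iff_eq_mul]
  have h1 := comp_conjHom g (derExp h)
  rw [← Pt.inl_eq_map_ofId] at h1
  apply Pt.dual_ext
  · rw [Pt.fst_mul, Pt.fst_mul, Pt.fst_inv, derExp_fst, derExp_fst, mul_one, Pt.inl_fst,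
      mul_inv_cancel]
  · ext a
    rw [Pt.snd_apply, ← h1, derExp_snd]
    change (derExp h).snd (conjHom g a) = _
    rw [derExp_snd]
    rfl

theorem Ad_neg (g : Pt K A K) (h : lieDer K A) : Ad g (-h) = -Ad g h := map_neg (Ad g) h

theorem neg_sub_Ad_neg (g : Pt K A K) (h : lieDer K A) : -h - Ad g (-h) = Ad g h - h := by
  rw [Ad_neg]; abel

theorem Ad_neg_sub_neg (g : Pt K A K) (h : lieDer K A) : Ad g (-h) - -h = h - Ad g h := by
  rw [Ad_neg]; abel

theorem lieDer_eq_sub_iff (a b c : lieDer K A) : a = b - c ↔ a + c = b :=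
  ⟨fun h => by rw [h]; abel, fun h => by rw [← h]; abel⟩

theorem derExp_conj (h α : lieDer K A) (g : Pt K A K) :
    derExp h * (derExp α * g.inl) * (derExp h)⁻¹ = derExp (α + (h - Ad g h)) * g.inl := by
  rw [mul_assoc, mul_assoc, ← derExp_neg, inl_mul_derExp, ← mul_assoc, ← mul_assoc, ← derExp_add,
    ← derExp_add, Ad_neg]
  congr 2
  abel

theorem Pt.ab_mul_congr {R : Type u} [CommRing R] [Algebra K R] {y y' z z' : Pt K A R}
    (h : y.ab = y'.ab) (h' : z.ab = z'.ab) : (y * z).ab = (y' * z').ab := by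
  have hle : abCoord K A ≤ AlgHom.equalizer (y * z).hom (y' * z').hom := by
    refine sSup_le fun C hC c hc => ?_
    have hCab : C ≤ abCoord K A := le_sSup hC
    have hl : ∀ {w w' : Pt K A R}, w.ab = w'.ab → w.hom.comp C.val = w'.hom.comp C.val := by
      intro w w' hw
      ext c
      exact DFunLike.congr_fun hw ⟨c, hCab c.2⟩
    have key : ∀ w v : Pt K A R, (w * v).hom c = Algebra.TensorProduct.lift (w.hom.comp C.val)
        (v.hom.comp C.val) (fun _ _ => .all _ _) (hC.1.comul ⟨c, hc⟩) := by
      intro w v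
      have h1 : Algebra.TensorProduct.lift (w.hom.comp C.val) (v.hom.comp C.val)
          (fun _ _ => .all _ _) = (Algebra.TensorProduct.lift w.hom v.hom (fun _ _ => .all _ _)).comp
            (Algebra.TensorProduct.map C.val C.val) := by
        ext <;> simp
      rw [h1, AlgHom.comp_apply, hC.1.val_comul]
      rfl
    change (y * z).hom c = (y' * z').hom c
    rw [key, key]
    simp only [hl h, hl h']
  ext c
  exact hle c.2

theorem Pt.inl_ab (x : Pt K A K) : x.inl.ab = (Algebra.ofId K (DualNumber K)).comp x.ab := by
  rw [Pt.inl_eq_map_ofId]; rfl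

theorem derExp_ab (h : lieDer K A) : (derExp h).ab = (1 : Pt K A (DualNumber K)).ab := by
  ext c
  · exact congrArg (fun t : Pt K A K => t.hom (c : A)) (derExp_fst h)
  · change (derExp h).snd (c : A) = 0
    rw [derExp_snd]
    have h1 := h.2.2 _ (Ideal.subset_span ⟨(c : A), c.2, rfl⟩)
    rw [map_sub, Algebra.algebraMap_eq_smul_one, map_smul,
      pointDer_one (lieDer_le_pointDer h.2), smul_zero, sub_zero] at h1
    exact h1

theorem exists_derExp_mul {y : Pt K A (DualNumber K)} {x : Pt K A K} (hfst : y.fst = x)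
    (hab : y.ab = (Algebra.ofId K (DualNumber K)).comp x.ab) :
    ∃ h : lieDer K A, y = derExp h * x.inl := by
  have h1 : (y * x⁻¹.inl).fst = 1 := by
    rw [Pt.fst_mul, Pt.inl_fst, hfst, mul_inv_cancel]
  have hD : (y * x⁻¹.inl).snd ∈ pointDer K A := by
    intro a b
    rw [Pt.snd_mul_apply, h1]
    rfl
  have hab' : ∀ c ∈ abCoord K A, (y * x⁻¹.inl).snd c = 0 := by
    intro c hc
    have h2 : (y * x⁻¹.inl).ab = (1 : Pt K A (DualNumber K)).ab := by
      rw [Pt.ab_mul_congr (hab.trans (Pt.inl_ab x).symm) rfl, ← Pt.inl_mul, mul_inv_cancel]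
      exact congrArg Pt.ab (map_one (Pt.map (TrivSqZeroExt.inlAlgHom K K K)))
    have h3 : (y * x⁻¹.inl).hom c = (1 : Pt K A (DualNumber K)).hom c :=
      DFunLike.congr_fun h2 ⟨c, hc⟩
    rw [Pt.snd_apply, h3]
    rfl
  refine ⟨⟨_, mem_lieDer_of_abCoord hD hab'⟩, ?_⟩
  rw [← mul_inv_eq_iff_eq_mul, ← Pt.inl_inv]
  exact Pt.dual_ext (by rw [h1, derExp_fst]) (by rw [derExp_snd])

theorem derExp_mul_inl_ab (h : lieDer K A) (x : Pt K A K) :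
    (derExp h * x.inl).ab = (Algebra.ofId K (DualNumber K)).comp x.ab := by
  rw [Pt.ab_mul_congr (derExp_ab h) rfl, one_mul, Pt.inl_ab]

end Exponential

section Cocycle

variable {K A Γ : Type u} [Field K] [CommRing A] [HopfAlgebra K A] [Group Γ]
  {ρ₀ : Γ →* Pt K A K}

open groupCohomology

theorem cocycle_mul (α : cocycles₁ (adRep ρ₀)) (δ δ' : Γ) :
    (α (δ * δ') : lieDer K A) = Ad (ρ₀ δ) (α δ') + α δ :=
  (mem_cocycles₁_iff (α : Γ → adRep ρ₀)).1 α.2 δ δ'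

/-- The representation over the dual numbers attached to a cocycle. -/
def liftRep (α : cocycles₁ (adRep ρ₀)) : Γ →* Pt K A (DualNumber K) :=
  MonoidHom.mk' (fun δ => derExp (α δ : lieDer K A) * (ρ₀ δ).inl) (by
    intro δ δ'
    rw [cocycle_mul, add_comm, derExp_add, map_mul, Pt.inl_mul]
    simp only [mul_assoc]
    rw [← mul_assoc (ρ₀ δ).inl, inl_mul_derExp, mul_assoc])

theorem liftRep_apply (α : cocycles₁ (adRep ρ₀)) (δ : Γ) :
    liftRep α δ = derExp (α δ : lieDer K A) * (ρ₀ δ).inl := rfl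

theorem exists_cocycle (r : Γ →* Pt K A (DualNumber K)) (hfst : ∀ δ, (r δ).fst = ρ₀ δ)
    (hab : ∀ δ, (r δ).ab = (Algebra.ofId K (DualNumber K)).comp (ρ₀ δ).ab) :
    ∃ α : cocycles₁ (adRep ρ₀), ∀ δ, r δ = liftRep α δ := by
  choose α hα using fun δ => exists_derExp_mul (hfst δ) (hab δ)
  have hmul : ∀ δ δ', α (δ * δ') = Ad (ρ₀ δ) (α δ') + α δ := by
    intro δ δ'
    apply derExp_injective
    have h := r.map_mul δ δ'
    rw [hα, hα, hα] at h
    apply mul_right_cancel (b := (ρ₀ (δ * δ')).inl)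
    rw [h, add_comm, derExp_add, map_mul, Pt.inl_mul]
    simp only [mul_assoc]
    rw [← mul_assoc (ρ₀ δ).inl, inl_mul_derExp, mul_assoc]
  have hc : (α : Γ → adRep ρ₀) ∈ cocycles₁ (adRep ρ₀) := (mem_cocycles₁_iff _).2 hmul
  exact ⟨⟨α, hc⟩, hα⟩

theorem H1π_eq_iff_exists (α β : cocycles₁ (adRep ρ₀)) :
    H1π (adRep ρ₀) α = H1π (adRep ρ₀) β ↔
      ∃ h : lieDer K A, ∀ δ, (α δ : lieDer K A) = β δ + (h - Ad (ρ₀ δ) h) := by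
  rw [H1π_eq_iff]
  constructor
  · rintro ⟨y, hy⟩
    refine ⟨-(y : lieDer K A), fun δ => ?_⟩
    have h1 : Ad (ρ₀ δ) (y : lieDer K A) - y = (α δ : lieDer K A) - β δ := congrFun hy δ
    rw [neg_sub_Ad_neg, h1]
    exact (add_sub_cancel (β δ : lieDer K A) (α δ : lieDer K A)).symm
  · rintro ⟨h, hh⟩
    refine ⟨-h, funext fun δ => ?_⟩
    change Ad (ρ₀ δ) (-h) - -h = (α δ : lieDer K A) - β δ
    rw [hh, Ad_neg_sub_neg]
    exact (add_sub_cancel_left (β δ : lieDer K A) (h - Ad (ρ₀ δ) h)).symm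

theorem resMap_H1π_eq_zero_iff {N : ℕ} (γ : Fin N → Γ) (α : cocycles₁ (adRep ρ₀)) :
    resMap ρ₀ γ (H1π (adRep ρ₀) α) = 0 ↔
      ∀ i, ∃ h : lieDer K A, (α (γ i) : lieDer K A) = h - Ad (ρ₀ (γ i)) h := by
  rw [funext_iff]
  refine forall_congr' fun i => ?_
  change (groupCohomology.map (Subgroup.zpowers (γ i)).subtype _ 1).hom (H1π (adRep ρ₀) α) = 0 ↔ _
  have h1 := H1π_comp_map_apply (Subgroup.zpowers (γ i)).subtype (CategoryTheory.CategoryStruct.id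
      (Rep.res (Subgroup.zpowers (γ i)).subtype (adRep ρ₀))) α
  refine (Eq.congr_left h1).trans ?_
  rw [H1π_eq_zero_iff]
  constructor
  · rintro ⟨y, hy⟩
    refine ⟨-(y : lieDer K A), ?_⟩
    have h2 : Ad (ρ₀ (γ i)) (y : lieDer K A) - y = (α (γ i) : lieDer K A) :=
      congrFun hy ⟨γ i, Subgroup.mem_zpowers _⟩
    rw [neg_sub_Ad_neg, h2]
  · rintro ⟨h, hh⟩
    have hone : (α 1 : lieDer K A) = 0 := cocycles₁_map_one α
    let H : Subgroup Γ :=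
      { carrier := {δ | (α δ : lieDer K A) + Ad (ρ₀ δ) h = h}
        one_mem' := by
          change (α 1 : lieDer K A) + Ad (ρ₀ 1) h = h
          rw [hone, map_one, map_one, zero_add]; rfl
        mul_mem' := by
          intro a b ha hb
          have ha' : (α a : lieDer K A) + Ad (ρ₀ a) h = h := ha
          have hb' : (α b : lieDer K A) + Ad (ρ₀ b) h = h := hb
          change (α (a * b) : lieDer K A) + Ad (ρ₀ (a * b)) h = h
          rw [cocycle_mul, map_mul, map_mul, Module.End.mul_apply, add_right_comm, ← map_add, hb',
            add_comm, ha']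
        inv_mem' := by
          intro a ha
          have ha' : (α a : lieDer K A) + Ad (ρ₀ a) h = h := ha
          change (α a⁻¹ : lieDer K A) + Ad (ρ₀ a⁻¹) h = h
          have h3 := cocycle_mul α a⁻¹ a
          rw [inv_mul_cancel, hone] at h3
          conv_lhs => rw [← ha']
          rw [map_add, ← Module.End.mul_apply, ← map_mul, ← map_mul, inv_mul_cancel, ← add_assoc,
            add_comm (α a⁻¹ : lieDer K A), ← h3, map_one, map_one, zero_add]
          rfl }
    have hle : Subgroup.zpowers (γ i) ≤ H := by
      rw [Subgroup.zpowers_le]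
      exact (lieDer_eq_sub_iff _ _ _).1 hh
    refine ⟨-h, funext fun δ => ?_⟩
    have h4 : (α δ : lieDer K A) + Ad (ρ₀ δ) h = h := hle δ.2
    change Ad (ρ₀ δ) (-h) - -h = (α δ : lieDer K A)
    rw [Ad_neg_sub_neg]
    exact ((lieDer_eq_sub_iff _ _ _).2 h4).symm

end Cocycle

/-! ### The ring `K[ε₁, ε₂]` -/

section TwoVariables

variable {K A B : Type u} [Field K] [CommRing A] [HopfAlgebra K A] [CommRing B] [Algebra K B]

variable (K) in
/-- The map `ε₂ ↦ 0`. -/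
abbrev proj₁ : TrivSqZeroExt K (K × K) →ₐ[K] DualNumber K :=
  TrivSqZeroExt.map (LinearMap.fst K K K)

variable (K) in
/-- The map `ε₁ ↦ 0`. -/
abbrev proj₂ : TrivSqZeroExt K (K × K) →ₐ[K] DualNumber K :=
  TrivSqZeroExt.map (LinearMap.snd K K K)

variable (K) in
/-- The map `ε₁, ε₂ ↦ ε`. -/
abbrev projSum : TrivSqZeroExt K (K × K) →ₐ[K] DualNumber K :=
  TrivSqZeroExt.map (LinearMap.fst K K K + LinearMap.snd K K K)

theorem proj_ext {x y : TrivSqZeroExt K (K × K)} (h₁ : proj₁ K x = proj₁ K y)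
    (h₂ : proj₂ K x = proj₂ K y) : x = y := by
  have a := congrArg TrivSqZeroExt.fst h₁
  have b := congrArg TrivSqZeroExt.snd h₁
  have c := congrArg TrivSqZeroExt.snd h₂
  simp only [TrivSqZeroExt.fst_map, TrivSqZeroExt.snd_map] at a b c
  exact TrivSqZeroExt.ext a (Prod.ext b c)

theorem comp_proj_ext {u v : B →ₐ[K] TrivSqZeroExt K (K × K)}
    (h₁ : (proj₁ K).comp u = (proj₁ K).comp v) (h₂ : (proj₂ K).comp u = (proj₂ K).comp v) :
    u = v :=
  AlgHom.ext fun b => proj_ext (DFunLike.congr_fun h₁ b) (DFunLike.congr_fun h₂ b)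

theorem Pt.proj_ext {x y : Pt K A (TrivSqZeroExt K (K × K))}
    (h₁ : Pt.map (proj₁ K) x = Pt.map (proj₁ K) y)
    (h₂ : Pt.map (proj₂ K) x = Pt.map (proj₂ K) y) : x = y :=
  Pt.ext (comp_proj_ext (congrArg Pt.hom h₁) (congrArg Pt.hom h₂))

/-- Two algebra maps to the dual numbers with the same reduction glue. -/
theorem exists_glue (u₁ u₂ : B →ₐ[K] DualNumber K)
    (h : (augmentation K K).comp u₁ = (augmentation K K).comp u₂) :
    ∃ u : B →ₐ[K] TrivSqZeroExt K (K × K),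
      (proj₁ K).comp u = u₁ ∧ (proj₂ K).comp u = u₂ := by
  have h' : ∀ b, TrivSqZeroExt.fst (u₁ b) = TrivSqZeroExt.fst (u₂ b) :=
    fun b => DFunLike.congr_fun h b
  let f : B →ₗ[K] TrivSqZeroExt K (K × K) :=
    { toFun := fun b => TrivSqZeroExt.inl (TrivSqZeroExt.fst (u₁ b)) +
        TrivSqZeroExt.inr (TrivSqZeroExt.snd (u₁ b), TrivSqZeroExt.snd (u₂ b))
      map_add' := fun a b => by ext <;> simp
      map_smul' := fun c b => by ext <;> simp }
  have hf : ∀ b, f b = TrivSqZeroExt.inl (TrivSqZeroExt.fst (u₁ b)) +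
        TrivSqZeroExt.inr (TrivSqZeroExt.snd (u₁ b), TrivSqZeroExt.snd (u₂ b)) := fun _ => rfl
  refine ⟨AlgHom.ofLinearMap f ?_ ?_, ?_, ?_⟩
  · rw [hf]; ext <;> simp
  · intro a b
    rw [hf, hf, hf]
    ext
    · simp
    · simp
    · simp [h']
  · ext b <;> simp [hf]
  · ext b <;> simp [hf, h']

variable (K) in
/-- The map `ε ↦ ε₁`. -/
abbrev incl₁ : DualNumber K →ₐ[K] TrivSqZeroExt K (K × K) :=
  TrivSqZeroExt.map (LinearMap.inl K K K)

variable (K) in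
/-- The map `ε ↦ ε₂`. -/
abbrev incl₂ : DualNumber K →ₐ[K] TrivSqZeroExt K (K × K) :=
  TrivSqZeroExt.map (LinearMap.inr K K K)

theorem map_scale_derExp (c : K) (h : lieDer K A) :
    Pt.map (TrivSqZeroExt.map (c • LinearMap.id : K →ₗ[K] K)) (derExp h) = derExp (c • h) := by
  apply Pt.dual_ext
  · refine Eq.trans ?_ ((derExp_fst h).trans (derExp_fst (c • h)).symm)
    ext a
    rw [Pt.fst_apply, Pt.fst_apply]
    exact TrivSqZeroExt.fst_map _ _
  · rw [derExp_snd]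
    ext a
    rw [Pt.snd_apply]
    have : (derExp h).snd a = h.1 a := by rw [derExp_snd]
    rw [Pt.snd_apply] at this
    simp [this]

theorem map_zero_derExp (h : lieDer K A) :
    Pt.map (TrivSqZeroExt.map (0 : K →ₗ[K] K)) (derExp h) = 1 := by
  have := map_scale_derExp 0 h
  rw [zero_smul, zero_smul, derExp_zero] at this
  exact this

/-- The point `1 + ε₁ h₁ + ε₂ h₂` of `G`. -/
def derExp₂ (h₁ h₂ : lieDer K A) : Pt K A (TrivSqZeroExt K (K × K)) :=
  Pt.map (incl₁ K) (derExp h₁) * Pt.map (incl₂ K) (derExp h₂)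

theorem trivSqZeroExt_map_comp {V W U : Type u} [AddCommGroup V] [Module K V] [Module Kᵐᵒᵖ V]
    [IsCentralScalar K V] [AddCommGroup W] [Module K W] [Module Kᵐᵒᵖ W]
    [IsCentralScalar K W] [AddCommGroup U] [Module K U] [Module Kᵐᵒᵖ U]
    [IsCentralScalar K U] (f : V →ₗ[K] W) (g : W →ₗ[K] U) :
    (TrivSqZeroExt.map g).comp (TrivSqZeroExt.map f) = TrivSqZeroExt.map (g ∘ₗ f) :=
  (TrivSqZeroExt.map_comp_map f g).symm

theorem map_id_derExp (h : lieDer K A) :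
    Pt.map (TrivSqZeroExt.map (LinearMap.id : K →ₗ[K] K)) (derExp h) = derExp h := by
  rw [TrivSqZeroExt.map_id]; rfl

theorem map_proj₁_derExp₂ (h₁ h₂ : lieDer K A) :
    Pt.map (proj₁ K) (derExp₂ h₁ h₂) = derExp h₁ := by
  rw [derExp₂, map_mul, Pt.map_map, Pt.map_map, trivSqZeroExt_map_comp, trivSqZeroExt_map_comp,
    LinearMap.fst_comp_inl, LinearMap.fst_comp_inr, map_id_derExp, map_zero_derExp, mul_one]

theorem map_proj₂_derExp₂ (h₁ h₂ : lieDer K A) :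
    Pt.map (proj₂ K) (derExp₂ h₁ h₂) = derExp h₂ := by
  rw [derExp₂, map_mul, Pt.map_map, Pt.map_map, trivSqZeroExt_map_comp, trivSqZeroExt_map_comp,
    LinearMap.snd_comp_inl, LinearMap.snd_comp_inr, map_id_derExp, map_zero_derExp, one_mul]

theorem map_projSum_derExp₂ (h₁ h₂ : lieDer K A) :
    Pt.map (projSum K) (derExp₂ h₁ h₂) = derExp (h₁ + h₂) := by
  rw [derExp₂, map_mul, Pt.map_map, Pt.map_map, trivSqZeroExt_map_comp, trivSqZeroExt_map_comp,
    LinearMap.add_comp, LinearMap.add_comp, LinearMap.fst_comp_inl, LinearMap.fst_comp_inr,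
    LinearMap.snd_comp_inl, LinearMap.snd_comp_inr, add_zero, zero_add, map_id_derExp,
    map_id_derExp, derExp_add]

theorem map_inl {R : Type u} [CommRing R] [Algebra K R] (φ : DualNumber K →ₐ[K] R) (x : Pt K A K) :
    Pt.map φ x.inl = Pt.map (Algebra.ofId K R) x := by
  rw [Pt.inl_eq_map_ofId, Pt.map_ofId]

theorem map_ofId_dual {R : Type u} [CommRing R] [Algebra K R] (φ : R →ₐ[K] DualNumber K)
    (x : Pt K A K) : Pt.map φ (Pt.map (Algebra.ofId K R) x) = x.inl := by
  rw [Pt.inl_eq_map_ofId, Pt.map_ofId]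

theorem map_proj₁_mul_ofId (h₁ h₂ : lieDer K A) (x : Pt K A K) :
    Pt.map (proj₁ K) (derExp₂ h₁ h₂ * Pt.map (Algebra.ofId K _) x) = derExp h₁ * x.inl := by
  rw [map_mul, map_proj₁_derExp₂, map_ofId_dual]

theorem map_proj₂_mul_ofId (h₁ h₂ : lieDer K A) (x : Pt K A K) :
    Pt.map (proj₂ K) (derExp₂ h₁ h₂ * Pt.map (Algebra.ofId K _) x) = derExp h₂ * x.inl := by
  rw [map_mul, map_proj₂_derExp₂, map_ofId_dual]

variable {Γ : Type u} [Group Γ] {ρ₀ : Γ →* Pt K A K}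

open groupCohomology

/-- The representation over `K[ε₁, ε₂]` attached to two cocycles. -/
def liftRep₂ (α β : cocycles₁ (adRep ρ₀)) : Γ →* Pt K A (TrivSqZeroExt K (K × K)) :=
  MonoidHom.mk' (fun δ => derExp₂ (α δ : lieDer K A) (β δ : lieDer K A) *
    Pt.map (Algebra.ofId K _) (ρ₀ δ)) (by
    intro δ δ'
    apply Pt.proj_ext
    · have h := (liftRep α).map_mul δ δ'
      rw [liftRep_apply, liftRep_apply, liftRep_apply] at h
      rw [map_proj₁_mul_ofId, (Pt.map (proj₁ K)).map_mul, map_proj₁_mul_ofId,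
        map_proj₁_mul_ofId, h]
    · have h := (liftRep β).map_mul δ δ'
      rw [liftRep_apply, liftRep_apply, liftRep_apply] at h
      rw [map_proj₂_mul_ofId, (Pt.map (proj₂ K)).map_mul, map_proj₂_mul_ofId,
        map_proj₂_mul_ofId, h])

theorem liftRep₂_apply (α β : cocycles₁ (adRep ρ₀)) (δ : Γ) : liftRep₂ α β δ =
    derExp₂ (α δ : lieDer K A) (β δ : lieDer K A) * Pt.map (Algebra.ofId K _) (ρ₀ δ) := rfl

theorem map_proj₁_liftRep₂ (α β : cocycles₁ (adRep ρ₀)) (δ : Γ) :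
    Pt.map (proj₁ K) (liftRep₂ α β δ) = liftRep α δ := by
  rw [liftRep₂_apply, map_proj₁_mul_ofId, liftRep_apply]

theorem map_proj₂_liftRep₂ (α β : cocycles₁ (adRep ρ₀)) (δ : Γ) :
    Pt.map (proj₂ K) (liftRep₂ α β δ) = liftRep β δ := by
  rw [liftRep₂_apply, map_proj₂_mul_ofId, liftRep_apply]

theorem map_projSum_liftRep₂ (α β : cocycles₁ (adRep ρ₀)) (δ : Γ) :
    Pt.map (projSum K) (liftRep₂ α β δ) = liftRep (α + β) δ := by
  rw [liftRep₂_apply, map_mul, map_projSum_derExp₂, map_ofId_dual, liftRep_apply]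
  rfl

theorem map_scale_liftRep (c : K) (α : cocycles₁ (adRep ρ₀)) (δ : Γ) :
    Pt.map (TrivSqZeroExt.map (c • LinearMap.id : K →ₗ[K] K)) (liftRep α δ) =
      liftRep (c • α) δ := by
  rw [liftRep_apply, map_mul, map_scale_derExp, map_inl, ← Pt.inl_eq_map_ofId, liftRep_apply]
  rfl

theorem liftRep_ab (α : cocycles₁ (adRep ρ₀)) (δ : Γ) :
    (liftRep α δ).ab = (Algebra.ofId K (DualNumber K)).comp (abelianization ρ₀ δ) :=
  derExp_mul_inl_ab _ _

theorem liftRep_fst (α : cocycles₁ (adRep ρ₀)) (δ : Γ) : (liftRep α δ).fst = ρ₀ δ := by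
  rw [liftRep_apply, Pt.fst_mul, derExp_fst, Pt.inl_fst, one_mul]

theorem liftRep₂_ab (α β : cocycles₁ (adRep ρ₀)) (δ : Γ) :
    (liftRep₂ α β δ).ab = (Algebra.ofId K _).comp (abelianization ρ₀ δ) := by
  apply comp_proj_ext
  · rw [← Pt.map_ab, map_proj₁_liftRep₂, liftRep_ab, ← AlgHom.comp_assoc]
    exact congrArg (AlgHom.comp · _) (Subsingleton.elim _ _)
  · rw [← Pt.map_ab, map_proj₂_liftRep₂, liftRep_ab, ← AlgHom.comp_assoc]
    exact congrArg (AlgHom.comp · _) (Subsingleton.elim _ _)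

theorem augmentation_comp_map {V W : Type u} [AddCommGroup V] [Module K V] [Module Kᵐᵒᵖ V]
    [IsCentralScalar K V] [AddCommGroup W] [Module K W] [Module Kᵐᵒᵖ W]
    [IsCentralScalar K W] (f : V →ₗ[K] W) :
    (augmentation K W).comp (TrivSqZeroExt.map f) = augmentation K V :=
  TrivSqZeroExt.fstHom_comp_map f

theorem liftRep₂_aug (α β : cocycles₁ (adRep ρ₀)) (δ : Γ) :
    Pt.map (augmentation K (K × K)) (liftRep₂ α β δ) = ρ₀ δ := by
  rw [← augmentation_comp_map (LinearMap.fst K K K), ← Pt.map_map, map_proj₁_liftRep₂]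
  exact liftRep_fst α δ

theorem isNilpotent_of_augmentation_eq_zero {V : Type u} [AddCommGroup V] [Module K V]
    [Module Kᵐᵒᵖ V] [IsCentralScalar K V] (x : TrivSqZeroExt K V) (hx : augmentation K V x = 0) :
    IsNilpotent x := by
  refine ⟨2, ?_⟩
  have h : x.fst = 0 := hx
  rw [pow_two]
  ext <;> simp [h]

end TwoVariables

/-! ### The class of a tangent vector -/

section Class

variable {K A Γ : Type u} [Field K] [CommRing A] [HopfAlgebra K A] [Group Γ]
  {N : ℕ} {ρ₀ : Γ →* Pt K A K} {γ : Fin N → Γ} {𝒦 : Fin N → ConjClass K A}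
  {R : Type u} [CommRing R] [Algebra K R] {aug : R →ₐ[K] K}

open groupCohomology

theorem IsSplitConnectedReductive.finiteType (hG : IsSplitConnectedReductive K A) :
    Algebra.FiniteType K A := by
  have := hG.smooth
  infer_instance

theorem IsSplitConnectedReductive.isDomain [CharZero K] (hG : IsSplitConnectedReductive K A) :
    IsDomain A := by
  have := hG.finiteType
  have := hG.connected
  exact isDomain_of_connected (K := K)

theorem isLeftCoideal_adCoord : IsLeftCoideal (adCoord K A) := by
  intro c hc
  obtain ⟨x, hx⟩ := (adCoord_isHopf K A).comul_mem c hc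
  refine ⟨Algebra.TensorProduct.map (adCoord K A).val (AlgHom.id K _) x, ?_⟩
  rw [← hx]
  have h : (Algebra.TensorProduct.map (AlgHom.id K A) (adCoord K A).val).comp
      (Algebra.TensorProduct.map (adCoord K A).val (AlgHom.id K _)) =
      Algebra.TensorProduct.map (adCoord K A).val (adCoord K A).val := by
    rw [← Algebra.TensorProduct.map_comp]; rfl
  exact DFunLike.congr_fun h x

theorem expPt_conj_eq [CharZero K] (hG : IsSplitConnectedReductive K A) {D : A →ₗ[K] K}
    (hD : D ∈ pointDer K A) : ∃ h : lieDer K A, ∀ y : Pt K A (DualNumber K),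
      expPt hD * y * (expPt hD)⁻¹ = derExp h * y * (derExp h)⁻¹ := by
  obtain ⟨z, hz, h, hh, hc, rfl⟩ := exists_central_add_lieDer hG hD
  refine ⟨⟨h, hh⟩, fun y => ?_⟩
  have h1 : expPt hD = expPt hz * derExp ⟨h, hh⟩ := (expPt_mul hz (lieDer_le_pointDer hh)).symm
  have h2 := expPt_commute_of_central hz hc (derExp ⟨h, hh⟩ * y * (derExp ⟨h, hh⟩)⁻¹)
  rw [h1, mul_inv_rev]
  have h3 := h2.eq
  rw [← mul_inv_eq_iff_eq_mul] at h3
  rw [← h3]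
  group

theorem exists_lieDer_adAct [CharZero K] (hG : IsSplitConnectedReductive K A)
    (t : Pt K (adCoord K A) (DualNumber K)) (ht : Pt.map (augmentation K K) t = 1) :
    ∃ h : lieDer K A, ∀ y, adAct t y = derExp h * y * (derExp h)⁻¹ := by
  have := hG.isDomain
  obtain ⟨D, hD, hDt⟩ := isLeftCoideal_adCoord.exists_pointDer t.hom
    (fun c => congrArg (fun x : Pt K (adCoord K A) K => x.hom c) ht)
  have h1 : t = toAd (expPt hD) := by
    ext c
    · refine (congrArg (fun x : Pt K (adCoord K A) K => x.hom c) ht).trans ?_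
      exact (congrArg (fun x : Pt K A K => x.hom (c : A)) (expPt_fst hD)).symm
    · refine (hDt c).symm.trans ?_
      exact (LinearMap.congr_fun (expPt_snd hD) (c : A)).symm
  obtain ⟨h, hh⟩ := expPt_conj_eq hG hD
  exact ⟨h, fun y => by rw [h1, adAct_toAd, hh]⟩

/-- The section `s` over `φ : R → K[ε]` realizes the deformation of `ρ₀` given by the cocycle `α`. -/
structure Deformation.Realizes (X : Deformation ρ₀ γ 𝒦 R aug) (φ : R →ₐ[K] DualNumber K)
    (s : X.obj.B →ₐ[K] DualNumber K) (α : cocycles₁ (adRep ρ₀)) : Prop where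
  isSection : X.IsSection (augmentation K K) φ s
  map_rep : ∀ δ, Pt.map s (X.obj.ρ δ) = liftRep α δ

theorem Deformation.IsSection.exists_realizes {X : Deformation ρ₀ γ 𝒦 R aug}
    {φ : R →ₐ[K] DualNumber K} {s : X.obj.B →ₐ[K] DualNumber K}
    (hs : X.IsSection (augmentation K K) φ s) : ∃ α, X.Realizes φ s α := by
  obtain ⟨α, hα⟩ := exists_cocycle (ρ₀ := ρ₀) ((Pt.map s).comp X.obj.ρ) (fun δ => hs.map_aug δ)
    (fun δ => by
      change (Pt.map s (X.obj.ρ δ)).ab = _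
      rw [Pt.map_ab, X.obj.ab_eq, ← AlgHom.comp_assoc]
      exact congrArg (AlgHom.comp · _) (Subsingleton.elim _ _))
  exact ⟨α, hs, hα⟩

theorem Deformation.Realizes.H1π_eq [CharZero K] (hG : IsSplitConnectedReductive K A)
    {X : Deformation ρ₀ γ 𝒦 R aug} {φ : R →ₐ[K] DualNumber K}
    {s s' : X.obj.B →ₐ[K] DualNumber K} {α α' : cocycles₁ (adRep ρ₀)}
    (h : X.Realizes φ s α) (h' : X.Realizes φ s' α') :
    H1π (adRep ρ₀) α = H1π (adRep ρ₀) α' := by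
  obtain ⟨t, ht, hts⟩ := h'.isSection.exists_act h.isSection
  obtain ⟨D, hD⟩ := exists_lieDer_adAct hG t ht
  rw [H1π_eq_iff_exists]
  refine ⟨D, fun δ => derExp_injective (mul_right_cancel (b := (ρ₀ δ).inl) ?_)⟩
  have h1 := hts δ
  rw [h.map_rep, h'.map_rep, hD, liftRep_apply, liftRep_apply, derExp_conj] at h1
  exact h1

/-- Every cocycle in the class of a realized cocycle is realized. -/
theorem Deformation.Realizes.exists_of_H1π_eq
    {X : Deformation ρ₀ γ 𝒦 R aug} {φ : R →ₐ[K] DualNumber K}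
    {s : X.obj.B →ₐ[K] DualNumber K} {α α' : cocycles₁ (adRep ρ₀)}
    (h : X.Realizes φ s α) (hα : H1π (adRep ρ₀) α' = H1π (adRep ρ₀) α) :
    ∃ s', X.Realizes φ s' α' := by
  obtain ⟨D, hD⟩ := (H1π_eq_iff_exists α' α).1 hα
  refine ⟨X.obj.act (toAd (derExp D)) s, ⟨?_, ?_⟩, fun δ => ?_⟩
  · rw [X.obj.act_comp_p, h.isSection.comp_p]
  · rw [X.obj.comp_act, map_toAd]
    have h1 : Pt.map (augmentation K K) (derExp D) = 1 := derExp_fst D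
    rw [h1, toAd_one, X.obj.act_one, h.isSection.aug_comp]
  · rw [X.obj.map_act, adAct_toAd, h.map_rep, liftRep_apply, derExp_conj, liftRep_apply, ← hD]

theorem TangentVector.exists_realizes [CharZero K] (hG : IsSplitConnectedReductive K A)
    (X : TangentVector ρ₀ γ 𝒦) : ∃ s α, X.Realizes (AlgHom.id K _) s α := by
  have := hG.isDomain
  obtain ⟨s, h1, h2⟩ := X.isMark.exists_section
  obtain ⟨α, hα⟩ := Deformation.IsSection.exists_realizes (X := X) ⟨h1, h2⟩
  exact ⟨s, α, hα⟩

theorem TangentVector.hasClass_iff (X : TangentVector ρ₀ γ 𝒦) (c : H1 (adRep ρ₀)) :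
    X.HasClass c ↔ ∃ s α, X.Realizes (AlgHom.id K _) s α ∧ H1π (adRep ρ₀) α = c := by
  have key : ∀ (s : X.obj.B →ₐ[K] DualNumber K) (α : cocycles₁ (adRep ρ₀)),
      X.IsSection (augmentation K K) (AlgHom.id K _) s →
      ((∀ (δ : Γ) (a : A), (α δ : lieDer K A).1 a = TrivSqZeroExt.snd ((Pt.map s (X.obj.ρ δ) *
        (Pt.map (Algebra.ofId K (DualNumber K)) (ρ₀ δ))⁻¹).hom a)) ↔
        ∀ δ, Pt.map s (X.obj.ρ δ) = liftRep α δ) := by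
    intro s α hs
    refine forall_congr' fun δ => ?_
    have h1 : (Pt.map s (X.obj.ρ δ) * (ρ₀ δ).inl⁻¹).fst = 1 := by
      rw [Pt.fst_mul, Pt.fst_inv, Pt.inl_fst]
      exact mul_inv_eq_one.2 (hs.map_aug δ)
    rw [← Pt.inl_eq_map_ofId, liftRep_apply, ← mul_inv_eq_iff_eq_mul]
    constructor
    · intro h
      refine Pt.dual_ext (by rw [h1, derExp_fst]) ?_
      rw [derExp_snd]
      exact LinearMap.ext fun a => (h a).symm
    · intro h a
      rw [h]
      exact (LinearMap.congr_fun (derExp_snd (α δ : lieDer K A)) a).symm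
  constructor
  · rintro ⟨s, α, h1, h2, h3, h4⟩
    exact ⟨s, α, ⟨⟨h1, h2⟩, (key s α ⟨h1, h2⟩).1 h3⟩, h4⟩
  · rintro ⟨s, α, ⟨h1, h2⟩, h3⟩
    exact ⟨s, α, h1.1, h1.2, (key s α h1).2 h2, h3⟩

theorem Deformation.Realizes.mem_ker [CharZero K] (hG : IsSplitConnectedReductive K A)
    (hconj : ∀ i, (𝒦 i).Mem (ρ₀ (γ i)))
    {X : Deformation ρ₀ γ 𝒦 R aug} {φ : R →ₐ[K] DualNumber K}
    {s : X.obj.B →ₐ[K] DualNumber K} {α : cocycles₁ (adRep ρ₀)} (h : X.Realizes φ s α) :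
    H1π (adRep ρ₀) α ∈ LinearMap.ker (resMap ρ₀ γ) := by
  have := hG.isDomain
  have := hG.finiteType
  rw [LinearMap.mem_ker, resMap_H1π_eq_zero_iff]
  intro i
  have hfst : (liftRep α (γ i)).fst = ρ₀ (γ i) := liftRep_fst α _
  obtain ⟨D, hD, hy⟩ := ConjClass.exists_pointDer (𝒦 := 𝒦 i) (y := liftRep α (γ i))
    (by rw [hfst]; exact hconj i) (fun a ha => by
      rw [← h.map_rep, Pt.map_hom, AlgHom.comp_apply, (X.inModuli.conj i).1 a ha, map_zero])
  obtain ⟨D', hD'⟩ := expPt_conj_eq hG hD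
  refine ⟨D', derExp_injective (mul_right_cancel (b := (ρ₀ (γ i)).inl) ?_)⟩
  rw [hfst, hD'] at hy
  have h1 := derExp_conj D' 0 (ρ₀ (γ i))
  rw [derExp_zero, one_mul, zero_add] at h1
  rw [← h1, ← hy, liftRep_apply]

theorem exists_conj_of_mem_ker {α : cocycles₁ (adRep ρ₀)}
    (hα : H1π (adRep ρ₀) α ∈ LinearMap.ker (resMap ρ₀ γ)) (i : Fin N) : ∃ h : lieDer K A,
      liftRep α (γ i) = derExp h * (ρ₀ (γ i)).inl * (derExp h)⁻¹ := by
  rw [LinearMap.mem_ker, resMap_H1π_eq_zero_iff] at hα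
  obtain ⟨h, hh⟩ := hα i
  have h1 := derExp_conj h 0 (ρ₀ (γ i))
  rw [derExp_zero, one_mul, zero_add] at h1
  exact ⟨h, by rw [h1, liftRep_apply, hh]⟩

theorem exists_tangentVector [CharZero K] (hG : IsSplitConnectedReductive K A)
    (hirr : IsGIrreducible ρ₀) (hconj : ∀ i, (𝒦 i).Mem (ρ₀ (γ i))) {α : cocycles₁ (adRep ρ₀)}
    (hα : H1π (adRep ρ₀) α ∈ LinearMap.ker (resMap ρ₀ γ)) :
    ∃ (X : TangentVector ρ₀ γ 𝒦) (s : _), X.Realizes (AlgHom.id K _) s α := by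
  have := hG.isDomain
  have := hG.finiteType
  obtain ⟨X, s, hs, hρ⟩ := exists_deformation (aug := augmentation K K) hirr hconj
    isNilpotent_of_augmentation_eq_zero (liftRep α) (liftRep_ab α) (liftRep_fst α) (fun i => by
      obtain ⟨h, hh⟩ := exists_conj_of_mem_ker hα i
      exact ⟨derExp h, by rw [hh, Pt.inl_eq_map_ofId]⟩)
  exact ⟨X, s, hs, hρ⟩

theorem exists_deformation₂ [CharZero K] (hG : IsSplitConnectedReductive K A)
    (hirr : IsGIrreducible ρ₀) (hconj : ∀ i, (𝒦 i).Mem (ρ₀ (γ i))) {α β : cocycles₁ (adRep ρ₀)}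
    (hα : H1π (adRep ρ₀) α ∈ LinearMap.ker (resMap ρ₀ γ))
    (hβ : H1π (adRep ρ₀) β ∈ LinearMap.ker (resMap ρ₀ γ)) :
    ∃ (X : Deformation ρ₀ γ 𝒦 (TrivSqZeroExt K (K × K)) (augmentation K (K × K)))
      (s : X.obj.B →ₐ[K] TrivSqZeroExt K (K × K)),
      X.IsSection (augmentation K (K × K)) (AlgHom.id K _) s ∧
        ∀ δ, Pt.map s (X.obj.ρ δ) = liftRep₂ α β δ := by
  have := hG.isDomain
  have := hG.finiteType
  refine exists_deformation hirr hconj isNilpotent_of_augmentation_eq_zero (liftRep₂ α β)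
    (liftRep₂_ab α β) (liftRep₂_aug α β) (fun i => ?_)
  obtain ⟨h, hh⟩ := exists_conj_of_mem_ker hα i
  obtain ⟨h', hh'⟩ := exists_conj_of_mem_ker hβ i
  refine ⟨derExp₂ h h', Pt.proj_ext ?_ ?_⟩
  · rw [map_proj₁_liftRep₂, hh, map_mul, map_mul, map_inv, map_proj₁_derExp₂, map_ofId_dual]
  · rw [map_proj₂_liftRep₂, hh', map_mul, map_mul, map_inv, map_proj₂_derExp₂, map_ofId_dual]

/-- Points of a pullback induce points of the original deformation that realize the same cocycle. -/
theorem Deformation.IsPullback.exists_realizes {φ : R →ₐ[K] DualNumber K}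
    {X : Deformation ρ₀ γ 𝒦 R aug} {Y : TangentVector ρ₀ γ 𝒦} (h : X.IsPullback φ Y)
    {s : Y.obj.B →ₐ[K] DualNumber K} {α : cocycles₁ (adRep ρ₀)}
    (hs : Y.Realizes (AlgHom.id K _) s α) : ∃ s', X.Realizes φ s' α := by
  obtain ⟨h, hh, hm⟩ := h
  refine ⟨s.comp h, hs.isSection.comp_isHom hh hm, fun δ => ?_⟩
  rw [← Pt.map_map, hh.rep, hs.map_rep]

theorem TangentVector.isSMul_iff [CharZero K] (hG : IsSplitConnectedReductive K A) (c : K)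
    {X Y : TangentVector ρ₀ γ 𝒦} {s t α β} (hX : X.Realizes (AlgHom.id K _) s α)
    (hY : Y.Realizes (AlgHom.id K _) t β) :
    TangentVector.IsSMul c X Y ↔ H1π (adRep ρ₀) β = c • H1π (adRep ρ₀) α := by
  have haug : (augmentation K K).comp (TrivSqZeroExt.map (c • LinearMap.id : K →ₗ[K] K)) =
      augmentation K K := augmentation_comp_map _
  have hlin : c • H1π (adRep ρ₀) α = H1π (adRep ρ₀) (c • α) := ((H1π (adRep ρ₀)).hom.map_smul c α).symm
  rw [hlin]
  constructor
  · intro h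
    obtain ⟨t', ht'⟩ := Deformation.IsPullback.exists_realizes h hY
    refine ht'.H1π_eq hG (s' := (TrivSqZeroExt.map (c • LinearMap.id)).comp s)
      ⟨hX.isSection.comp _ haug, fun δ => ?_⟩
    rw [← Pt.map_map, hX.map_rep, map_scale_liftRep]
  · intro h
    obtain ⟨t', ht'⟩ := hY.exists_of_H1π_eq h.symm
    refine Deformation.isPullback_of_sections haug hX.isSection ht'.isSection fun δ => ?_
    rw [ht'.map_rep, ← Pt.map_map, hX.map_rep, map_scale_liftRep]

theorem TangentVector.isAdd_iff [CharZero K] (hG : IsSplitConnectedReductive K A)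
    (hirr : IsGIrreducible ρ₀) (hconj : ∀ i, (𝒦 i).Mem (ρ₀ (γ i)))
    {X₁ X₂ Y : TangentVector ρ₀ γ 𝒦} {s₁ s₂ t α₁ α₂ β}
    (h₁ : X₁.Realizes (AlgHom.id K _) s₁ α₁) (h₂ : X₂.Realizes (AlgHom.id K _) s₂ α₂)
    (hY : Y.Realizes (AlgHom.id K _) t β) :
    TangentVector.IsAdd X₁ X₂ Y ↔
      H1π (adRep ρ₀) β = H1π (adRep ρ₀) α₁ + H1π (adRep ρ₀) α₂ := by
  have hlin : H1π (adRep ρ₀) α₁ + H1π (adRep ρ₀) α₂ = H1π (adRep ρ₀) (α₁ + α₂) :=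
    ((H1π (adRep ρ₀)).hom.map_add α₁ α₂).symm
  rw [hlin]
  constructor
  · rintro ⟨W, hW₁, hW₂, hW₃⟩
    obtain ⟨u₁, hu₁⟩ := hW₁.exists_realizes h₁
    obtain ⟨u₂, hu₂⟩ := hW₂.exists_realizes h₂
    obtain ⟨u₃, hu₃⟩ := hW₃.exists_realizes hY
    obtain ⟨u, e₁, e₂⟩ := exists_glue u₁ u₂
      (by rw [hu₁.isSection.aug_comp, hu₂.isSection.aug_comp])
    have hsec : W.IsSection (augmentation K (K × K)) (AlgHom.id K _) u := by
      refine ⟨comp_proj_ext ?_ ?_, ?_⟩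
      · rw [← AlgHom.comp_assoc, e₁, hu₁.isSection.comp_p]; rfl
      · rw [← AlgHom.comp_assoc, e₂, hu₂.isSection.comp_p]; rfl
      · refine (congrArg (AlgHom.comp · u)
          (augmentation_comp_map (LinearMap.fst K K K)).symm).trans ?_
        rw [AlgHom.comp_assoc, e₁, hu₁.isSection.aug_comp]
    have hrep : ∀ δ, Pt.map u (W.obj.ρ δ) = liftRep₂ α₁ α₂ δ := by
      intro δ
      apply Pt.proj_ext
      · rw [Pt.map_map, e₁, hu₁.map_rep, map_proj₁_liftRep₂]
      · rw [Pt.map_map, e₂, hu₂.map_rep, map_proj₂_liftRep₂]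
    have hsum := hsec.comp (aug'' := augmentation K K) (projSum K)
      (augmentation_comp_map (LinearMap.fst K K K + LinearMap.snd K K K))
    rw [AlgHom.comp_id] at hsum
    refine hu₃.H1π_eq hG ⟨hsum, fun δ => ?_⟩
    rw [← Pt.map_map, hrep, map_projSum_liftRep₂]
  · intro h
    obtain ⟨t', ht'⟩ := hY.exists_of_H1π_eq h.symm
    obtain ⟨W, u, hu, hrep⟩ := exists_deformation₂ hG hirr hconj (h₁.mem_ker hG hconj)
      (h₂.mem_ker hG hconj)
    refine ⟨W, ?_, ?_, ?_⟩
    · refine Deformation.isPullback_of_sections (φ := proj₁ K)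
        (augmentation_comp_map (LinearMap.fst K K K)) hu h₁.isSection fun δ => ?_
      rw [h₁.map_rep, ← Pt.map_map, hrep, map_proj₁_liftRep₂]
    · refine Deformation.isPullback_of_sections (φ := proj₂ K)
        (augmentation_comp_map (LinearMap.snd K K K)) hu h₂.isSection fun δ => ?_
      rw [h₂.map_rep, ← Pt.map_map, hrep, map_proj₂_liftRep₂]
    · refine Deformation.isPullback_of_sections (φ := projSum K)
        (augmentation_comp_map (LinearMap.fst K K K + LinearMap.snd K K K)) hu ht'.isSection
        fun δ => ?_
      rw [ht'.map_rep, ← Pt.map_map, hrep, map_projSum_liftRep₂]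

theorem TangentVector.iso_iff [CharZero K] (hG : IsSplitConnectedReductive K A)
    {X Y : TangentVector ρ₀ γ 𝒦} {s t α β} (hX : X.Realizes (AlgHom.id K _) s α)
    (hY : Y.Realizes (AlgHom.id K _) t β) :
    X.Iso Y ↔ H1π (adRep ρ₀) α = H1π (adRep ρ₀) β := by
  constructor
  · rintro ⟨e, he, hm⟩
    obtain ⟨t', ht'⟩ := Deformation.IsPullback.exists_realizes
      (X := X) (φ := AlgHom.id K _) ⟨_, he, hm⟩ hY
    exact hX.H1π_eq hG ht'
  · intro h
    obtain ⟨t', ht'⟩ := hY.exists_of_H1π_eq h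
    exact Deformation.iso_of_sections hX.isSection ht'.isSection fun δ => by
      rw [ht'.map_rep, hX.map_rep]

end Class

end RepModuli

end

theorem proposition4p5 {K A Γ : Type u} [Field K] [CharZero K] [CommRing A] [HopfAlgebra K A]
    (hG : RepModuli.IsSplitConnectedReductive K A) [Group Γ] (hΓ : Group.FG Γ)
    {N : ℕ} (γ : Fin N → Γ) (𝒦 : Fin N → RepModuli.ConjClass K A)
    (ρ₀ : Γ →* RepModuli.Pt K A K) (hirr : RepModuli.IsGIrreducible ρ₀)
    (hconj : ∀ i, (𝒦 i).Mem (ρ₀ (γ i))) :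
    ∃ Φ : RepModuli.TangentSpace ρ₀ γ 𝒦 ≃ LinearMap.ker (RepModuli.resMap ρ₀ γ),
      (∀ (X : RepModuli.TangentVector ρ₀ γ 𝒦) (c : groupCohomology.H1 (RepModuli.adRep ρ₀)),
        X.HasClass c ↔ (Φ X.cls : groupCohomology.H1 (RepModuli.adRep ρ₀)) = c) ∧
      (∀ (c : K) (X Y : RepModuli.TangentVector ρ₀ γ 𝒦),
        RepModuli.TangentVector.IsSMul c X Y ↔ Φ Y.cls = c • Φ X.cls) ∧
      (∀ X₁ X₂ Y : RepModuli.TangentVector ρ₀ γ 𝒦,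
        RepModuli.TangentVector.IsAdd X₁ X₂ Y ↔ Φ Y.cls = Φ X₁.cls + Φ X₂.cls) := by
  choose s α hα using fun X : RepModuli.TangentVector ρ₀ γ 𝒦 =>
    RepModuli.TangentVector.exists_realizes hG X
  let cl (X : RepModuli.TangentVector ρ₀ γ 𝒦) : LinearMap.ker (RepModuli.resMap ρ₀ γ) :=
    ⟨groupCohomology.H1π (RepModuli.adRep ρ₀) (α X), (hα X).mem_ker hG hconj⟩
  let f : RepModuli.TangentSpace ρ₀ γ 𝒦 → LinearMap.ker (RepModuli.resMap ρ₀ γ) :=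
    Quotient.lift cl fun X Y h =>
      Subtype.ext ((RepModuli.TangentVector.iso_iff hG (hα X) (hα Y)).1 h)
  have hf : ∀ X : RepModuli.TangentVector ρ₀ γ 𝒦, (f X.cls).1 =
      groupCohomology.H1π (RepModuli.adRep ρ₀) (α X) := fun _ => rfl
  have hbij : Function.Bijective f := by
    constructor
    · intro x y
      refine Quotient.inductionOn₂ x y fun X Y h => Quotient.sound ?_
      exact (RepModuli.TangentVector.iso_iff hG (hα X) (hα Y)).2 (congrArg Subtype.val h)
    · rintro ⟨c, hc⟩
      induction c using groupCohomology.H1_induction_on with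
      | h β =>
        obtain ⟨X, t, ht⟩ := RepModuli.exists_tangentVector (𝒦 := 𝒦) hG hirr hconj hc
        exact ⟨X.cls, Subtype.ext ((hα X).H1π_eq hG ht)⟩
  refine ⟨Equiv.ofBijective f hbij, fun X c => ?_, fun c X Y => ?_, fun X₁ X₂ Y => ?_⟩
  · change _ ↔ (f X.cls).1 = c
    rw [RepModuli.TangentVector.hasClass_iff, hf]
    constructor
    · rintro ⟨t, β, h, rfl⟩
      exact (hα X).H1π_eq hG h
    · exact fun h => ⟨s X, α X, hα X, h⟩
  · rw [RepModuli.TangentVector.isSMul_iff hG c (hα X) (hα Y), Subtype.ext_iff]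
    rfl
  · rw [RepModuli.TangentVector.isAdd_iff hG hirr hconj (hα X₁) (hα X₂) (hα Y), Subtype.ext_iff]
    rfl
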